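/- Let $\mathbf{F}$ be a finite field with $q$ elements. Let $\mathbf{V}$ be the $\mathbf{F}$-vector space with basis $\{e_i,f_i\}_{i\ge 1}$ and the alternating form with $\langle e_i,e_j\rangle=\langle f_i,f_j\rangle=0$ and $\langle e_i,f_j\rangle=\delta_{i,j}$, and let $G$ be the group of linear automorphisms of $\mathbf{V}$ preserving the form. For a subset $A\subset\mathbf{V}$ let $G(A)\subset G$ be its pointwise stabilizer; the subgroups $G(A)$ with $A$ finite form a neighborhood basis of the identity for a topology on $G$. Let $\mathscr{O}$ be the set of all open subgroups of $G$, and let $\mathscr{E}\subset\mathscr{O}$ be the set of all $G(A)$ with $A$ finite. For $\mathscr{S}\in\{\mathscr{O},\mathscr{E}\}$, a finitary $\mathscr{S}$-smooth $\hat{G}$-set is a set with an action of some $U\in\mathscr{S}$ that has finitely many orbits and all of whose stabilizers belong to $\mathscr{S}$; we are free to shrink $U$ within $\mathscr{S}$, and isomorphisms are bijections equivariant for some smaller subgroup in $\mathscr{S}$. A measure relative to $\mathscr{S}$ valued in a commutative ring $k$ assigns to each such $X$ an element $\mu(X)\in k$ such that: $\mu(X)=\mu(Y)$ if $X\cong Y$;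 $\mu(X)=1$ if $X$ is a singleton; $\mu(X\amalg Y)=\mu(X)+\mu(Y)$; $\mu(X^g)=\mu(X)$ for $g\in G$, where $X^g$ is $X$ with the action twisted by $g$; and $\mu(Y)=\mu(X)\mu(T)$ whenever $Y\to X$ is a map of transitive $U$-sets, $U\in\mathscr{S}$, with $T$ the fiber over some point. Let $\Theta(G)$ (for $\mathscr{S}=\mathscr{O}$) and $\Theta(G;\mathbf{V})$ (for $\mathscr{S}=\mathscr{E}$) be the polynomial rings over $\mathbf{Z}$ on symbols $[X]$ modulo the ideals generated by these relations; there is a natural ring homomorphism $\Theta(G;\mathbf{V})\to\Theta(G)$, $[X]\mapsto[X]$. A measure for $G$ means a measure relative to $\mathscr{O}$. For $m,n\ge 0$ let $V_{m,n}$ be the $\mathbf{F}$-vector space of dimension $2m+n$ with a form that is symplectic on a $2m$-dimensional summand and has the complementary $n$-dimensional summand as null space; an embedding is an injective linear map respecting the forms. Let $X_{a,b}$ be the set of embeddings $V_{a,b}\to\mathbf{V}$, a transitive $G$-set with stabilizers in $\mathscr{E}$, put $x_{a,b}=[X_{a,b}]\in\Theta(G;\mathbf{V})$, let $N_{a,b}^{m,n}$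 be the number of embeddings $V_{a,b}\to V_{m,n}$, and let $$P_{a,b}(t)=q^{-e}\,t^a\prod_{i=0}^{a+b-1}(t-q^{2i})\in\mathbf{Z}[1/q][t],\qquad e=2\binom{a+b}{2}+a^2-\binom{b}{2}.$$ Then there is a ring homomorphism $\phi\colon\Theta(G;\mathbf{V})\to\mathbf{Z}[1/q][t]$ such that: 1. $\phi(x_{a,b})=P_{a,b}(t)$ for all $a,b\ge 0$, and $P_{a,b}(q^{2m})=N_{a,b}^{m,0}$ for all $a,b,m\ge 0$. Moreover $\phi$ is the counting measure: if $f\colon Y\to X$ is a map of transitive $G$-sets with stabilizers in $\mathscr{E}$ and $T$ is the fiber of $f$ over a point, then for all sufficiently large $m$ the set $\mathrm{Hom}_G(X_{m,0},X)$ is non-empty and every fiber of $\mathrm{Hom}_G(X_{m,0},Y)\to\mathrm{Hom}_G(X_{m,0},X)$ has exactly $\phi([T])(q^{2m})$ elements. 2. The induced map $\Theta(G;\mathbf{V})[1/q]\to\mathbf{Z}[1/q][t]$ is an isomorphism. 3. There is a ring isomorphism $\Phi\colon\Theta(G)\otimes\mathbf{Q}\to\mathbf{Q}[t]$ induced by $\phi$,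 i.e. whose composition with $\Theta(G;\mathbf{V})\to\Theta(G)\otimes\mathbf{Q}$ is $\phi$ followed by $\mathbf{Z}[1/q][t]\subset\mathbf{Q}[t]$. 4. Let $k$ be a field of characteristic $0$. For $t_0\in k$ let $\mu_{t_0}(X)$ be the value of the polynomial $\Phi([X]\otimes 1)$ at $t_0$. Then $\mu_{t_0}$ is a measure for $G$ valued in $k$ with $\mu_{t_0}(\mathbf{V})=t_0$, and every $k$-valued measure $\mu$ for $G$ equals $\mu_{t_0}$ with $t_0=\mu(\mathbf{V})$. -/

import Mathlib

universe u v w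

open scoped TensorProduct

/-! ### Measures on oligomorphic groups -/

namespace Olig

section Basic
variable (G : Type u) [Group G] (Ω : Type v) [MulAction G Ω]

/-- The open subgroups of `G`, for the topology of pointwise convergence on `Ω`: a neighborhood
basis of the identity is given by the pointwise stabilizers `G(A)` of the finite subsets `A`. -/
def openSubgroups : Set (Subgroup G) :=
  {U | ∃ A : Set Ω, A.Finite ∧ fixingSubgroup G A ≤ U}

/-- The stabilizer class `ℰ(Ω)`: all subgroups `G(A)` with `A` a finite subset of `Ω`. -/
def stabClass : Set (Subgroup G) :=
  {U | ∃ A : Set Ω, A.Finite ∧ U = fixingSubgroup G A}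

theorem stabClass_subset : stabClass G Ω ⊆ openSubgroups G Ω := by
  rintro _ ⟨A, hA, rfl⟩
  exact ⟨A, hA, le_rfl⟩

theorem top_mem_stabClass : (⊤ : Subgroup G) ∈ stabClass G Ω :=
  ⟨∅, Set.finite_empty, by
    ext g
    simp⟩

end Basic

section Hat
variable {G : Type u} [Group G]

/-- A finitary `ℰ`-smooth `Ĝ`-set: a set with an action of some subgroup `grp` in `ℰ` (its group
of definition), such that all stabilizers belong to `ℰ` and there are finitely many orbits. For
`ℰ` the class of all open subgroups these are the finitary `Ĝ`-sets. -/
structure HatSet (E : Set (Subgroup G)) where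
  grp : Subgroup G
  grp_mem : grp ∈ E
  carrier : Type u
  [action : MulAction grp carrier]
  smooth : ∀ x : carrier, (MulAction.stabilizer grp x).map grp.subtype ∈ E
  finitary : Finite (MulAction.orbitRel.Quotient grp carrier)

attribute [instance] HatSet.action

namespace HatSet
variable {E : Set (Subgroup G)}

/-- `W` is contained in the groups of definition of `X` and `Y`, and `f` is `W`-equivariant. -/
def IsMap (W : Subgroup G) (X Y : HatSet E) (f : X.carrier → Y.carrier) : Prop :=
  ∃ (hX : W ≤ X.grp) (hY : W ≤ Y.grp), ∀ (g : G) (hg : g ∈ W) (x : X.carrier),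
    f ((⟨g, hX hg⟩ : X.grp) • x) = (⟨g, hY hg⟩ : Y.grp) • f x

/-- `X ≅ Y` as `Ĝ`-sets: there is a bijection that is equivariant for a common (smaller) group of
definition. -/
def Iso (X Y : HatSet E) : Prop :=
  ∃ W ∈ E, ∃ f : X.carrier → Y.carrier, Function.Bijective f ∧ IsMap W X Y f

/-- `Z ≅ X ⨿ Y` as `Ĝ`-sets. -/
def IsCoprod (X Y Z : HatSet E) : Prop :=
  ∃ W ∈ E, ∃ (i : X.carrier → Z.carrier) (j : Y.carrier → Z.carrier),
    IsMap W X Z i ∧ IsMap W Y Z j ∧ Function.Injective i ∧ Function.Injective j ∧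
      IsCompl (Set.range i) (Set.range j)

/-- `Y ≅ X^g` as `Ĝ`-sets, where `X^g` is `X` with the action of `Ĝ` twisted by `g`: the element
`g h g⁻¹` acts on `X^g` as `h` acts on `X`. -/
def IsTwist (g : G) (X Y : HatSet E) : Prop :=
  ∃ W ∈ E, ∃ (hX : W ≤ X.grp) (hY : ∀ h ∈ W, g * h * g⁻¹ ∈ Y.grp)
    (f : X.carrier → Y.carrier), Function.Bijective f ∧ ∀ (h : G) (hh : h ∈ W) (x : X.carrier),
      f ((⟨h, hX hh⟩ : X.grp) • x) = (⟨g * h * g⁻¹, hY h hh⟩ : Y.grp) • f x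

/-- `Y` and `X` are transitive `U`-sets for the same group `U`, and `T` is isomorphic, as a
`Ĝ`-set, to the fiber of some `U`-map `f : Y → X` over some point `x`. -/
def IsFiber (Y X T : HatSet E) : Prop :=
  Y.grp = X.grp ∧ Nonempty Y.carrier ∧ MulAction.IsPretransitive Y.grp Y.carrier ∧
    MulAction.IsPretransitive X.grp X.carrier ∧
    ∃ f : Y.carrier → X.carrier, IsMap Y.grp Y X f ∧ ∃ x : X.carrier,
      ∃ W ∈ E, ∃ j : T.carrier → Y.carrier, IsMap W T Y j ∧ Function.Injective j ∧
        Set.range j = f ⁻¹' {x}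

/-- A finitary `ℰ`-smooth `Ĝ`-set is also a finitary `ℰ'`-smooth one, if `ℰ ⊆ ℰ'`. -/
def ofSubset {E E' : Set (Subgroup G)} (h : E ⊆ E') (X : HatSet E) : HatSet E' where
  grp := X.grp
  grp_mem := h X.grp_mem
  carrier := X.carrier
  smooth x := h (X.smooth x)
  finitary := X.finitary

/-- A finitary `ℰ`-smooth `G`-set, as a `Ĝ`-set with group of definition `G`. -/
def ofGSet (hE : ⊤ ∈ E) (X : Type u) [MulAction G X] (hs : ∀ x : X, MulAction.stabilizer G x ∈ E)
    (hf : Finite (MulAction.orbitRel.Quotient G X)) : HatSet E where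
  grp := ⊤
  grp_mem := hE
  carrier := X
  smooth x := by
    convert hs x
    ext g
    simp [Subgroup.mem_map, MulAction.mem_stabilizer_iff, Subgroup.smul_def]
  finitary := by
    refine Finite.of_surjective (α := MulAction.orbitRel.Quotient G X)
      (Quotient.map' id ?_) ?_
    · rintro x y ⟨g, rfl⟩
      exact ⟨⟨g, trivial⟩, rfl⟩
    · rintro ⟨x⟩
      exact ⟨⟦x⟧, rfl⟩

end HatSet

section Fiber
variable {E : Set (Subgroup G)} {X Y : Type u} [MulAction G X] [MulAction G Y]

/-- The action of the stabilizer `G_x` on the fiber `f⁻¹(x)` of a map of `G`-sets. -/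
instance fiberAction (f : Y →[G] X) (x : X) :
    MulAction (MulAction.stabilizer G x) (f ⁻¹' {x} : Set Y) where
  smul g y := ⟨(g : G) • (y : Y), by
    have h1 : f y = x := y.2
    have h2 : (g : G) • x = x := g.2
    simp [h1, h2]⟩
  one_smul y := Subtype.ext (one_smul G (y : Y))
  mul_smul g h y := Subtype.ext (mul_smul (g : G) (h : G) (y : Y))

/-- The fiber over `x` of a map of `ℰ`-smooth `G`-sets, with `Y` transitive, as a `Ĝ`-set. -/
def HatSet.fiber [MulAction.IsPretransitive G Y] (f : Y →[G] X)
    (hX : ∀ x : X, MulAction.stabilizer G x ∈ E) (hY : ∀ y : Y, MulAction.stabilizer G y ∈ E)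
    (x : X) : HatSet E where
  grp := MulAction.stabilizer G x
  grp_mem := hX x
  carrier := (f ⁻¹' {x} : Set Y)
  smooth y := by
    convert hY y.1
    ext g
    simp only [Subgroup.mem_map, MulAction.mem_stabilizer_iff, Subgroup.coe_subtype]
    constructor
    · rintro ⟨g, hg, rfl⟩
      exact congrArg Subtype.val hg
    · intro hg
      refine ⟨⟨g, ?_⟩, Subtype.ext hg, rfl⟩
      have h1 : f y.1 = x := y.2
      rw [MulAction.mem_stabilizer_iff, ← h1, ← map_smul, hg]
  finitary := by
    have : MulAction.IsPretransitive (MulAction.stabilizer G x) (f ⁻¹' {x} : Set Y) := by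
      refine ⟨fun y z => ?_⟩
      obtain ⟨g, hg⟩ := MulAction.exists_smul_eq G y.1 z.1
      have h1 : f y.1 = x := y.2
      have h2 : f z.1 = x := z.2
      refine ⟨⟨g, ?_⟩, Subtype.ext hg⟩
      rw [MulAction.mem_stabilizer_iff]
      conv_lhs => rw [← h1]
      rw [← map_smul, hg, h2]
    have := (MulAction.pretransitive_iff_subsingleton_quotient
      (MulAction.stabilizer G x) (f ⁻¹' {x} : Set Y)).1 this
    infer_instance

end Fiber

/-- A measure for `G` relative to `ℰ`, valued in the commutative ring `k`. For `ℰ` the class of all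
open subgroups this is a measure for `G`. -/
structure IsMeasure {E : Set (Subgroup G)} {k : Type w} [CommRing k] (μ : HatSet E → k) :
    Prop where
  iso : ∀ X Y, HatSet.Iso X Y → μ X = μ Y
  point : ∀ X : HatSet E, Nonempty (Unique X.carrier) → μ X = 1
  coprod : ∀ X Y Z, HatSet.IsCoprod X Y Z → μ Z = μ X + μ Y
  twist : ∀ g X Y, HatSet.IsTwist g X Y → μ Y = μ X
  fiber : ∀ Y X T, HatSet.IsFiber Y X T → μ Y = μ X * μ T

/-- The relations between the symbols `[X]` that correspond to the axioms of a measure. -/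
inductive Theta.Rel (E : Set (Subgroup G)) :
    MvPolynomial (HatSet E) ℤ → MvPolynomial (HatSet E) ℤ → Prop
  | iso (X Y) : HatSet.Iso X Y → Rel E (.X X) (.X Y)
  | point (X) : Nonempty (Unique X.carrier) → Rel E (.X X) 1
  | coprod (X Y Z) : HatSet.IsCoprod X Y Z → Rel E (.X Z) (.X X + .X Y)
  | twist (g X Y) : HatSet.IsTwist g X Y → Rel E (.X Y) (.X X)
  | fiber (Y X T) : HatSet.IsFiber Y X T → Rel E (.X Y) (.X X * .X T)

/-- The ring `Θ(G; ℰ)` carrying the universal measure: the polynomial ring over `ℤ` on symbols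
`[X]`, for `X` a finitary `ℰ`-smooth `Ĝ`-set, modulo the ideal generated by the relations of a
measure. -/
abbrev Theta (E : Set (Subgroup G)) : Type (u + 1) :=
  MvPolynomial (HatSet E) ℤ ⧸ Ideal.ofRel (Theta.Rel E)

/-- The class `[X]` in `Θ(G; ℰ)`. -/
noncomputable def Theta.cls {E : Set (Subgroup G)} (X : HatSet E) : Theta E :=
  Ideal.Quotient.mk _ (.X X)

theorem Theta.mk_eq_of_rel {E : Set (Subgroup G)} {p q : MvPolynomial (HatSet E) ℤ}
    (h : Theta.Rel E p q) :
    Ideal.Quotient.mk (Ideal.ofRel (Theta.Rel E)) p = Ideal.Quotient.mk _ q :=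
  Ideal.Quotient.eq.2 (Submodule.subset_span ⟨p, q, h, sub_add_cancel p q⟩)

/-- The natural ring homomorphism `Θ(G; ℰ) → Θ(G; ℰ')`, `[X] ↦ [X]`, for `ℰ ⊆ ℰ'`. -/
noncomputable def Theta.map {E E' : Set (Subgroup G)} (h : E ⊆ E') : Theta E →+* Theta E' :=
  Ideal.Quotient.lift _ (MvPolynomial.aeval fun X => Theta.cls (X.ofSubset h)).toRingHom <| by
    intro a ha
    refine Submodule.span_induction (p := fun a _ =>
      (MvPolynomial.aeval fun X : HatSet E => Theta.cls (X.ofSubset h)).toRingHom a = 0)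
      ?_ (map_zero _) (fun x y _ _ hx hy => by rw [map_add, hx, hy, add_zero])
      (fun c x _ hx => by rw [smul_eq_mul, map_mul, hx, mul_zero]) ha
    rintro x ⟨p, q, hpq, hx⟩
    obtain rfl : x = p - q := eq_sub_of_add_eq hx
    rw [map_sub, sub_eq_zero]
    cases hpq with
    | iso X Y H =>
      obtain ⟨W, hW, f, hf⟩ := H
      simpa [Theta.cls] using Theta.mk_eq_of_rel
        (.iso (X.ofSubset h) (Y.ofSubset h) ⟨W, h hW, f, hf⟩)
    | point X H =>
      simpa [Theta.cls] using Theta.mk_eq_of_rel (.point (X.ofSubset h) H)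
    | coprod X Y Z H =>
      obtain ⟨W, hW, H⟩ := H
      simpa [Theta.cls] using Theta.mk_eq_of_rel
        (.coprod (X.ofSubset h) (Y.ofSubset h) (Z.ofSubset h) ⟨W, h hW, H⟩)
    | twist g X Y H =>
      obtain ⟨W, hW, H⟩ := H
      simpa [Theta.cls] using Theta.mk_eq_of_rel
        (.twist g (X.ofSubset h) (Y.ofSubset h) ⟨W, h hW, H⟩)
    | fiber Y X T H =>
      obtain ⟨h1, h2, h3, h4, f, h5, x, W, hW, h6⟩ := H
      simpa [Theta.cls] using Theta.mk_eq_of_rel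
        (.fiber (Y.ofSubset h) (X.ofSubset h) (T.ofSubset h)
          ⟨h1, h2, h3, h4, f, h5, x, W, h hW, h6⟩)

end Hat
end Olig

/-! ### The infinite symplectic group -/

namespace InfSp

section Spaces
variable (F : Type u) [Field F]

/-- The space `𝐕` with basis `e_i = (single i 1, 0)`, `f_i = (0, single i 1)`. -/
abbrev Vinf : Type u := (ℕ →₀ F) × (ℕ →₀ F)

/-- The alternating form on `𝐕` with `⟨e_i, e_j⟩ = ⟨f_i, f_j⟩ = 0` and `⟨e_i, f_j⟩ = δ_{ij}`. -/
noncomputable def formV : LinearMap.BilinForm F (Vinf F) :=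
  LinearMap.mk₂ F
    (fun v w => (v.1.sum fun i a => a * w.2 i) - (v.2.sum fun i a => a * w.1 i))
    (fun v v' w => by
      simp only [Prod.fst_add, Prod.snd_add]
      rw [Finsupp.sum_add_index' (by simp) (by intros; ring),
        Finsupp.sum_add_index' (by simp) (by intros; ring)]
      ring)
    (fun c v w => by
      simp only [Prod.smul_fst, Prod.smul_snd]
      rw [Finsupp.sum_smul_index (by simp), Finsupp.sum_smul_index (by simp)]
      simp only [mul_assoc, ← Finsupp.mul_sum, smul_eq_mul]
      ring)
    (fun v w w' => by
      simp only [Prod.fst_add, Prod.snd_add, Finsupp.add_apply, mul_add, Finsupp.sum_add]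
      ring)
    (fun c v w => by
      simp only [Prod.smul_fst, Prod.smul_snd, Finsupp.smul_apply, smul_eq_mul,
        mul_left_comm _ c, ← Finsupp.mul_sum]
      ring)

/-- The underlying space of `V_{m,n}`, of dimension `2m + n`. -/
abbrev Std (m n : ℕ) : Type u := ((Fin m → F) × (Fin m → F)) × (Fin n → F)

/-- The form of `V_{m,n}`: symplectic on the first `2m` coordinates, and the last `n` coordinates
span the null space. -/
def formStd (m n : ℕ) : LinearMap.BilinForm F (Std F m n) :=
  LinearMap.mk₂ F (fun v w => v.1.1 ⬝ᵥ w.1.2 - v.1.2 ⬝ᵥ w.1.1)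
    (fun v v' w => by simp only [Prod.fst_add, Prod.snd_add, add_dotProduct]; ring)
    (fun c v w => by simp [smul_dotProduct]; ring)
    (fun v w w' => by simp only [Prod.fst_add, Prod.snd_add, dotProduct_add]; ring)
    (fun c v w => by simp [dotProduct_smul]; ring)

/-- The infinite symplectic group: the linear automorphisms of `𝐕` that preserve the form. -/
def Sp : Subgroup (Vinf F ≃ₗ[F] Vinf F) where
  carrier := {g | ∀ v w, formV F (g v) (g w) = formV F v w}
  mul_mem' {g h} hg hh v w := by
    rw [LinearEquiv.mul_apply, LinearEquiv.mul_apply, hg, hh]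
  one_mem' _ _ := rfl
  inv_mem' {g} hg v w := by
    rw [← hg]
    change formV F (g (g.symm v)) (g (g.symm w)) = _
    simp

end Spaces

section Embeddings
variable {F : Type u} [Field F]

/-- Embeddings of spaces with a bilinear form: injective linear maps that respect the forms. -/
def Embedding {W W' : Type*} [AddCommGroup W] [Module F W] [AddCommGroup W'] [Module F W']
    (B : LinearMap.BilinForm F W) (B' : LinearMap.BilinForm F W') : Type _ :=
  {i : W →ₗ[F] W' // Function.Injective i ∧ ∀ v w, B' (i v) (i w) = B v w}

end Embeddings

section EmbX
variable (F : Type u) [Field F]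

/-- `X_{a,b}`: the set of embeddings `V_{a,b} → 𝐕`. -/
abbrev EmbX (a b : ℕ) : Type u := Embedding (formStd F a b) (formV F)

noncomputable instance (a b : ℕ) : MulAction (Sp F) (EmbX F a b) where
  smul g i := ⟨(g : Vinf F ≃ₗ[F] Vinf F).toLinearMap ∘ₗ i.1,
    (g : Vinf F ≃ₗ[F] Vinf F).injective.comp i.2.1, fun v w => (g.2 _ _).trans (i.2.2 v w)⟩
  one_smul _ := rfl
  mul_smul _ _ _ := rfl

/-- `N_{a,b}^{m,n}`: the number of embeddings `V_{a,b} → V_{m,n}`. -/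
noncomputable def numEmb (a b m n : ℕ) : ℕ := Nat.card (Embedding (formStd F a b) (formStd F m n))

end EmbX

section Witt
variable {F : Type u} [Field F]

theorem formV_apply (v w : Vinf F) : formV F v w =
    (v.1.sum fun i a => a * w.2 i) - (v.2.sum fun i a => a * w.1 i) := rfl

theorem formV_self (v : Vinf F) : formV F v v = 0 := by
  have h : v.1.sum (fun i a => a * v.2 i) = v.2.sum (fun i a => a * v.1 i) := by
    classical
    rw [Finsupp.sum_of_support_subset v.1 (s := v.1.support ∪ v.2.support)
        Finset.subset_union_left _ (by simp),
      Finsupp.sum_of_support_subset v.2 (s := v.1.support ∪ v.2.support)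
        Finset.subset_union_right _ (by simp)]
    exact Finset.sum_congr rfl fun i _ => mul_comm _ _
  rw [formV_apply, h, sub_self]

theorem formV_swap (v w : Vinf F) : formV F v w = - formV F w v := by
  have h := formV_self (v + w)
  simp only [map_add, LinearMap.add_apply, formV_self, zero_add, add_zero] at h
  exact eq_neg_of_add_eq_zero_right h

/-- Every linear functional on `𝐕` agrees on a given finite set with a pairing. -/
theorem exists_formV_eq (l : Vinf F →ₗ[F] F) (B : Set (Vinf F)) (hB : B.Finite) :
    ∃ v, ∀ b ∈ B, formV F v b = l b := by
  classical
  obtain ⟨s, hs⟩ : ∃ s : Finset ℕ, ∀ b ∈ B, b.1.support ⊆ s ∧ b.2.support ⊆ s := by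
    refine ⟨hB.toFinset.biUnion fun b => b.1.support ∪ b.2.support, fun b hb => ?_⟩
    have hb' : b ∈ hB.toFinset := by simpa using hb
    exact ⟨Finset.subset_union_left.trans
        (Finset.subset_biUnion_of_mem (fun b : Vinf F => b.1.support ∪ b.2.support) hb'),
      Finset.subset_union_right.trans
        (Finset.subset_biUnion_of_mem (fun b : Vinf F => b.1.support ∪ b.2.support) hb')⟩
  refine ⟨(Finsupp.onFinset s (fun i => if i ∈ s then l (0, Finsupp.single i 1) else 0)
      (by intro i; simp +contextual),
    Finsupp.onFinset s (fun i => if i ∈ s then - l (Finsupp.single i 1, 0) else 0)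
      (by intro i; simp +contextual)), fun b hb => ?_⟩
  obtain ⟨h1, h2⟩ := hs b hb
  have hb1 : b.1 = ∑ i ∈ s, b.1 i • Finsupp.single i (1 : F) := by
    conv_lhs => rw [← Finsupp.sum_single b.1]
    rw [Finsupp.sum_of_support_subset _ h1 _ (by simp)]
    simp
  have hb2 : b.2 = ∑ i ∈ s, b.2 i • Finsupp.single i (1 : F) := by
    conv_lhs => rw [← Finsupp.sum_single b.2]
    rw [Finsupp.sum_of_support_subset _ h2 _ (by simp)]
    simp
  have hb : b = (∑ i ∈ s, b.1 i • ((Finsupp.single i (1 : F), 0) : Vinf F))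
      + ∑ i ∈ s, b.2 i • ((0, Finsupp.single i (1 : F)) : Vinf F) := by
    refine Prod.ext ?_ ?_
    · simp only [Prod.fst_add, Prod.fst_sum, Prod.smul_fst, smul_zero, Finset.sum_const_zero,
        add_zero]
      exact hb1
    · simp only [Prod.snd_add, Prod.snd_sum, Prod.smul_snd, smul_zero, Finset.sum_const_zero,
        zero_add]
      exact hb2
  conv_rhs => rw [hb]
  simp only [map_add, map_sum, map_smul, smul_eq_mul]
  rw [formV_apply, Finsupp.onFinset_sum _ (by simp), Finsupp.onFinset_sum _ (by simp), add_comm,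
    sub_eq_add_neg, ← Finset.sum_neg_distrib]
  congr 1
  · exact Finset.sum_congr rfl fun i hi => by rw [if_pos hi, mul_comm]
  · exact Finset.sum_congr rfl fun i hi => by rw [if_pos hi]; ring

/-- The transvection `x ↦ x + c ⟨d, x⟩ d` in the symplectic group. -/
noncomputable def transv (c : F) (d : Vinf F) : Sp F :=
  ⟨LinearEquiv.transvection (f := c • formV F d) (v := d) (by simp [formV_self]), fun v w => by
    simp only [LinearEquiv.transvection.apply, map_add, LinearMap.add_apply, map_smul,
      LinearMap.smul_apply, smul_eq_mul, formV_self]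
    rw [formV_swap v d]
    ring⟩

theorem transv_apply (c : F) (d x : Vinf F) :
    transv c d • x = x + (c * formV F d x) • d := by
  exact LinearEquiv.transvection.apply (f := c • formV F d) (v := d) (by simp [formV_self]) x

/-- A transvection that fixes `A` and moves `u` to `u'`, if `⟨u', u⟩ ≠ 0`. -/
theorem exists_move_of_ne {A : Submodule F (Vinf F)} {u u' : Vinf F}
    (h : ∀ a ∈ A, formV F u a = formV F u' a) (hne : formV F u' u ≠ 0) :
    ∃ g : Sp F, (∀ a ∈ A, g • a = a) ∧ g • u = u' := by
  refine ⟨transv (formV F u' u)⁻¹ (u' - u), fun a ha => ?_, ?_⟩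
  · rw [transv_apply, map_sub, LinearMap.sub_apply, h a ha, sub_self, mul_zero, zero_smul, add_zero]
  · rw [transv_apply, map_sub, LinearMap.sub_apply, formV_self, sub_zero, inv_mul_cancel₀ hne,
      one_smul, add_sub_cancel]

theorem exists_functional {A : Submodule F (Vinf F)} {u u' : Vinf F} (hu : u ∉ A) (hu' : u' ∉ A)
    (h : ∀ a ∈ A, formV F u a = formV F u' a) (h0 : formV F u' u = 0) :
    ∃ l : Vinf F →ₗ[F] F, (∀ a ∈ A, l a = formV F u a) ∧ l u ≠ 0 ∧ l u' ≠ 0 := by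
  obtain ⟨p, hpu, hpA⟩ := Submodule.exists_le_ker_of_notMem hu
  by_cases hc : u' ∈ A ⊔ Submodule.span F {u}
  · obtain ⟨a, ha, y, hy, rfl⟩ := Submodule.mem_sup.1 hc
    obtain ⟨c, rfl⟩ := Submodule.mem_span_singleton.1 hy
    have hcne : c ≠ 0 := by
      rintro rfl
      exact hu' (by simpa using ha)
    have hua : formV F u a = 0 := by
      rw [map_add, LinearMap.add_apply, map_smul, LinearMap.smul_apply, formV_self, smul_zero,
        add_zero] at h0
      rw [formV_swap, h0, neg_zero]
    refine ⟨formV F u + p, fun b hb => ?_, ?_, ?_⟩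
    · rw [LinearMap.add_apply, LinearMap.mem_ker.1 (hpA hb), add_zero]
    · rw [LinearMap.add_apply, formV_self, zero_add]; exact hpu
    · rw [LinearMap.add_apply, map_add, map_add, map_smul, map_smul, formV_self, hua,
        LinearMap.mem_ker.1 (hpA ha)]
      simpa using ⟨hcne, hpu⟩
  · obtain ⟨r, hru, hrA⟩ := Submodule.exists_le_ker_of_notMem hc
    have hrA' : ∀ a ∈ A, r a = 0 := fun a ha => hrA (Submodule.mem_sup_left ha)
    have hr0 : r u = 0 := hrA (Submodule.mem_sup_right (Submodule.mem_span_singleton_self u))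
    refine ⟨formV F u + p + ((r u')⁻¹ * (1 - formV F u u' - p u')) • r, fun b hb => ?_, ?_, ?_⟩
    · simp [LinearMap.mem_ker.1 (hpA hb), hrA' b hb]
    · simpa [formV_self, hr0] using hpu
    · have : (r u')⁻¹ * (1 - formV F u u' - p u') * r u' = 1 - formV F u u' - p u' := by
        field_simp
      simp only [LinearMap.add_apply, LinearMap.smul_apply, smul_eq_mul, this]
      intro hh
      exact one_ne_zero (α := F) (by linear_combination hh)

theorem exists_move [Finite F] {A : Submodule F (Vinf F)} (hA : (A : Set (Vinf F)).Finite) {u u' : Vinf F}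
    (hu : u ∉ A) (hu' : u' ∉ A) (h : ∀ a ∈ A, formV F u a = formV F u' a) :
    ∃ g : Sp F, (∀ a ∈ A, g • a = a) ∧ g • u = u' := by
  by_cases h0 : formV F u' u = 0
  · obtain ⟨l, hlA, hlu, hlu'⟩ := exists_functional hu hu' h h0
    obtain ⟨x, hx⟩ := exists_formV_eq l (A ∪ {u, u'}) (hA.union (by simp))
    have hxA : ∀ a ∈ A, formV F u a = formV F x a := fun a ha => by
      rw [hx a (Or.inl ha), hlA a ha]
    obtain ⟨g, hgA, hgu⟩ := exists_move_of_ne (A := A) (u := u) (u' := x) hxA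
      (by rw [hx u (by simp)]; exact hlu)
    obtain ⟨g', hgA', hgu'⟩ := exists_move_of_ne (A := A) (u := x) (u' := u')
      (fun a ha => by rw [← hxA a ha, h a ha])
      (by rw [formV_swap, hx u' (by simp)]; exact neg_ne_zero.2 hlu')
    exact ⟨g' * g, fun a ha => by rw [mul_smul, hgA a ha, hgA' a ha],
      by rw [mul_smul, hgu, hgu']⟩
  · exact exists_move_of_ne h h0

theorem witt [Finite F] {W : Type*} [AddCommGroup W] [Module F W] [Finite W] (i j : W →ₗ[F] Vinf F)
    (hi : Function.Injective i) (hj : Function.Injective j)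
    (h : ∀ v w, formV F (i v) (i w) = formV F (j v) (j w)) :
    ∃ g : Sp F, ∀ x, g • i x = j x := by
  suffices H : ∀ s : Set W, s.Finite → ∃ g : Sp F, ∀ x ∈ Submodule.span F s, g • i x = j x by
    obtain ⟨g, hg⟩ := H Set.univ Set.finite_univ
    exact ⟨g, fun x => hg x (Submodule.subset_span trivial)⟩
  intro s hs
  induction s, hs using Set.Finite.induction_on with
  | empty => exact ⟨1, fun x hx => by
      rw [Submodule.span_empty, Submodule.mem_bot] at hx
      rw [hx, map_zero, map_zero, smul_zero]⟩
  | @insert w s _ _ ih =>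
    obtain ⟨g, hg⟩ := ih
    by_cases hw : w ∈ Submodule.span F s
    · exact ⟨g, fun x hx => hg x (by rwa [Submodule.span_insert_eq_span hw] at hx)⟩
    · have hnot : j w ∉ (Submodule.span F s).map j := by
        rintro ⟨y, hy, hyw⟩
        exact hw (hj hyw ▸ hy)
      have hnot' : g • i w ∉ (Submodule.span F s).map j := by
        rintro ⟨y, hy, hyw⟩
        rw [← hg y hy] at hyw
        exact hw (hi (MulAction.injective g hyw) ▸ hy)
      obtain ⟨g', hgA, hgw⟩ := exists_move (A := (Submodule.span F s).map j)
        ((Set.toFinite (Submodule.span F s : Set W)).image j) hnot' hnot (by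
          rintro _ ⟨y, hy, rfl⟩
          rw [← h, ← hg y hy]
          exact g.2 _ _)
      refine ⟨g' * g, fun x hx => ?_⟩
      obtain ⟨c, y, hy, rfl⟩ := Submodule.mem_span_insert.1 hx
      have h1 : (g' * g) • i w = j w := by rw [mul_smul, hgw]
      have h2 : (g' * g) • i y = j y := by
        rw [mul_smul, hg y hy]
        exact hgA _ ⟨y, hy, rfl⟩
      rw [map_add, map_add, smul_add, h2, map_smul, map_smul, smul_comm, h1]

theorem exists_smul_eq [Finite F] {a b : ℕ} (i j : EmbX F a b) : ∃ g : Sp F, g • i = j := by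
  obtain ⟨g, hg⟩ := witt i.1 j.1 i.2.1 j.2.1 fun v w => by rw [i.2.2, j.2.2]
  exact ⟨g, Subtype.ext (LinearMap.ext hg)⟩

instance [Finite F] (a b : ℕ) : MulAction.IsPretransitive (Sp F) (EmbX F a b) := ⟨exists_smul_eq⟩

end Witt

section Classes
open Olig
variable (F : Type u) [Field F]

/-- The stabilizer class `ℰ(𝐕)` of the infinite symplectic group. -/
abbrev EV : Set (Subgroup (Sp F)) := stabClass (Sp F) (Vinf F)

/-- The class of all open subgroups of the infinite symplectic group. -/
abbrev Op : Set (Subgroup (Sp F)) := openSubgroups (Sp F) (Vinf F)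

theorem stabilizer_X_mem [Finite F] {a b : ℕ} (i : EmbX F a b) :
    MulAction.stabilizer (Sp F) i ∈ EV F := by
  refine ⟨Set.range i.1, Set.finite_range _, ?_⟩
  ext g
  rw [MulAction.mem_stabilizer_iff, mem_fixingSubgroup_iff]
  constructor
  · rintro h _ ⟨x, rfl⟩
    exact LinearMap.congr_fun (congrArg Subtype.val h) x
  · intro h
    exact Subtype.ext (LinearMap.ext fun x => h _ ⟨x, rfl⟩)

theorem finite_orbits_X [Finite F] (a b : ℕ) :
    Finite (MulAction.orbitRel.Quotient (Sp F) (EmbX F a b)) := by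
  have := (MulAction.pretransitive_iff_subsingleton_quotient (Sp F) (EmbX F a b)).1 inferInstance
  infer_instance

theorem stabilizer_V_mem (v : Vinf F) : MulAction.stabilizer (Sp F) v ∈ EV F :=
  ⟨{v}, Set.finite_singleton v, by
    ext g
    simp [MulAction.mem_stabilizer_iff, mem_fixingSubgroup_iff]⟩

theorem finite_orbits_V [Finite F] : Finite (MulAction.orbitRel.Quotient (Sp F) (Vinf F)) := by
  let e : Vinf F := (Finsupp.single 0 1, 0)
  have he : e ≠ 0 := fun h => by
    have := congrArg (fun v : Vinf F => v.1 0) h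
    simp [e] at this
  refine Finite.of_surjective (fun c : Bool => (⟦if c then e else 0⟧ :
    MulAction.orbitRel.Quotient (Sp F) (Vinf F))) ?_
  rintro ⟨v⟩
  by_cases hv : v = 0
  · exact ⟨false, by subst hv; rfl⟩
  · obtain ⟨g, hg⟩ := witt (LinearMap.toSpanSingleton F (Vinf F) v)
      (LinearMap.toSpanSingleton F (Vinf F) e) (smul_left_injective F hv) (smul_left_injective F he)
      (fun x y => by simp [formV_self])
    refine ⟨true, Quotient.sound ⟨g, ?_⟩⟩
    simpa using hg 1

/-- `X_{a,b}` as a finitary `𝐕`-smooth `G`-set. -/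
noncomputable def hatX [Finite F] (a b : ℕ) : HatSet (EV F) :=
  HatSet.ofGSet (top_mem_stabClass _ _) (EmbX F a b) (stabilizer_X_mem F) (finite_orbits_X F a b)

/-- `𝐕` as a finitary `𝐕`-smooth `G`-set. -/
noncomputable def hatV [Finite F] : HatSet (EV F) :=
  HatSet.ofGSet (top_mem_stabClass _ _) (Vinf F) (stabilizer_V_mem F) (finite_orbits_V F)

/-- The ring `ℤ[1/q]`, where `q` is the cardinality of `F`. -/
abbrev Zq (F : Type u) : Type := Localization.Away (Nat.card F : ℤ)

/-- The polynomial `P_{a,b}(t) = q^{-e} t^a ∏_{i < a+b} (t - q^{2i})` over `ℤ[1/q]`, where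
`e = 2 (a+b choose 2) + a² - (b choose 2)`; this `e` is never negative. -/
noncomputable def Ppoly (a b : ℕ) : Polynomial (Zq F) :=
  Polynomial.C (IsLocalization.Away.invSelf (Nat.card F : ℤ) ^
      (2 * (a + b).choose 2 + a ^ 2 - b.choose 2)) * Polynomial.X ^ a *
    ∏ i ∈ Finset.range (a + b), (Polynomial.X - Polynomial.C ((Nat.card F : Zq F) ^ (2 * i)))

theorem isUnit_card_Zq (F : Type u) : IsUnit (Nat.card F : Zq F) := by
  simpa using IsLocalization.Away.algebraMap_isUnit (S := Zq F) (Nat.card F : ℤ)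

theorem isUnit_map_card (F : Type u) {R : Type*} [CommRing R] (φ : R →+* Polynomial (Zq F)) :
    IsUnit (φ (Nat.card F : R)) := by
  rw [map_natCast, ← map_natCast Polynomial.C]
  exact (isUnit_card_Zq F).map Polynomial.C

/-- The ring homomorphism `R[1/q] → ℤ[1/q][t]` induced by a ring homomorphism `R → ℤ[1/q][t]`. -/
noncomputable def invertCard (F : Type u) {R : Type*} [CommRing R] (φ : R →+* Polynomial (Zq F)) :
    Localization.Away (Nat.card F : R) →+* Polynomial (Zq F) :=
  Localization.awayLift (P := Polynomial (Zq F)) φ (Nat.card F : R) (isUnit_map_card F φ)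

/-- The inclusion `ℤ[1/q] → ℚ`. -/
noncomputable def zqToRat [Finite F] : Zq F →+* ℚ :=
  Localization.awayLift (Int.castRingHom ℚ) (Nat.card F : ℤ)
    (by simp [Nat.card_pos.ne'])

variable {F} in
/-- The function on finitary `Ĝ`-sets obtained by composing `[X] ↦ [X] ⊗ 1`, an isomorphism
`Φ : Θ(G) ⊗ ℚ → ℚ[t]`, and the homomorphism `ℚ[t] → k` that maps the variable to `t`. -/
noncomputable def muOf (Φ : Theta (Op F) ⊗[ℤ] ℚ ≃+* Polynomial ℚ) {k : Type w} [Field k]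
    [CharZero k] (t : k) : HatSet (Op F) → k :=
  fun Y => Polynomial.aeval t (Φ (Theta.cls Y ⊗ₜ[ℤ] 1))

end Classes
end InfSp

open Olig InfSp

/-! Everything comes from counting fixed points. Regard V_{m,0} as the span in 𝐕 of the first m
hyperbolic pairs. For a `Ĝ`-set X let `cnt X m` be the number of points of X fixed by G(V_{m,0}).
The germ of this function at m = ∞ is a measure (`isMeasure_cntGerm`).

The serious axiom is the one on fibers: for a map Y → X of transitive U-sets, the fibers over all
fixed points of X must contain equally many fixed points of Y. This holds because the elements of U
that preserve V_{m,0} act transitively on the fixed points of X. Two facts give that transitivity: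
every open subgroup has a smallest finite support B (`exists_support`), and an isometry between
subspaces of V_{m,0} extends to one that preserves V_{m,0} (`exists_extension`, which also handles
twists).

Conversely, a measure μ is controlled by μ(𝐕). The vectors with prescribed pairings with a finite
subspace A form |A| mutually isomorphic pieces of 𝐕, so each piece has measure μ(𝐕)/|A|. Removing
the finitely many points in A leaves the orbit G(A)/G(A + ⟨u⟩). Towers of such extensions give every
G(A)/G(B), so relative to ℰ(𝐕) all values lie in any subring that contains μ(𝐕) and 1/q
(`measure_mem_EV`). For a general open S with smallest support B the index [S : G(B)] is finite, and
dividing by it also gives μ(U/S) (`measure_mem_Op`).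

The two halves combine as follows. The counting germ of 𝐕 is q^{2m}, so all counting germs are
values at t = q^{2m} of polynomials in t. Such a polynomial is determined by its germ, which defines
the homomorphisms to ℤ[1/q][t] and ℚ[t]. The generation statement for the universal measure shows
that t ↦ [𝐕] is surjective onto Θ(G;𝐕)[1/q] and onto Θ(G) ⊗ ℚ. As counting is a left inverse of that
map, both are isomorphisms. Generation for a product of two measures gives uniqueness. Finally
P_{a,b}(q^{2m}) and the number of embeddings obey the same recursions, obtained by adjoining one
vector at a time. -/

namespace InfSp

/-! ### Linear conditions in a finite nondegenerate space -/

section Counting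
variable {F : Type u} [Field F] {M A : Type*} [AddCommGroup M] [Module F M] [Finite M]
  [AddCommGroup A] [Module F A] [Finite A]

/-- Nondegeneracy makes M → M* bijective by dimension, and M* → A* is onto because functionals
extend from a subspace. -/
theorem surjective_pairing {β : LinearMap.BilinForm F M} (hβ : ∀ v, (∀ w, β v w = 0) → v = 0)
    {i : A →ₗ[F] M} (hi : Function.Injective i) :
    Function.Surjective (i.dualMap ∘ₗ β : M →ₗ[F] Module.Dual F A) := by
  have : Module.Finite F M := Module.Finite.of_finite
  have : Module.Finite F A := Module.Finite.of_finite
  have h1 : Function.Injective (β : M →ₗ[F] Module.Dual F M) := by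
    refine (injective_iff_map_eq_zero (β : M →ₗ[F] Module.Dual F M)).2 fun v hv => hβ v fun w => ?_
    rw [hv, LinearMap.zero_apply]
  have h2 : Function.Surjective (β : M →ₗ[F] Module.Dual F M) :=
    (LinearMap.injective_iff_surjective_of_finrank_eq_finrank
      (Subspace.dual_finrank_eq (K := F) (V := M)).symm).1 h1
  exact (LinearMap.dualMap_surjective_of_injective hi).comp h2

theorem card_dual : Nat.card (Module.Dual F A) = Nat.card A := by
  have : Module.Finite F A := Module.Finite.of_finite
  exact Nat.card_congr (Module.Free.chooseBasis F A).toDualEquiv.symm.toEquiv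

/-- In a nondegenerate finite space, the number of vectors with prescribed pairings. -/
theorem card_solutions {β : LinearMap.BilinForm F M} (hβ : ∀ v, (∀ w, β v w = 0) → v = 0)
    {i : A →ₗ[F] M} (hi : Function.Injective i) (l : Module.Dual F A) :
    Nat.card {v : M // ∀ a, β v (i a) = l a} * Nat.card A = Nat.card M := by
  set f : M →ₗ[F] Module.Dual F A := i.dualMap ∘ₗ β with hf
  have hs := surjective_pairing hβ hi
  have hfib : ∀ l : Module.Dual F A,
      Nat.card {v : M // f v = l} = Nat.card (LinearMap.ker f) := fun l => by
    obtain ⟨v₀, hv₀⟩ := hs l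
    refine Nat.card_congr ⟨fun v => ⟨v.1 - v₀, ?_⟩, fun v => ⟨v.1 + v₀, ?_⟩, fun v => ?_, fun v => ?_⟩
    · rw [LinearMap.mem_ker, map_sub, v.2]; exact sub_eq_zero.2 hv₀.symm
    · rw [map_add, LinearMap.mem_ker.1 v.2, zero_add]; exact hv₀
    · simp
    · simp
  have h1 : Nat.card M = Nat.card (Module.Dual F A) * Nat.card (LinearMap.ker f) := by
    have : Finite (Module.Dual F A) := Finite.of_surjective _ hs
    have := Fintype.ofFinite (Module.Dual F A)
    rw [← Nat.card_congr (Equiv.sigmaFiberEquiv f), Nat.card_sigma]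
    simp [hfib]
  rw [h1, card_dual, mul_comm, ← hfib l]
  congr 1
  exact Nat.card_congr (Equiv.subtypeEquivRight fun v => by simp [hf, LinearMap.ext_iff])

end Counting

/-! ### Pointwise stabilizers of finite subspaces -/

section Fix
variable {F : Type u} [Field F]

/-- The pointwise stabilizer of a subspace. -/
noncomputable def fixG (A : Submodule F (Vinf F)) : Subgroup (Sp F) := fixingSubgroup (Sp F) (A : Set (Vinf F))

theorem mem_fixG {A : Submodule F (Vinf F)} {g : Sp F} : g ∈ fixG A ↔ ∀ a ∈ A, g • a = a := by
  simp [fixG, mem_fixingSubgroup_iff]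

theorem fixG_antitone {A B : Submodule F (Vinf F)} (h : A ≤ B) : fixG B ≤ fixG A :=
  fun _ hg => mem_fixG.2 fun a ha => mem_fixG.1 hg a (h ha)

/-- The action of the symplectic group by linear maps. -/
noncomputable def toLin (g : Sp F) : Vinf F →ₗ[F] Vinf F := (g : Vinf F ≃ₗ[F] Vinf F).toLinearMap

@[simp] theorem toLin_apply (g : Sp F) (v : Vinf F) : toLin g v = g • v := rfl

theorem formV_smul_smul (g : Sp F) (v w : Vinf F) : formV F (g • v) (g • w) = formV F v w :=
  g.2 v w

theorem fixingSubgroup_eq_fixG (s : Set (Vinf F)) :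
    fixingSubgroup (Sp F) s = fixG (Submodule.span F s) := by
  ext g
  rw [mem_fixingSubgroup_iff, mem_fixG]
  refine ⟨fun h a ha => ?_, fun h a ha => h a (Submodule.subset_span ha)⟩
  have : Submodule.span F s ≤ LinearMap.eqLocus (toLin g) LinearMap.id :=
    Submodule.span_le.2 fun a ha => h a ha
  exact this ha

theorem finite_span [Finite F] {s : Set (Vinf F)} (hs : s.Finite) : Finite (Submodule.span F s) := by
  have := Module.Finite.span_of_finite F hs
  exact Module.finite_of_finite F

theorem finite_coe (A : Submodule F (Vinf F)) [h : Finite A] : (A : Set (Vinf F)).Finite := h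

theorem mem_EV_iff [Finite F] {S : Subgroup (Sp F)} :
    S ∈ EV F ↔ ∃ A : Submodule F (Vinf F), Finite A ∧ S = fixG A := by
  constructor
  · rintro ⟨s, hs, rfl⟩
    exact ⟨_, finite_span hs, fixingSubgroup_eq_fixG s⟩
  · rintro ⟨A, hA, rfl⟩
    exact ⟨A, Set.toFinite _, rfl⟩

theorem mem_Op_iff [Finite F] {S : Subgroup (Sp F)} :
    S ∈ Op F ↔ ∃ A : Submodule F (Vinf F), Finite A ∧ fixG A ≤ S := by
  constructor
  · rintro ⟨s, hs, h⟩
    exact ⟨_, finite_span hs, fixingSubgroup_eq_fixG s ▸ h⟩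
  · rintro ⟨A, hA, h⟩
    exact ⟨A, Set.toFinite _, h⟩

theorem fixG_sup (A B : Submodule F (Vinf F)) : fixG (A ⊔ B) = fixG A ⊓ fixG B := by
  refine le_antisymm (le_inf (fixG_antitone le_sup_left) (fixG_antitone le_sup_right)) ?_
  rintro g ⟨h1, h2⟩
  refine mem_fixG.2 fun x hx => ?_
  obtain ⟨a, ha, b, hb, rfl⟩ := Submodule.mem_sup.1 hx
  rw [smul_add, mem_fixG.1 h1 a ha, mem_fixG.1 h2 b hb]

instance finite_sup (A B : Submodule F (Vinf F)) [Finite A] [Finite B] : Finite ↥(A ⊔ B) := by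
  refine Finite.of_surjective (fun p : A × B => (⟨p.1 + p.2, Submodule.add_mem_sup p.1.2 p.2.2⟩ :
    ↥(A ⊔ B))) ?_
  rintro ⟨x, hx⟩
  obtain ⟨a, ha, b, hb, rfl⟩ := Submodule.mem_sup.1 hx
  exact ⟨(⟨a, ha⟩, ⟨b, hb⟩), rfl⟩

instance finite_span_singleton [Finite F] (u : Vinf F) : Finite (Submodule.span F {u}) :=
  finite_span (Set.finite_singleton u)

theorem finite_of_le {A B : Submodule F (Vinf F)} [Finite B] (h : A ≤ B) : Finite A :=
  Finite.of_injective _ (Submodule.inclusion_injective h)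

instance finite_map (g : Sp F) (A : Submodule F (Vinf F)) [Finite A] : Finite (A.map (toLin g)) :=
  (Set.toFinite (A : Set (Vinf F))).image (toLin g)

theorem mem_map_toLin {g : Sp F} {A : Submodule F (Vinf F)} {v : Vinf F} :
    v ∈ A.map (toLin g) ↔ g⁻¹ • v ∈ A := by
  constructor
  · rintro ⟨a, ha, rfl⟩
    simpa using ha
  · intro h
    exact ⟨_, h, by simp⟩

theorem mem_fixG_map {g h : Sp F} {A : Submodule F (Vinf F)} :
    h ∈ fixG (A.map (toLin g)) ↔ g⁻¹ * h * g ∈ fixG A := by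
  rw [mem_fixG, mem_fixG]
  constructor
  · intro H a ha
    rw [mul_smul, mul_smul, H (g • a) ⟨a, ha, rfl⟩, inv_smul_smul]
  · rintro H _ ⟨a, ha, rfl⟩
    have := H a ha
    rw [mul_smul, mul_smul, inv_smul_eq_iff] at this
    exact this

end Fix

/-! ### The exhaustion of 𝐕 by the subspaces V_{m,0} -/

section Standard
variable (F : Type u) [Field F]

/-- The inclusion of the coordinate space `F^m`. -/
noncomputable def coordIncl (m : ℕ) : (Fin m → F) →ₗ[F] (ℕ →₀ F) :=
  Finsupp.lmapDomain F F Fin.val ∘ₗ (Finsupp.linearEquivFunOnFinite F F (Fin m)).symm.toLinearMap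

theorem coordIncl_apply_fin {m : ℕ} (x : Fin m → F) (i : Fin m) : coordIncl F m x i = x i := by
  simp [coordIncl, Finsupp.mapDomain_apply Fin.val_injective]

theorem coordIncl_apply_of_le {m : ℕ} (x : Fin m → F) {i : ℕ} (h : m ≤ i) :
    coordIncl F m x i = 0 := by
  refine Finsupp.mapDomain_of_notMem_range _ _ ?_
  rintro ⟨j, rfl⟩
  exact absurd j.2 (not_lt.2 h)

theorem coordIncl_sum {m : ℕ} (x : Fin m → F) (w : ℕ →₀ F) :
    ((coordIncl F m x).sum fun i a => a * w i) = ∑ i : Fin m, x i * w i := by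
  rw [coordIncl, LinearMap.comp_apply, Finsupp.lmapDomain_apply,
    Finsupp.sum_mapDomain_index (by simp) (by intros; ring), Finsupp.sum_fintype _ _ (by simp)]
  simp

/-- The standard embedding of `V_{m,0}` into `𝐕`. -/
noncomputable def stdEmb (m : ℕ) : EmbX F m 0 :=
  ⟨((coordIncl F m).prodMap (coordIncl F m)) ∘ₗ LinearMap.fst F _ _, by
    rintro ⟨⟨x, y⟩, z⟩ ⟨⟨x', y'⟩, z'⟩ h
    have h1 : coordIncl F m x = coordIncl F m x' := congrArg Prod.fst h
    have h2 : coordIncl F m y = coordIncl F m y' := congrArg Prod.snd h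
    refine Prod.ext (Prod.ext (funext fun i => ?_) (funext fun i => ?_)) (Subsingleton.elim _ _)
    · simpa only [coordIncl_apply_fin] using DFunLike.congr_fun h1 (i : ℕ)
    · simpa only [coordIncl_apply_fin] using DFunLike.congr_fun h2 (i : ℕ), by
    rintro ⟨⟨x, y⟩, z⟩ ⟨⟨x', y'⟩, z'⟩
    simp [formV_apply, coordIncl_sum, coordIncl_apply_fin, formStd, dotProduct]⟩

/-- The image of the standard embedding of `V_{m,0}`. -/
noncomputable def stdSub (m : ℕ) : Submodule F (Vinf F) := LinearMap.range (stdEmb F m).1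

instance [Finite F] (m : ℕ) : Finite (stdSub F m) := (Set.finite_range (stdEmb F m).1)

theorem mem_stdSub {m : ℕ} {v : Vinf F} : v ∈ stdSub F m ↔ ∀ i, m ≤ i → v.1 i = 0 ∧ v.2 i = 0 := by
  constructor
  · rintro ⟨x, rfl⟩ i hi
    exact ⟨coordIncl_apply_of_le F _ hi, coordIncl_apply_of_le F _ hi⟩
  · intro h
    refine ⟨((fun i => v.1 i, fun i => v.2 i), 0), Prod.ext (Finsupp.ext fun i => ?_)
      (Finsupp.ext fun i => ?_)⟩
    · rcases lt_or_ge i m with hi | hi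
      · exact coordIncl_apply_fin F _ ⟨i, hi⟩
      · exact (coordIncl_apply_of_le F _ hi).trans (h i hi).1.symm
    · rcases lt_or_ge i m with hi | hi
      · exact coordIncl_apply_fin F _ ⟨i, hi⟩
      · exact (coordIncl_apply_of_le F _ hi).trans (h i hi).2.symm

theorem stdSub_mono {m n : ℕ} (h : m ≤ n) : stdSub F m ≤ stdSub F n := fun _ hv =>
  (mem_stdSub F).2 fun i hi => (mem_stdSub F).1 hv i (h.trans hi)

variable {F}

theorem exists_mem_stdSub (v : Vinf F) : ∃ m, v ∈ stdSub F m := by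
  refine ⟨(v.1.support ∪ v.2.support).sup id + 1, (mem_stdSub F).2 fun i hi => ?_⟩
  have : i ∉ v.1.support ∪ v.2.support := fun h => by
    have := Finset.le_sup (f := id) h
    simp only [id] at this
    omega
  simpa using this

theorem eventually_subset_stdSub {s : Set (Vinf F)} (hs : s.Finite) :
    ∀ᶠ m in Filter.atTop, s ⊆ stdSub F m := by
  have : ∀ᶠ m in Filter.atTop, ∀ v ∈ s, v ∈ stdSub F m := by
    rw [Filter.eventually_all_finite hs]
    intro v _
    obtain ⟨m, hm⟩ := exists_mem_stdSub v
    filter_upwards [Filter.eventually_ge_atTop m] with n hn using stdSub_mono F hn hm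
  exact this

theorem eventually_le_stdSub (A : Submodule F (Vinf F)) [Finite A] :
    ∀ᶠ m in Filter.atTop, A ≤ stdSub F m :=
  eventually_subset_stdSub (Set.toFinite (A : Set (Vinf F)))

theorem formStd_nondegenerate (m : ℕ) (v : Std F m 0) (h : ∀ w, formStd F m 0 v w = 0) : v = 0 := by
  obtain ⟨⟨x, y⟩, z⟩ := v
  refine Prod.ext (Prod.ext (funext fun i => ?_) (funext fun i => ?_)) (Subsingleton.elim _ _)
  · simpa [formStd] using h ((0, Pi.single i 1), 0)
  · simpa [formStd] using h ((Pi.single i 1, 0), 0)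

theorem stdSub_nondegenerate (m : ℕ) (v : stdSub F m)
    (h : ∀ w, (formV F).restrict (stdSub F m) v w = 0) : v = 0 := by
  obtain ⟨_, x, rfl⟩ := v
  have : x = 0 := formStd_nondegenerate m x fun w => by
    rw [← (stdEmb F m).2.2]
    exact h ⟨_, w, rfl⟩
  subst this
  exact Subtype.ext (map_zero _)

theorem exists_perp_notMem (D : Submodule F (Vinf F)) [Finite D] :
    ∃ y, y ∉ D ∧ ∀ d ∈ D, formV F y d = 0 := by
  obtain ⟨m, hm⟩ := (eventually_le_stdSub D).exists
  -- The next basis vector e_m lies outside V_{m,0} and is orthogonal to it.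
  refine ⟨(Finsupp.single m 1, 0), fun h => ?_, fun d hd => ?_⟩
  · simpa using ((mem_stdSub F).1 (hm h) m le_rfl).1
  · simp [formV_apply, ((mem_stdSub F).1 (hm hd) m le_rfl).2]

/-- Every functional is given on a finite subspace by the pairing with a vector outside it. -/
theorem exists_formV_eq_notMem (l : Vinf F →ₗ[F] F) (D : Submodule F (Vinf F)) [Finite D] :
    ∃ w, w ∉ D ∧ ∀ d ∈ D, formV F w d = l d := by
  obtain ⟨w, hw⟩ := exists_formV_eq l D (Set.toFinite _)
  by_cases h : w ∈ D
  · obtain ⟨y, hy, hyD⟩ := exists_perp_notMem D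
    refine ⟨w + y, fun h' => hy ((Submodule.add_mem_iff_right D h).1 h'), fun d hd => ?_⟩
    rw [map_add, LinearMap.add_apply, hw d hd, hyD d hd, add_zero]
  · exact ⟨w, h, hw⟩

/-- If some b in B is not in A, a functional that vanishes on A but not at b agrees on A and b with
the pairing with some d. The transvection along d then fixes A and moves b. In particular a finite
subspace is recovered from its stabilizer. -/
theorem fixG_le_fixG {A B : Submodule F (Vinf F)} [Finite A] : fixG A ≤ fixG B ↔ B ≤ A := by
  refine ⟨fun h => ?_, fixG_antitone⟩
  by_contra hBA
  obtain ⟨b, hb, hbA⟩ := SetLike.not_le_iff_exists.1 hBA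
  obtain ⟨p, hpb, hpA⟩ := Submodule.exists_le_ker_of_notMem hbA
  obtain ⟨d, hd⟩ := exists_formV_eq p (insert b (A : Set (Vinf F))) ((Set.toFinite _).insert b)
  have h1 : transv 1 d ∈ fixG A := mem_fixG.2 fun a ha => by
    rw [transv_apply, hd a (Or.inr ha), LinearMap.mem_ker.1 (hpA ha), mul_zero, zero_smul, add_zero]
  have h2 := mem_fixG.1 (h h1) b hb
  rw [transv_apply, hd b (Or.inl rfl), one_mul, add_eq_left, smul_eq_zero] at h2
  rcases h2 with h2 | rfl
  · exact hpb h2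
  · exact hpb (by rw [← hd b (Or.inl rfl), map_zero, LinearMap.zero_apply])

end Standard

end InfSp

namespace InfSp

/-! ### Witt's theorem inside V_{m,0} -/

section Extension
variable {F : Type u} [Field F] [Finite F]

theorem card_stdSub_solutions (m : ℕ) {A : Submodule F (Vinf F)} [Finite A]
    (j : A →ₗ[F] stdSub F m) (hj : Function.Injective j) (l : A →ₗ[F] F) :
    Nat.card {v : stdSub F m // ∀ a, formV F v (j a) = l a} * Nat.card A =
      Nat.card (stdSub F m) :=
  card_solutions (M := stdSub F m) (A := A) (β := (formV F).restrict (stdSub F m))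
    (stdSub_nondegenerate m) hj l

/-- Witt's theorem in `V_{m,0}`: an isometry between subspaces of `V_{m,0}` extends. -/
theorem exists_extension (m : ℕ) (B : Submodule F (Vinf F)) (hB : B ≤ stdSub F m) (u : Sp F)
    (hu : ∀ b ∈ B, u • b ∈ stdSub F m) :
    ∃ g : Sp F, (∀ b ∈ B, g • b = u • b) ∧ ∀ v ∈ stdSub F m, g • v ∈ stdSub F m := by
  suffices H : ∀ s : Set (Vinf F), s.Finite → s ⊆ stdSub F m → ∃ g : Sp F,
      (∀ b ∈ B, g • b = u • b) ∧ ∀ v ∈ B ⊔ Submodule.span F s, g • v ∈ stdSub F m by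
    obtain ⟨g, hg, hg'⟩ := H (stdSub F m) (finite_coe _) subset_rfl
    exact ⟨g, hg, fun v hv => hg' v (Submodule.mem_sup_right (Submodule.subset_span hv))⟩
  intro s hs
  induction s, hs using Set.Finite.induction_on with
  | empty => exact fun _ => ⟨u, fun _ _ => rfl, fun v hv => hu v (by simpa using hv)⟩
  | @insert w s _ hs ih =>
    intro hws
    obtain ⟨g, hg, hg'⟩ := ih ((Set.subset_insert _ _).trans hws)
    set A := B ⊔ Submodule.span F s with hA
    have hAm : A ≤ stdSub F m :=
      sup_le hB (Submodule.span_le.2 ((Set.subset_insert _ _).trans hws))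
    have hwm : w ∈ stdSub F m := hws (Set.mem_insert _ _)
    have hAw : B ⊔ Submodule.span F (insert w s) = A ⊔ Submodule.span F {w} := by
      rw [Submodule.span_insert, hA, sup_assoc, sup_comm (Submodule.span F {w})]
    have : Finite A := finite_of_le hAm
    by_cases hw : w ∈ A
    · refine ⟨g, hg, fun v hv => hg' v ?_⟩
      rwa [hAw, sup_eq_left.2 ((Submodule.span_singleton_le_iff_mem _ _).2 hw)] at hv
    -- The image of the new vector w is found by counting. In V_{m,0} the conditions imposed by A
    -- and those imposed by gA have equally many solutions. If every solution for gA were in gA,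
    -- then `g⁻¹` would inject these solutions into the solutions for A that lie in A. By equality
    -- of the counts the solution w would be among them, contrary to w ∉ A.
    obtain ⟨w', hw'm, hw'A, hw'⟩ : ∃ w' ∈ stdSub F m, w' ∉ A.map (toLin g) ∧
        ∀ a ∈ A, formV F w' (g • a) = formV F w a := by
      by_contra! hcon
      have e1 := card_stdSub_solutions m (Submodule.inclusion hAm) (Submodule.inclusion_injective hAm) ((formV F w).domRestrict A)
      let j : A →ₗ[F] stdSub F m := (toLin g).restrict hg'
      have hj : Function.Injective j := fun a b hab =>
        Subtype.ext (MulAction.injective g (congrArg Subtype.val hab))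
      have e2 := card_stdSub_solutions m j hj ((formV F w).domRestrict A)
      have hpos : 0 < Nat.card A := Nat.card_pos
      have e3 := Nat.eq_of_mul_eq_mul_right hpos (e1.trans e2.symm)
      have hmem : ∀ v : {v : stdSub F m // ∀ a, formV F v (j a) =
          (formV F w).domRestrict A a}, g⁻¹ • (v.1 : Vinf F) ∈ A := fun v => by
        by_contra hv
        obtain ⟨a, ha, hne⟩ := hcon v.1 v.1.2 (fun h => hv (mem_map_toLin.1 h))
        exact hne (v.2 ⟨a, ha⟩)
      let f : {v : stdSub F m // ∀ a, formV F v (j a) =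
            (formV F w).domRestrict A a} →
          {v : stdSub F m // ∀ a, formV F v (Submodule.inclusion hAm a) =
            (formV F w).domRestrict A a} := fun v =>
        ⟨⟨g⁻¹ • (v.1 : Vinf F), hAm (hmem v)⟩, fun a => by
          rw [← v.2 a]
          change formV F (g⁻¹ • (v.1 : Vinf F)) a = formV F v.1 (g • (a : Vinf F))
          rw [← formV_smul_smul g, smul_inv_smul]⟩
      have hf : Function.Injective f := fun v v' h =>
        Subtype.ext (Subtype.ext (MulAction.injective g⁻¹
          (congrArg (fun x => ((x.1 : stdSub F m) : Vinf F)) h)))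
      obtain ⟨v, hv⟩ := (hf.bijective_of_nat_card_le e3.le).2 ⟨⟨w, hwm⟩, fun _ => rfl⟩
      refine hw ?_
      have := hmem v
      rwa [show g⁻¹ • (v.1 : Vinf F) = w from
        congrArg (fun x => ((x.1 : stdSub F m) : Vinf F)) hv] at this
    obtain ⟨g', hg'A, hg'w⟩ := exists_move (A := A.map (toLin g)) (u := g • w) (u' := w')
      (finite_coe _) (by
        rw [mem_map_toLin, inv_smul_smul]; exact hw) hw'A (by
        rintro _ ⟨a, ha, rfl⟩
        rw [toLin_apply, formV_smul_smul, hw' a ha])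
    refine ⟨g' * g, fun b hb => ?_, fun v hv => ?_⟩
    · rw [mul_smul, ← hg b hb]
      exact hg'A _ ⟨b, Submodule.mem_sup_left hb, rfl⟩
    · rw [hAw] at hv
      obtain ⟨a, ha, y, hy, rfl⟩ := Submodule.mem_sup.1 hv
      obtain ⟨c, rfl⟩ := Submodule.mem_span_singleton.1 hy
      rw [mul_smul, smul_add, smul_add, hg'A (g • a) ⟨a, ha, rfl⟩, smul_comm g c, smul_comm g' c, hg'w]
      exact add_mem (hg' a ha) (Submodule.smul_mem _ _ hw'm)

end Extension
end InfSp

namespace InfSp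

/-! ### Smallest supports of open subgroups -/

section Support
variable {F : Type u} [Field F] [Finite F]

/-- Dividing by the common kernel reduces this to the injective case `witt`. -/
theorem witt_of_ker_eq {W : Type*} [AddCommGroup W] [Module F W] [Finite W]
    (i j : W →ₗ[F] Vinf F) (hk : LinearMap.ker i = LinearMap.ker j)
    (h : ∀ v w, formV F (i v) (i w) = formV F (j v) (j w)) : ∃ g : Sp F, ∀ x, g • i x = j x := by
  have : Finite (W ⧸ LinearMap.ker i) := Finite.of_surjective _ (Submodule.mkQ_surjective _)
  obtain ⟨g, hg⟩ := witt ((LinearMap.ker i).liftQ i le_rfl) ((LinearMap.ker i).liftQ j hk.le)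
    (LinearMap.ker_eq_bot.1 (Submodule.ker_liftQ_eq_bot _ _ _ le_rfl))
    (LinearMap.ker_eq_bot.1 (Submodule.ker_liftQ_eq_bot _ _ _ hk.ge)) (by
      rintro ⟨v⟩ ⟨w⟩
      exact h v w)
  exact ⟨g, fun x => hg (Submodule.Quotient.mk x)⟩

open Classical in
/-- The position of `gB` relative to `A`. -/
noncomputable def relPosition (A B : Submodule F (Vinf F)) (g : Sp F) : B → Option A × (A → F) :=
  fun b => (if h : g • (b : Vinf F) ∈ A then some ⟨_, h⟩ else none,
    fun a => formV F (g • (b : Vinf F)) a)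

/-- The relative position takes finitely many values, so this bounds the number of `G(A)`-orbits of
restrictions of group elements to B. The maps (a, b) ↦ a + g b and (a, b) ↦ a + g' b on A × B have
the same kernel and induce the same form, so Witt's theorem carries one to the other. The element
obtained fixes A, as is seen by taking b = 0. -/
theorem exists_mem_fixG_of_relPosition_eq {A B : Submodule F (Vinf F)} [Finite A] [Finite B]
    {g g' : Sp F} (h : relPosition A B g = relPosition A B g') :
    ∃ x ∈ fixG A, ∀ b ∈ B, x • g • b = g' • b := by
  have hform : ∀ b ∈ B, ∀ a ∈ A, formV F (g • b) a = formV F (g' • b) a := fun b hb a ha =>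
    congrFun (congrArg Prod.snd (congrFun h ⟨b, hb⟩)) ⟨a, ha⟩
  have hmem : ∀ b ∈ B, g • b ∈ A ∨ g' • b ∈ A → g • b = g' • b := fun b hb hh => by
    have := congrArg Prod.fst (congrFun h ⟨b, hb⟩)
    simp only [relPosition] at this
    by_cases h1 : g • b ∈ A <;> by_cases h2 : g' • b ∈ A
    · rw [dif_pos h1, dif_pos h2] at this
      exact congrArg Subtype.val (Option.some_injective _ this)
    · rw [dif_pos h1, dif_neg h2] at this
      cases this
    · rw [dif_neg h1, dif_pos h2] at this
      cases this
    · tauto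
  let i (g : Sp F) : A × B →ₗ[F] Vinf F := A.subtype.coprod (toLin g ∘ₗ B.subtype)
  have hi : ∀ g a b, i g (a, b) = (a : Vinf F) + g • (b : Vinf F) := fun g a b => by simp [i]
  obtain ⟨x, hx⟩ := witt_of_ker_eq (W := A × B) (i g) (i g') (by
      ext ⟨a, b⟩
      rw [LinearMap.mem_ker, LinearMap.mem_ker, hi, hi]
      constructor
      · intro h0
        rwa [← hmem b b.2 (Or.inl (by rw [eq_neg_of_add_eq_zero_right h0]; exact neg_mem a.2))]
      · intro h0
        rwa [hmem b b.2 (Or.inr (by rw [eq_neg_of_add_eq_zero_right h0]; exact neg_mem a.2))]) (by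
      rintro ⟨a, b⟩ ⟨a', b'⟩
      simp only [hi, map_add, LinearMap.add_apply, formV_smul_smul]
      rw [formV_swap (a : Vinf F) (g • (b' : Vinf F)), formV_swap (a : Vinf F) (g' • (b' : Vinf F)),
        hform b b.2 a' a'.2, hform b' b'.2 a a.2])
  refine ⟨x, mem_fixG.2 fun a ha => ?_, fun b hb => ?_⟩
  · simpa [hi] using hx (⟨a, ha⟩, 0)
  · simpa [hi] using hx (0, ⟨b, hb⟩)

/-- If `P'` is a hyperplane of `P' + ⟨u⟩` and `R ⊇ P'` does not contain `u`, then `G(P' + ⟨u⟩)` and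
`G(R)` generate a subgroup that contains `G(P')`. -/
theorem fixG_le_of_sup_span_le {P R : Submodule F (Vinf F)} [Finite P] [Finite R] (hPR : P ≤ R)
    {u : Vinf F} (hu : u ∉ R) {H : Subgroup (Sp F)} (h1 : fixG (P ⊔ Submodule.span F {u}) ≤ H)
    (h2 : fixG R ≤ H) : fixG P ≤ H := by
  obtain ⟨p, hpu, hpR⟩ := Submodule.exists_le_ker_of_notMem hu
  have hpP : ∀ a ∈ P, p a = 0 := fun a ha => LinearMap.mem_ker.1 (hpR (hPR ha))
  have memS : ∀ x ∈ P ⊔ Submodule.span F {u}, ∃ a ∈ P, ∃ c : F, x = a + c • u := fun x hx => by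
    obtain ⟨a, ha, y, hy, rfl⟩ := Submodule.mem_sup.1 hx
    obtain ⟨c, rfl⟩ := Submodule.mem_span_singleton.1 hy
    exact ⟨a, ha, c, rfl⟩
  have hPH : ∀ g ∈ fixG R, g ∈ fixG P := fun g hg => fixG_antitone hPR hg
  have hSP : ∀ g ∈ fixG (P ⊔ Submodule.span F {u}), g ∈ fixG P := fun g hg =>
    fixG_antitone le_sup_left hg
  -- It suffices to move u inside H to every possible image under G(P). For a target outside P + ⟨u⟩
  -- two moves are enough: G(R) takes u to an auxiliary w, and G(P + ⟨u⟩) takes w to the target.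
  have key : ∀ u₁ : Vinf F, u₁ ∉ P ⊔ Submodule.span F {u} →
      (∀ a ∈ P, formV F u₁ a = formV F u a) → ∃ h ∈ H, h ∈ fixG P ∧ h • u = u₁ := by
    intro u₁ hu₁ hf
    -- As p vanishes on R and ⟨u, u⟩ = 0, this w pairs with R as u does, and with u as `u₁` does.
    obtain ⟨w, hwD, hw⟩ := exists_formV_eq_notMem (formV F u + (formV F u₁ u / p u) • p)
      (R ⊔ Submodule.span F {u})
    have hwR : ∀ r ∈ R, formV F u r = formV F w r := fun r hr => by
      rw [hw r (Submodule.mem_sup_left hr)]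
      simp [LinearMap.mem_ker.1 (hpR hr)]
    have hwu : formV F w u = formV F u₁ u := by
      rw [hw u (Submodule.mem_sup_right (Submodule.mem_span_singleton_self u))]
      simp [formV_self, hpu]
    obtain ⟨g₁, hg₁, hg₁u⟩ := exists_move (finite_coe R) hu
      (fun h => hwD (Submodule.mem_sup_left h)) hwR
    obtain ⟨g₂, hg₂, hg₂w⟩ := exists_move (finite_coe (P ⊔ Submodule.span F {u}))
      (fun h => hwD (sup_le_sup_right hPR _ h)) hu₁ (fun x hx => by
        obtain ⟨a, ha, c, rfl⟩ := memS x hx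
        rw [map_add, map_add, map_smul, map_smul, hwu, ← hwR a (hPR ha), hf a ha])
    have m1 : g₁ ∈ fixG R := mem_fixG.2 hg₁
    have m2 : g₂ ∈ fixG (P ⊔ Submodule.span F {u}) := mem_fixG.2 hg₂
    exact ⟨g₂ * g₁, mul_mem (h1 m2) (h2 m1), mul_mem (hSP _ m2) (hPH _ m1),
      by rw [mul_smul, hg₁u, hg₂w]⟩
  have key' : ∀ u₁ : Vinf F, u₁ ∉ P → (∀ a ∈ P, formV F u₁ a = formV F u a) →
      ∃ h ∈ H, h ∈ fixG P ∧ h • u = u₁ := by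
    intro u₁ hu₁ hf
    -- A target in P + ⟨u⟩ but not in P is outside R, so G(R) reaches it from some w outside R +
    -- ⟨u⟩, to which `key` applies.
    by_cases hS : u₁ ∈ P ⊔ Submodule.span F {u}
    · have hR : u₁ ∉ R := by
        obtain ⟨a, ha, c, rfl⟩ := memS u₁ hS
        intro h
        have := LinearMap.mem_ker.1 (hpR h)
        rw [map_add, hpP a ha, map_smul, zero_add, smul_eq_mul, mul_eq_zero] at this
        obtain rfl := this.resolve_right hpu
        exact hu₁ (by simpa using ha)
      obtain ⟨w, hwD, hw⟩ := exists_formV_eq_notMem (formV F u₁) (R ⊔ Submodule.span F {u})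
      have hwR : ∀ r ∈ R, formV F w r = formV F u₁ r := fun r hr =>
        hw r (Submodule.mem_sup_left hr)
      obtain ⟨g₁, hg₁, hg₁u⟩ := exists_move (finite_coe R)
        (fun h => hwD (Submodule.mem_sup_left h)) hR hwR
      obtain ⟨g₂, hg₂, hg₂P, hg₂u⟩ := key w (fun h => hwD (sup_le_sup_right hPR _ h))
        (fun a ha => by rw [hwR a (hPR ha), hf a ha])
      have m1 : g₁ ∈ fixG R := mem_fixG.2 hg₁
      exact ⟨g₁ * g₂, mul_mem (h2 m1) hg₂, mul_mem (hPH _ m1) hg₂P, by rw [mul_smul, hg₂u, hg₁u]⟩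
    · exact key u₁ hS hf
  intro g hg
  obtain ⟨h, hh, hhP, hhu⟩ := key' (g • u)
    (fun hgu => hu (hPR (by
      have := mem_fixG.1 (inv_mem hg) _ hgu
      rw [inv_smul_smul] at this
      rwa [this])))
    (fun a ha => by
      conv_lhs => rw [← mem_fixG.1 hg a ha]
      exact formV_smul_smul g u a)
  have : h⁻¹ * g ∈ fixG (P ⊔ Submodule.span F {u}) := by
    refine mem_fixG.2 fun x hx => ?_
    obtain ⟨a, ha, c, rfl⟩ := memS x hx
    rw [smul_add, mul_smul, mem_fixG.1 hg a ha, mem_fixG.1 (inv_mem hhP) a ha, smul_comm, mul_smul,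
      ← hhu, inv_smul_smul]
  simpa using mul_mem hh (h1 this)

/-- Every open subgroup has a smallest finite support. -/
theorem exists_support {S : Subgroup (Sp F)} (hS : S ∈ Op F) :
    ∃ B : Submodule F (Vinf F), Finite B ∧
      ∀ Q : Submodule F (Vinf F), Finite Q → (fixG Q ≤ S ↔ B ≤ Q) := by
  classical
  -- B is a support of least cardinality. If a support Q did not contain some b in B, a functional p
  -- that vanishes on Q with p(b) ≠ 0 would cut out the smaller subspace P = B ∩ ker p, with B = P +
  -- ⟨b⟩ and b ∉ P + Q. By the preceding result P would be a support, contrary to minimality.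
  have hex : ∃ n, ∃ B : Submodule F (Vinf F), Finite B ∧ fixG B ≤ S ∧ Nat.card B = n := by
    obtain ⟨B, hB, h⟩ := mem_Op_iff.1 hS
    exact ⟨_, B, hB, h, rfl⟩
  obtain ⟨B, hB, hBS, hBn⟩ := Nat.find_spec hex
  refine ⟨B, hB, fun Q hQ => ⟨fun hQS => ?_, fun h => (fixG_antitone h).trans hBS⟩⟩
  by_contra hBQ
  obtain ⟨b, hb, hbQ⟩ := SetLike.not_le_iff_exists.1 hBQ
  obtain ⟨p, hpb, hpQ⟩ := Submodule.exists_le_ker_of_notMem hbQ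
  have hP : Finite ↥(B ⊓ LinearMap.ker p) := finite_of_le inf_le_left
  have hlt : Nat.card ↥(B ⊓ LinearMap.ker p) < Nat.card B := by
    refine Set.Finite.card_lt_card (finite_coe B) ⟨fun x hx => hx.1, fun h => hpb (h hb).2⟩
  refine Nat.find_min hex (hBn ▸ hlt) ⟨_, hP, ?_, rfl⟩
  refine fixG_le_of_sup_span_le (R := (B ⊓ LinearMap.ker p) ⊔ Q) le_sup_left (u := b)
    (fun h => hpb (sup_le inf_le_right hpQ h)) ((fixG_antitone ?_).trans hBS)
    ((fixG_antitone le_sup_right).trans hQS)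
  intro x hx
  refine Submodule.mem_sup.2 ⟨x - (p x / p b) • b, ⟨sub_mem hx (Submodule.smul_mem _ _ hb), ?_⟩,
    (p x / p b) • b, Submodule.smul_mem _ _ (Submodule.mem_span_singleton_self b),
    sub_add_cancel _ _⟩
  change p _ = 0
  rw [map_sub, map_smul, smul_eq_mul, div_mul_cancel₀ _ hpb, sub_self]

/-- If an open subgroup and a conjugate of it both contain `G(V_{m,0})`, then the conjugation is
realized by an element that preserves `V_{m,0}`. -/
theorem exists_mul_preserves_stdSub {S : Subgroup (Sp F)} (hS : S ∈ Op F) (m : ℕ) (u : Sp F)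
    (h1 : fixG (stdSub F m) ≤ S) (h2 : ∀ g ∈ fixG (stdSub F m), u⁻¹ * g * u ∈ S) :
    ∃ s ∈ S, ∀ v ∈ stdSub F m, (u * s) • v ∈ stdSub F m := by
  -- Minimality of the support B gives B ⊆ V_{m,0} and uB ⊆ V_{m,0}. An extension g of the
  -- restriction of u to B that preserves V_{m,0} differs from u by s = `u⁻¹ * g`, which fixes B and
  -- hence lies in S.
  obtain ⟨B, hB, hQ⟩ := exists_support hS
  have hB1 := (hQ _ inferInstance).1 h1
  have hB2 := (hQ ((stdSub F m).map (toLin u⁻¹)) inferInstance).1 fun g hg => by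
    rw [mem_fixG_map, inv_inv] at hg
    simpa [mul_assoc] using h2 _ hg
  obtain ⟨g, hg, hg'⟩ := exists_extension m B hB1 u fun b hb => by
    simpa [mem_map_toLin] using mem_map_toLin.1 (hB2 hb)
  refine ⟨u⁻¹ * g, (hQ B hB).2 le_rfl (mem_fixG.2 fun b hb => ?_), fun v hv => ?_⟩
  · rw [mul_smul, hg b hb, inv_smul_smul]
  · simpa using hg' v hv

theorem conj_mem_fixG_stdSub {m : ℕ} {g : Sp F} (hg : ∀ v ∈ stdSub F m, g • v ∈ stdSub F m)
    {x : Sp F} : g⁻¹ * x * g ∈ fixG (stdSub F m) ↔ x ∈ fixG (stdSub F m) := by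
  have : (stdSub F m).map (toLin g) = stdSub F m := by
    have hle : (stdSub F m).map (toLin g) ≤ stdSub F m := by
      rintro _ ⟨v, hv, rfl⟩
      exact hg v hv
    refine SetLike.coe_injective (Set.eq_of_subset_of_ncard_le hle ?_ (finite_coe _))
    rw [Submodule.map_coe]
    exact (Set.ncard_image_of_injective _ (MulAction.injective g)).ge
  rw [← mem_fixG_map, this]

end Support
end InfSp

namespace InfSp

/-! ### Counting embeddings by adjoining a vector -/

section EmbeddingCount
variable {F : Type u} [Field F] {W W' M : Type*} [AddCommGroup W] [Module F W]
  [AddCommGroup W'] [Module F W'] [AddCommGroup M] [Module F M]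

/-- Embeddings of a space obtained by adjoining one vector, as pairs of an embedding and the image
of the vector. -/
noncomputable def embeddingAdjoin {β : LinearMap.BilinForm F M} (hβ : β.IsAlt)
    {ω : LinearMap.BilinForm F W} {ω' : LinearMap.BilinForm F W'} (l : Module.Dual F W)
    (e : (W × F) ≃ₗ[F] W') (he : ∀ w c w' c', ω' (e (w, c)) (e (w', c')) =
      ω w w' + c * l w' - c' * l w) :
    Embedding ω' β ≃ Σ i : Embedding ω β,
      {v : M // v ∉ LinearMap.range i.1 ∧ ∀ x, β v (i.1 x) = l x} where
  toFun k := ⟨⟨k.1 ∘ₗ e.toLinearMap ∘ₗ LinearMap.inl F W F,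
      fun x y h => congrArg Prod.fst (e.injective (k.2.1 h)), fun v w => by
        simp [k.2.2, he]⟩, k.1 (e (0, 1)), by
      rintro ⟨x, hx⟩
      have := congrArg Prod.snd (e.injective (k.2.1 hx))
      simp at this, fun x => by simp [k.2.2, he]⟩
  invFun p := ⟨(p.1.1.coprod (LinearMap.toSpanSingleton F M p.2.1)) ∘ₗ e.symm.toLinearMap, by
      suffices h : Function.Injective (p.1.1.coprod (LinearMap.toSpanSingleton F M p.2.1)) by
        rw [LinearMap.coe_comp]
        exact h.comp e.symm.injective
      refine (injective_iff_map_eq_zero (p.1.1.coprod (LinearMap.toSpanSingleton F M p.2.1))).2 ?_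
      rintro ⟨x, c⟩ h
      simp only [LinearMap.coprod_apply, LinearMap.toSpanSingleton_apply] at h
      have hc : c = 0 := by
        by_contra hc
        refine p.2.2.1 ⟨-c⁻¹ • x, ?_⟩
        rw [map_smul, eq_neg_of_add_eq_zero_left h, smul_neg, neg_smul, neg_neg,
          inv_smul_smul₀ hc]
      subst hc
      rw [zero_smul, add_zero] at h
      rw [p.1.2.1 (h.trans (map_zero _).symm)]
      rfl, fun v w => by
      obtain ⟨⟨x, c⟩, rfl⟩ := e.surjective v
      obtain ⟨⟨y, d⟩, rfl⟩ := e.surjective w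
      have h1 : β p.2.1 p.2.1 = 0 := hβ _
      have h2 : β (p.1.1 x) p.2.1 = - l x := by
        rw [← p.2.2.2]
        exact (LinearMap.IsAlt.neg hβ _ _).symm
      simp [p.1.2.2, p.2.2.2, h1, h2, he]
      ring⟩
  left_inv k := by
    refine Subtype.ext (LinearMap.ext fun v => ?_)
    obtain ⟨⟨x, c⟩, rfl⟩ := e.surjective v
    simp only [LinearMap.comp_apply, LinearEquiv.coe_coe, LinearEquiv.symm_apply_apply,
      LinearMap.coprod_apply, LinearMap.toSpanSingleton_apply, LinearMap.inl_apply]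
    rw [← map_smul, ← map_smul, ← map_add, ← map_add]
    simp
  right_inv p := by
    obtain ⟨i, v, hv⟩ := p
    -- The type of the second component depends on the first, so both are generalized before they
    -- are identified.
    have : ∀ (j : Embedding ω β) (hj : j = i) (w : M) (hw : w = v) (h),
        (⟨j, w, h⟩ : Σ i : Embedding ω β,
          {v : M // v ∉ LinearMap.range i.1 ∧ ∀ x, β v (i.1 x) = l x}) = ⟨i, v, hv⟩ := by
      rintro _ rfl _ rfl _
      rfl
    refine this _ (Subtype.ext (LinearMap.ext fun x => ?_)) _ ?_ _
    · simp
    · simp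

instance finite_embedding [Finite W] [Finite M] (ω : LinearMap.BilinForm F W)
    (β : LinearMap.BilinForm F M) : Finite (Embedding ω β) :=
  Finite.of_injective (fun i : Embedding ω β => (i.1 : W → M))
    fun _ _ h => Subtype.ext (DFunLike.coe_injective h)

/-- Over each embedding i of W, the admissible images of the new vector are the |M|/|W| solutions of
the pairing conditions, except those in the range of i. The latter correspond to the y in W that
represent l. The identity is stated without subtraction or division so that it holds in ℕ. -/
theorem card_embedding_adjoin [Finite W] [Finite M] {β : LinearMap.BilinForm F M} (hβ : β.IsAlt)
    (hβ' : ∀ v, (∀ w, β v w = 0) → v = 0)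
    {ω : LinearMap.BilinForm F W} {ω' : LinearMap.BilinForm F W'} (l : Module.Dual F W)
    (e : (W × F) ≃ₗ[F] W') (he : ∀ w c w' c', ω' (e (w, c)) (e (w', c')) =
      ω w w' + c * l w' - c' * l w) :
    (Nat.card (Embedding ω' β) + Nat.card (Embedding ω β) * Nat.card {y : W // ∀ x, ω y x = l x}) *
      Nat.card W = Nat.card (Embedding ω β) * Nat.card M := by
  have hfib : ∀ i : Embedding ω β,
      (Nat.card {v : M // v ∉ LinearMap.range i.1 ∧ ∀ x, β v (i.1 x) = l x} +
        Nat.card {y : W // ∀ x, ω y x = l x}) * Nat.card W = Nat.card M := fun i => by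
    rw [← card_solutions hβ' i.2.1 l]
    congr 1
    have h1 : Nat.card {y : W // ∀ x, ω y x = l x} =
        Nat.card {v : M // v ∈ LinearMap.range i.1 ∧ ∀ x, β v (i.1 x) = l x} :=
      Nat.card_congr (Equiv.ofBijective
        (fun y => ⟨i.1 y.1, ⟨y.1, rfl⟩, fun x => (i.2.2 _ _).trans (y.2 x)⟩)
        ⟨fun y y' h => Subtype.ext (i.2.1 (congrArg Subtype.val h)), by
          rintro ⟨_, ⟨y, rfl⟩, hy⟩
          exact ⟨⟨y, fun x => (i.2.2 _ _).symm.trans (hy x)⟩, rfl⟩⟩)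
    rw [h1, add_comm, ← Nat.card_sum]
    classical
    refine Nat.card_congr ((Equiv.sumCongr ?_ ?_).trans (Equiv.sumCompl fun v :
      {v : M // ∀ a, β v (i.1 a) = l a} => (v : M) ∈ LinearMap.range i.1))
    · exact ⟨fun v => ⟨⟨v.1, v.2.2⟩, v.2.1⟩, fun v => ⟨v.1.1, v.2, v.1.2⟩, fun _ => rfl, fun _ => rfl⟩
    · exact ⟨fun v => ⟨⟨v.1, v.2.2⟩, v.2.1⟩, fun v => ⟨v.1.1, v.2, v.1.2⟩, fun _ => rfl, fun _ => rfl⟩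
  have := Fintype.ofFinite (Embedding ω β)
  rw [Nat.card_congr (embeddingAdjoin hβ l e he), Nat.card_sigma, Nat.card_eq_fintype_card,
    ← Finset.card_univ, Finset.card_eq_sum_ones, Finset.sum_mul, ← Finset.sum_add_distrib,
    Finset.sum_mul, Finset.sum_mul]
  refine Finset.sum_congr rfl fun i _ => ?_
  rw [one_mul, one_mul, hfib]

end EmbeddingCount

/-! ### The common recursions for embedding numbers and for P_{a,b} -/

section Recursion
variable (F : Type u) [Field F]

theorem formStd_apply (a b : ℕ) (v w : Std F a b) :
    formStd F a b v w = v.1.1 ⬝ᵥ w.1.2 - v.1.2 ⬝ᵥ w.1.1 := rfl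

theorem formStd_isAlt (a b : ℕ) : (formStd F a b).IsAlt := fun v => by
  rw [formStd_apply, dotProduct_comm, sub_self]

/-- `V_{a,b+1}` is obtained from `V_{a,b}` by adjoining a null vector. -/
noncomputable def stdAdjoinNull (a b : ℕ) : (Std F a b × F) ≃ₗ[F] Std F a (b + 1) where
  toFun p := (p.1.1, Fin.cons p.2 p.1.2)
  invFun v := ((v.1, fun i => v.2 i.succ), v.2 0)
  left_inv p := by simp
  right_inv v := Prod.ext rfl (Fin.cons_self_tail v.2)
  map_add' p p' := Prod.ext rfl (funext fun i => by
    refine Fin.cases ?_ (fun i => ?_) i <;> simp)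
  map_smul' c p := Prod.ext rfl (funext fun i => by
    refine Fin.cases ?_ (fun i => ?_) i <;> simp)

/-- `V_{a+1,0}` is obtained from `V_{a,1}` by adjoining a vector that pairs with the null space. -/
noncomputable def stdAdjoinDual (a : ℕ) : (Std F a 1 × F) ≃ₗ[F] Std F (a + 1) 0 where
  toFun p := ((Fin.cons (p.1.2 0) p.1.1.1, Fin.cons p.2 p.1.1.2), 0)
  invFun v := (((fun i => v.1.1 i.succ, fun i => v.1.2 i.succ), fun _ => v.1.1 0), v.1.2 0)
  left_inv p := Prod.ext (Prod.ext (by simp) (funext fun i => by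
    rw [Subsingleton.elim i 0]; simp)) (by simp)
  right_inv v := Prod.ext (Prod.ext (Fin.cons_self_tail v.1.1) (Fin.cons_self_tail v.1.2))
    (Subsingleton.elim _ _)
  map_add' p p' := Prod.ext (Prod.ext
    (funext fun i => by refine Fin.cases ?_ (fun i => ?_) i <;> simp)
    (funext fun i => by refine Fin.cases ?_ (fun i => ?_) i <;> simp)) (Subsingleton.elim _ _)
  map_smul' c p := Prod.ext (Prod.ext
    (funext fun i => by refine Fin.cases ?_ (fun i => ?_) i <;> simp)
    (funext fun i => by refine Fin.cases ?_ (fun i => ?_) i <;> simp)) (Subsingleton.elim _ _)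

omit [Field F] in
theorem card_std [Finite F] (a b : ℕ) : Nat.card (Std F a b) = Nat.card F ^ (2 * a + b) := by
  simp only [Nat.card_prod, Nat.card_fun, Nat.card_eq_fintype_card, Fintype.card_fin]
  ring

theorem card_radical [Finite F] (a b : ℕ) :
    Nat.card {y : Std F a b // ∀ x, formStd F a b y x = (0 : Module.Dual F (Std F a b)) x} =
      Nat.card F ^ b := by
  have : Nat.card (Fin b → F) = Nat.card F ^ b := by
    simp [Nat.card_fun]
  rw [← this]
  refine Nat.card_congr ⟨fun y => y.1.2, fun z => ⟨(0, z), fun x => by simp [formStd_apply]⟩,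
    fun y => ?_, fun z => rfl⟩
  obtain ⟨⟨⟨x, y⟩, z⟩, h⟩ := y
  refine Subtype.ext (Prod.ext (Prod.ext (funext fun i => ?_) (funext fun i => ?_)) rfl)
  · simpa [formStd] using (h ((0, Pi.single i 1), 0)).symm
  · exact (show y i = 0 by simpa [formStd] using h ((Pi.single i 1, 0), 0)).symm

theorem numEmb_succ_right [Finite F] (a b m : ℕ) :
    (numEmb F a (b + 1) m 0 + numEmb F a b m 0 * Nat.card F ^ b) * Nat.card F ^ (2 * a + b) =
      numEmb F a b m 0 * Nat.card F ^ (2 * m) := by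
  have := card_embedding_adjoin (formStd_isAlt F m 0) (formStd_nondegenerate m)
    (ω := formStd F a b) (ω' := formStd F a (b + 1)) 0 (stdAdjoinNull F a b) (by
      intro w c w' c'
      simp [formStd_apply, stdAdjoinNull])
  rwa [card_radical, card_std, card_std] at this

theorem numEmb_succ_left [Finite F] (a m : ℕ) :
    numEmb F (a + 1) 0 m 0 * Nat.card F ^ (2 * a + 1) =
      numEmb F a 1 m 0 * Nat.card F ^ (2 * m) := by
  have := card_embedding_adjoin (formStd_isAlt F m 0) (formStd_nondegenerate m)
    (ω := formStd F a 1) (ω' := formStd F (a + 1) 0)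
    -- The null vector of V_{a,1} becomes an e and the adjoined vector is its partner f; the sign is
    -- that of ⟨f, e⟩ = -1.
    (-(LinearMap.proj 0 ∘ₗ LinearMap.snd F _ _)) (stdAdjoinDual F a) (by
      intro w c w' c'
      simp [formStd_apply, stdAdjoinDual, dotProduct, Fin.sum_univ_succ]
      ring)
  rw [card_std, card_std] at this
  -- No vector of V_{a,1} has these pairings, since all of them are orthogonal to the null vector.
  -- So nothing has to be excluded.
  have h0 : IsEmpty {y : Std F a 1 // ∀ x, formStd F a 1 y x =
      (-(LinearMap.proj 0 ∘ₗ LinearMap.snd F _ _) : Module.Dual F (Std F a 1)) x} := by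
    refine ⟨fun y => ?_⟩
    have := y.2 (0, 1)
    simp [formStd_apply] at this
  rw [@Nat.card_of_isEmpty _ h0, mul_zero, add_zero] at this
  exact this

theorem numEmb_zero_zero (m : ℕ) : numEmb F 0 0 m 0 = 1 := by
  refine Nat.card_eq_one_iff_unique.2 ⟨⟨fun i j => Subtype.ext (LinearMap.ext fun x => ?_)⟩,
    ⟨⟨0, Function.injective_of_subsingleton _, fun v w => by simp [formStd_apply]⟩⟩⟩
  rw [Subsingleton.elim x 0, map_zero, map_zero]

/-- This makes the natural-number subtraction in the exponent of `Ppoly` a true subtraction. -/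
theorem choose_two_le (a b : ℕ) : b.choose 2 ≤ 2 * (a + b).choose 2 + a ^ 2 :=
  (Nat.choose_le_choose 2 (Nat.le_add_left b a)).trans (by omega)

theorem Ppoly_exponent_succ_right (a b : ℕ) :
    2 * (a + (b + 1)).choose 2 + a ^ 2 - (b + 1).choose 2 =
      2 * (a + b).choose 2 + a ^ 2 - b.choose 2 + (2 * a + b) := by
  have h1 := choose_two_le a b
  have h2 : (a + (b + 1)).choose 2 = (a + b) + (a + b).choose 2 := by
    rw [← add_assoc, Nat.choose_succ_succ' _ 1, Nat.choose_one_right]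
  have h3 : (b + 1).choose 2 = b + b.choose 2 := by
    rw [Nat.choose_succ_succ' _ 1, Nat.choose_one_right]
  omega

omit [Field F] in
theorem invSelf_card_mul (n m : ℕ) (p r : Polynomial (Zq F)) :
    Polynomial.C (IsLocalization.Away.invSelf (Nat.card F : ℤ) ^ (n + m)) * p * r *
      Polynomial.C ((Nat.card F : Zq F) ^ m) =
    Polynomial.C (IsLocalization.Away.invSelf (Nat.card F : ℤ) ^ n) * p * r := by
  have h : (IsLocalization.Away.invSelf (Nat.card F : ℤ) : Zq F) * (Nat.card F : Zq F) = 1 := by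
    simpa [mul_comm] using IsLocalization.Away.mul_invSelf (S := Zq F) (Nat.card F : ℤ)
  rw [mul_comm _ (Polynomial.C ((Nat.card F : Zq F) ^ m)), ← mul_assoc, ← mul_assoc, ← map_mul,
    pow_add, mul_left_comm, ← mul_pow, mul_comm (Nat.card F : Zq F), h, one_pow, mul_one]

omit [Field F] in
theorem Ppoly_succ_right (a b : ℕ) :
    Ppoly F a (b + 1) * Polynomial.C ((Nat.card F : Zq F) ^ (2 * a + b)) =
      Ppoly F a b * (Polynomial.X - Polynomial.C ((Nat.card F : Zq F) ^ (2 * (a + b)))) := by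
  rw [Ppoly, Ppoly, Ppoly_exponent_succ_right, invSelf_card_mul, show a + (b + 1) = a + b + 1 from rfl,
    Finset.prod_range_succ, ← mul_assoc]

omit [Field F] in
theorem Ppoly_succ_left (a : ℕ) :
    Ppoly F (a + 1) 0 * Polynomial.C ((Nat.card F : Zq F) ^ (2 * a + 1)) =
      Ppoly F a 1 * Polynomial.X := by
  have he : 2 * (a + 1 + 0).choose 2 + (a + 1) ^ 2 - Nat.choose 0 2 =
      2 * (a + 1).choose 2 + a ^ 2 - Nat.choose 1 2 + (2 * a + 1) := by
    simp [Nat.choose]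
    ring
  rw [Ppoly, Ppoly, he, invSelf_card_mul, add_zero, pow_succ Polynomial.X a, ← mul_assoc]
  exact mul_right_comm (G := Polynomial (Zq F)) _ _ _

/-- Both sides satisfy the same recursions, in which powers of the unit q can be cancelled. The
route is (a, 0) → (a, 1) → (a + 1, 0) for the first index, and then (a, b) → (a, b + 1). -/
theorem Ppoly_eval [Finite F] (a b m : ℕ) :
    (Ppoly F a b).eval ((Nat.card F : Zq F) ^ (2 * m)) = (numEmb F a b m 0 : Zq F) := by
  have hu := isUnit_card_Zq F
  have right : ∀ a b, (Ppoly F a b).eval ((Nat.card F : Zq F) ^ (2 * m)) = (numEmb F a b m 0 : Zq F) →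
      (Ppoly F a (b + 1)).eval ((Nat.card F : Zq F) ^ (2 * m)) =
        (numEmb F a (b + 1) m 0 : Zq F) := by
    intro a b ih
    refine (hu.pow (2 * a + b)).mul_right_cancel ?_
    have h1 := congrArg (Polynomial.eval ((Nat.card F : Zq F) ^ (2 * m))) (Ppoly_succ_right F a b)
    have h2 := congrArg (Nat.cast : ℕ → Zq F) (numEmb_succ_right F a b m)
    simp only [Polynomial.eval_mul, Polynomial.eval_C, Polynomial.eval_sub, Polynomial.eval_X,
      ih] at h1
    push_cast at h2
    linear_combination h1 - h2
  have left : ∀ a, (Ppoly F a 0).eval ((Nat.card F : Zq F) ^ (2 * m)) = (numEmb F a 0 m 0 : Zq F) := by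
    intro a
    induction a with
    | zero => simp [Ppoly, numEmb_zero_zero]
    | succ a ih =>
      refine (hu.pow (2 * a + 1)).mul_right_cancel ?_
      have h1 := congrArg (Polynomial.eval ((Nat.card F : Zq F) ^ (2 * m))) (Ppoly_succ_left F a)
      have h2 := congrArg (Nat.cast : ℕ → Zq F) (numEmb_succ_left F a m)
      simp only [Polynomial.eval_mul, Polynomial.eval_C, Polynomial.eval_X, right a 0 ih] at h1
      push_cast at h2
      rw [h1, h2]
  induction b with
  | zero => exact left a
  | succ b ih => exact right a b ih

end Recursion
end InfSp

/-! ### Transitive `Ĝ`-sets and additivity of measures -/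

namespace Olig.HatSet
variable {G : Type u} [Group G] {E : Set (Subgroup G)}

/-- The stabilizer of a point, as a subgroup of `G`. -/
def stab (X : HatSet E) (x : X.carrier) : Subgroup G :=
  (MulAction.stabilizer X.grp x).map X.grp.subtype

theorem mem_stab {X : HatSet E} {x : X.carrier} {g : G} :
    g ∈ X.stab x ↔ ∃ h : g ∈ X.grp, (⟨g, h⟩ : X.grp) • x = x := by
  simp [stab, Subgroup.mem_map, MulAction.mem_stabilizer_iff]

theorem mem_stab' {X : HatSet E} {x : X.carrier} {g : X.grp} : (g : G) ∈ X.stab x ↔ g • x = x := by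
  rw [mem_stab]
  exact ⟨fun ⟨_, h⟩ => h, fun h => ⟨g.2, h⟩⟩

theorem stab_le (X : HatSet E) (x : X.carrier) : X.stab x ≤ X.grp := fun _ hg =>
  (mem_stab.1 hg).1

theorem stab_mem (X : HatSet E) (x : X.carrier) : X.stab x ∈ E := X.smooth x

theorem mem_stab_smul {X : HatSet E} {x : X.carrier} {u : X.grp} {g : G} :
    g ∈ X.stab (u • x) ↔ (u : G)⁻¹ * g * u ∈ X.stab x := by
  rw [mem_stab, mem_stab]
  constructor
  · rintro ⟨h, hx⟩
    refine ⟨mul_mem (mul_mem (inv_mem u.2) h) u.2, ?_⟩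
    rw [show (⟨(u : G)⁻¹ * g * u, mul_mem (mul_mem (inv_mem u.2) h) u.2⟩ : X.grp) =
      u⁻¹ * ⟨g, h⟩ * u from rfl, mul_smul, mul_smul, hx, inv_smul_smul]
  · rintro ⟨h, hx⟩
    have hg : g ∈ X.grp := by
      have := mul_mem (mul_mem u.2 h) (inv_mem u.2)
      simpa [mul_assoc] using this
    refine ⟨hg, ?_⟩
    rw [show (⟨(u : G)⁻¹ * g * u, h⟩ : X.grp) = u⁻¹ * ⟨g, hg⟩ * u from rfl, mul_smul, mul_smul,
      inv_smul_eq_iff] at hx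
    exact hx

/-- The subset of a `Ĝ`-set cut out by a stable subset. -/
def sub (X : HatSet E) (Z : SubMulAction X.grp X.carrier) : HatSet E where
  grp := X.grp
  grp_mem := X.grp_mem
  carrier := Z
  smooth z := by
    convert X.smooth z.1
    ext g
    simp [MulAction.mem_stabilizer_iff, Subtype.ext_iff]
  finitary := by
    have := X.finitary
    refine Finite.of_injective (β := MulAction.orbitRel.Quotient X.grp X.carrier)
      (Quotient.map' (Subtype.val : Z → X.carrier) ?_) ?_
    · rintro _ z ⟨g, rfl⟩
      exact ⟨g, rfl⟩
    · rintro ⟨z⟩ ⟨z'⟩ h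
      obtain ⟨g, hg⟩ := Quotient.exact h
      exact Quotient.sound ⟨g, Subtype.ext hg⟩

theorem stab_sub {X : HatSet E} (Z : SubMulAction X.grp X.carrier) (z : Z) :
    (X.sub Z).stab z = X.stab z.1 := by
  ext g
  refine mem_stab.trans (Iff.trans ?_ mem_stab.symm)
  exact exists_congr fun h => Subtype.ext_iff

theorem isMap_of_grp_eq {X Y : HatSet E} (h : X.grp ≤ Y.grp) {f : X.carrier → Y.carrier}
    (hf : ∀ (g : X.grp) (x : X.carrier), f (g • x) = (⟨g, h g.2⟩ : Y.grp) • f x) :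
    IsMap X.grp X Y f :=
  ⟨le_rfl, h, fun g hg x => hf ⟨g, hg⟩ x⟩

/-- The preimage of a set under an invariant function. -/
def preim (X : HatSet E) {ι : Type*} (f : X.carrier → ι) (hf : ∀ (g : X.grp) x, f (g • x) = f x)
    (s : Set ι) : SubMulAction X.grp X.carrier where
  carrier := f ⁻¹' s
  smul_mem' g x hx := by
    rw [Set.mem_preimage, hf]
    exact hx

section Transitive

/-- A map from a transitive `Ĝ`-set, given by the image of a point. -/
theorem exists_map {X Y : HatSet E} (h : X.grp ≤ Y.grp) [MulAction.IsPretransitive X.grp X.carrier]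
    (x : X.carrier) (y : Y.carrier) (hxy : X.stab x ≤ Y.stab y) :
    ∃ f : X.carrier → Y.carrier, IsMap X.grp X Y f ∧ f x = y ∧
      (∀ g : X.grp, f (g • x) = (⟨g, h g.2⟩ : Y.grp) • y) ∧
      (Y.stab y ⊓ X.grp ≤ X.stab x → Function.Injective f) := by
  choose c hc using fun x' : X.carrier => MulAction.exists_smul_eq X.grp x x'
  have key : ∀ g : X.grp, (⟨c (g • x), h (c (g • x)).2⟩ : Y.grp) • y = (⟨g, h g.2⟩ : Y.grp) • y := by
    intro g
    have h1 : ((g⁻¹ * c (g • x) : X.grp) : G) ∈ X.stab x := by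
      rw [mem_stab', mul_smul, hc, inv_smul_smul]
    obtain ⟨h2, h3⟩ := mem_stab.1 (hxy h1)
    rw [← inv_smul_eq_iff, ← mul_smul]
    exact h3
  refine ⟨fun x' => (⟨c x', h (c x').2⟩ : Y.grp) • y, isMap_of_grp_eq h fun g x' => ?_, ?_, key,
    fun hinj x₁ x₂ h12 => ?_⟩
  · obtain ⟨g', rfl⟩ := MulAction.exists_smul_eq X.grp x x'
    rw [← mul_smul, key, key, ← mul_smul]
    rfl
  · have := key 1
    rw [one_smul] at this
    exact this.trans (one_smul _ _)
  · have h1 : (((c x₁)⁻¹ * c x₂ : X.grp) : G) ∈ Y.stab y ⊓ X.grp := by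
      refine ⟨mem_stab.2 ⟨h ((c x₁)⁻¹ * c x₂).2, ?_⟩, ((c x₁)⁻¹ * c x₂).2⟩
      rw [show (⟨_, h ((c x₁)⁻¹ * c x₂).2⟩ : Y.grp) = (⟨c x₁, h (c x₁).2⟩ : Y.grp)⁻¹ *
        ⟨c x₂, h (c x₂).2⟩ from rfl, mul_smul, inv_smul_eq_iff]
      exact h12.symm
    have h2 := mem_stab'.1 (hinj h1)
    rw [mul_smul, inv_smul_eq_iff, hc, hc] at h2
    exact h2.symm

theorem iso_of_stab_eq {X Y : HatSet E} (h : X.grp = Y.grp)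
    [MulAction.IsPretransitive X.grp X.carrier] [MulAction.IsPretransitive Y.grp Y.carrier]
    (x : X.carrier) (y : Y.carrier) (hxy : X.stab x = Y.stab y) : Iso X Y := by
  obtain ⟨f, hf, -, hg, hinj⟩ := exists_map h.le x y hxy.le
  refine ⟨X.grp, X.grp_mem, f, ⟨hinj (hxy ▸ inf_le_left), fun y' => ?_⟩, hf⟩
  obtain ⟨g, rfl⟩ := MulAction.exists_smul_eq Y.grp y y'
  exact ⟨(⟨g, h.ge g.2⟩ : X.grp) • x, hg _⟩

/-- In terms of cosets: for R ≤ S ≤ U the map U/R → U/S has fiber S/R. This yields μ(U/R) = μ(U/S)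
μ(S/R). -/
theorem isFiber_of_stab_eq {Y X T : HatSet E} (h : Y.grp = X.grp)
    [MulAction.IsPretransitive X.grp X.carrier] [MulAction.IsPretransitive Y.grp Y.carrier]
    [MulAction.IsPretransitive T.grp T.carrier] (y : Y.carrier) (x : X.carrier) (t : T.carrier)
    (hyx : Y.stab y ≤ X.stab x) (hT : T.grp = X.stab x) (hty : T.stab t = Y.stab y) :
    IsFiber Y X T := by
  obtain ⟨f, hf, hfy, hfg, -⟩ := exists_map h.le y x hyx
  have hTY : T.grp ≤ Y.grp := by
    rw [hT, h]
    exact X.stab_le x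
  obtain ⟨j, hj, hjt, hjg, hinj⟩ := exists_map hTY t y hty.le
  refine ⟨h, ⟨y⟩, inferInstance, inferInstance, f, hf, x, T.grp, T.grp_mem, j, hj,
    hinj (hty ▸ inf_le_left), ?_⟩
  ext y'
  constructor
  · rintro ⟨t', rfl⟩
    obtain ⟨g, rfl⟩ := MulAction.exists_smul_eq T.grp t t'
    rw [Set.mem_preimage, hjg, hfg, Set.mem_singleton_iff]
    exact mem_stab'.1 (hT ▸ g.2 : (g : G) ∈ X.stab x)
  · intro hy'
    obtain ⟨g, rfl⟩ := MulAction.exists_smul_eq Y.grp y y'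
    rw [Set.mem_preimage, hfg, Set.mem_singleton_iff] at hy'
    have : (g : G) ∈ T.grp := hT ▸ mem_stab.2 ⟨_, hy'⟩
    exact ⟨(⟨g, this⟩ : T.grp) • t, hjg _⟩

end Transitive

section Measure
variable {k : Type w} [CommRing k] {μ : HatSet E → k}

theorem iso_sub_univ (X : HatSet E) (Z : SubMulAction X.grp X.carrier) (hZ : ∀ x, x ∈ Z) :
    Iso (X.sub Z) X :=
  ⟨X.grp, X.grp_mem, Subtype.val, ⟨Subtype.val_injective, fun x => ⟨⟨x, hZ x⟩, rfl⟩⟩,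
    isMap_of_grp_eq (X := X.sub Z) (Y := X) le_rfl fun _ _ => rfl⟩

theorem isCoprod_sub (X : HatSet E) (Z₁ Z₂ Z : SubMulAction X.grp X.carrier) (h₁ : Z₁ ≤ Z)
    (h₂ : Z₂ ≤ Z) (hd : ∀ x, x ∈ Z₁ → x ∉ Z₂) (hu : ∀ x ∈ Z, x ∈ Z₁ ∨ x ∈ Z₂) :
    IsCoprod (X.sub Z₁) (X.sub Z₂) (X.sub Z) := by
  refine ⟨X.grp, X.grp_mem, Set.inclusion h₁, Set.inclusion h₂,
    isMap_of_grp_eq (X := X.sub Z₁) (Y := X.sub Z) le_rfl fun _ _ => rfl,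
    isMap_of_grp_eq (X := X.sub Z₂) (Y := X.sub Z) le_rfl fun _ _ => rfl,
    Set.inclusion_injective h₁, Set.inclusion_injective h₂, ?_⟩
  refine isCompl_iff.2 ⟨Set.disjoint_left.2 ?_, codisjoint_iff.2 (Set.eq_univ_of_forall ?_)⟩
  · rintro ⟨z, hz⟩ ⟨⟨z', h'⟩, hzz⟩ ⟨⟨z'', h''⟩, hzz'⟩
    have e1 : z' = z := congrArg Subtype.val hzz
    have e2 : z'' = z := congrArg Subtype.val hzz'
    subst e1
    subst e2
    exact hd _ h' h''
  · rintro ⟨z, hz⟩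
    rcases hu z hz with h' | h'
    · exact Or.inl ⟨⟨z, h'⟩, rfl⟩
    · exact Or.inr ⟨⟨z, h'⟩, rfl⟩

/-- The empty set is the coproduct of two copies of itself. -/
theorem measure_of_isEmpty (hμ : IsMeasure μ) (X : HatSet E) [IsEmpty X.carrier] : μ X = 0 := by
  have hid : IsMap X.grp X X id := isMap_of_grp_eq (X := X) (Y := X) le_rfl fun _ _ => rfl
  have := hμ.coprod X X X ⟨X.grp, X.grp_mem, id, id, hid, hid, Function.injective_id,
    Function.injective_id, isCompl_iff.2 ⟨Set.disjoint_left.2 fun x => isEmptyElim x,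
      codisjoint_iff.2 (Set.eq_univ_of_forall fun x => isEmptyElim x)⟩⟩
  exact left_eq_add.1 this

/-- Additivity of a measure for a finite partition into stable subsets. -/
theorem measure_eq_sum (hμ : IsMeasure μ) (X : HatSet E) {ι : Type*} [Fintype ι]
    (f : X.carrier → ι) (hf : ∀ (g : X.grp) x, f (g • x) = f x) :
    μ X = ∑ i, μ (X.sub (X.preim f hf {i})) := by
  classical
  have H : ∀ s : Finset ι, μ (X.sub (X.preim f hf s)) = ∑ i ∈ s, μ (X.sub (X.preim f hf {i})) := by
    intro s
    induction s using Finset.induction_on with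
    | empty =>
      rw [Finset.sum_empty]
      have : IsEmpty (X.sub (X.preim f hf ((∅ : Finset ι) : Set ι))).carrier :=
        ⟨fun x => Finset.notMem_empty _ (Finset.mem_coe.1 x.2)⟩
      exact measure_of_isEmpty hμ _
    | insert i s hi ih =>
      rw [Finset.sum_insert hi, ← ih]
      refine hμ.coprod _ _ _ (isCoprod_sub X _ _ _ ?_ ?_ ?_ ?_)
      · intro x hx
        exact Finset.mem_coe.2 (Finset.mem_insert.2 (Or.inl hx))
      · intro x hx
        exact Finset.mem_coe.2 (Finset.mem_insert_of_mem (Finset.mem_coe.1 hx))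
      · intro x hx hx'
        have h1 : f x = i := hx
        have h2 : f x ∈ s := hx'
        exact hi (h1 ▸ h2)
      · intro x hx
        have h1 : f x ∈ insert i s := Finset.mem_coe.1 hx
        exact Finset.mem_insert.1 h1
  rw [← H Finset.univ]
  exact (hμ.iso _ _ (iso_sub_univ X _ fun x => Finset.mem_coe.2 (Finset.mem_univ _))).symm

theorem measure_mem_of_subsingleton (hμ : IsMeasure μ) (K : Subring k) (X : HatSet E)
    [Subsingleton X.carrier] : μ X ∈ K := by
  rcases isEmpty_or_nonempty X.carrier with h | ⟨⟨x⟩⟩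
  · rw [measure_of_isEmpty hμ X]
    exact zero_mem K
  · rw [hμ.point X ⟨⟨⟨x⟩, fun y => Subsingleton.elim _ _⟩⟩]
    exact one_mem K

theorem measure_of_trivial (hμ : IsMeasure μ) (X : HatSet E) [Finite X.carrier]
    (h : ∀ (g : X.grp) (x : X.carrier), g • x = x) : μ X = Nat.card X.carrier := by
  have := Fintype.ofFinite X.carrier
  rw [measure_eq_sum hμ X id h, Finset.sum_congr rfl fun i _ => hμ.point (X.sub (X.preim id h {i}))
    ⟨⟨⟨⟨i, rfl⟩⟩, fun y => Subtype.ext y.2⟩⟩]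
  simp

theorem measure_mem_of_transitive (hμ : IsMeasure μ) (K : Subring k) (X : HatSet E)
    (H : ∀ (Y : HatSet E) (_ : Y.carrier), Y.grp = X.grp →
      MulAction.IsPretransitive Y.grp Y.carrier → μ Y ∈ K) : μ X ∈ K := by
  have := X.finitary
  have := Fintype.ofFinite (MulAction.orbitRel.Quotient X.grp X.carrier)
  rw [measure_eq_sum hμ X (Quotient.mk (MulAction.orbitRel X.grp X.carrier))
    fun g x => Quotient.sound (s := MulAction.orbitRel X.grp X.carrier) ⟨g, rfl⟩]
  refine sum_mem fun q _ => H _ ⟨q.out, Quotient.out_eq q⟩ rfl ⟨?_⟩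
  rintro ⟨x, hx⟩ ⟨y, hy⟩
  obtain ⟨g, hg⟩ := Quotient.exact (s := MulAction.orbitRel X.grp X.carrier)
    ((show _ = q from hy).trans (show _ = q from hx).symm)
  exact ⟨g, Subtype.ext hg⟩

end Measure

end Olig.HatSet

namespace InfSp
open Olig.HatSet

/-! ### Restriction to smaller groups and coset spaces -/

section StabClass
variable {F : Type u} [Field F] [Finite F]

/-- The properties of `ℰ(𝐕)` and of the class of all open subgroups that are used below. -/
class IsStabClass (E : Set (Subgroup (Sp F))) : Prop where
  EV_subset : EV F ⊆ E
  subset_Op : E ⊆ Op F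
  inf_mem : ∀ U ∈ E, ∀ W ∈ E, U ⊓ W ∈ E
  conj_mem : ∀ U ∈ E, ∀ (g : Sp F) (V : Subgroup (Sp F)), (∀ x, x ∈ V ↔ g⁻¹ * x * g ∈ U) → V ∈ E

instance : IsStabClass (EV F) where
  EV_subset := subset_rfl
  subset_Op := stabClass_subset _ _
  inf_mem U hU W hW := by
    obtain ⟨A, hA, rfl⟩ := mem_EV_iff.1 hU
    obtain ⟨B, hB, rfl⟩ := mem_EV_iff.1 hW
    exact mem_EV_iff.2 ⟨A ⊔ B, inferInstance, (fixG_sup A B).symm⟩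
  conj_mem U hU g V hV := by
    obtain ⟨A, hA, rfl⟩ := mem_EV_iff.1 hU
    exact mem_EV_iff.2 ⟨A.map (toLin g), inferInstance,
      Subgroup.ext fun x => (hV x).trans mem_fixG_map.symm⟩

instance : IsStabClass (Op F) where
  EV_subset := stabClass_subset _ _
  subset_Op := subset_rfl
  inf_mem U hU W hW := by
    obtain ⟨A, hA, hAU⟩ := mem_Op_iff.1 hU
    obtain ⟨B, hB, hBW⟩ := mem_Op_iff.1 hW
    exact mem_Op_iff.2 ⟨A ⊔ B, inferInstance, fixG_sup A B ▸ inf_le_inf hAU hBW⟩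
  conj_mem U hU g V hV := by
    obtain ⟨A, hA, hAU⟩ := mem_Op_iff.1 hU
    exact mem_Op_iff.2 ⟨A.map (toLin g), inferInstance,
      fun x hx => (hV x).2 (hAU (mem_fixG_map.1 hx))⟩

theorem finite_range_of_factors {α β γ : Type*} [Finite γ] (f : α → β) (g : α → γ)
    (h : ∀ a a', g a = g a' → f a = f a') : (Set.range f).Finite := by
  refine Finite.of_injective (fun y : Set.range f => g y.2.choose) fun y y' hy => ?_
  have := h _ _ hy
  rw [y.2.choose_spec, y'.2.choose_spec] at this
  exact Subtype.ext this

variable {E : Set (Subgroup (Sp F))} [hE : IsStabClass E]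

theorem fixG_mem (A : Submodule F (Vinf F)) [Finite A] : fixG A ∈ E :=
  hE.EV_subset (mem_EV_iff.2 ⟨A, inferInstance, rfl⟩)

theorem exists_fixG_le {S : Subgroup (Sp F)} (hS : S ∈ E) :
    ∃ A : Submodule F (Vinf F), Finite A ∧ fixG A ≤ S := mem_Op_iff.1 (hE.subset_Op hS)

/-- A `Ĝ`-set with a smaller group of definition. -/
noncomputable def res (X : HatSet E) (W : Subgroup (Sp F)) (hW : W ∈ E) (h : W ≤ X.grp) : HatSet E where
  grp := W
  grp_mem := hW
  carrier := X.carrier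
  action := MulAction.compHom X.carrier (Subgroup.inclusion h)
  smooth x := by
    convert hE.inf_mem _ hW _ (X.smooth x)
    ext g
    rw [Subgroup.mem_inf, Subgroup.mem_map, Subgroup.mem_map]
    constructor
    · rintro ⟨g, hg, rfl⟩
      exact ⟨g.2, Subgroup.inclusion h g, hg, rfl⟩
    · rintro ⟨hg, g, hg', rfl⟩
      exact ⟨⟨g, hg⟩, hg', rfl⟩
  finitary := by
    let _ : MulAction W X.carrier := MulAction.compHom X.carrier (Subgroup.inclusion h)
    have := X.finitary
    obtain ⟨A, hA, hAW⟩ := exists_fixG_le hW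
    suffices H : ∀ x : X.carrier, (Set.range fun u : X.grp =>
        (⟦u • x⟧ : MulAction.orbitRel.Quotient W X.carrier)).Finite by
      have h1 : (⋃ q : MulAction.orbitRel.Quotient X.grp X.carrier, Set.range fun u : X.grp =>
        (⟦u • q.out⟧ : MulAction.orbitRel.Quotient W X.carrier)).Finite :=
          Set.finite_iUnion fun q => H q.out
      refine Set.finite_univ_iff.1 (h1.subset ?_)
      rintro ⟨x⟩ -
      obtain ⟨u, hu⟩ := Quotient.mk_out (s := MulAction.orbitRel X.grp X.carrier) x
      refine Set.mem_iUnion.2 ⟨⟦x⟧, u⁻¹, ?_⟩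
      change ⟦_⟧ = ⟦x⟧
      rw [inv_smul_eq_iff.2]
      exact hu.symm
    intro x
    obtain ⟨B, hB, hBx⟩ := exists_fixG_le (X.stab_mem x)
    -- With G(A) ≤ W and G(B) fixing x, the W-orbit of u x depends only on the position of uB
    -- relative to A, which leaves finitely many orbits.
    refine finite_range_of_factors _ (fun u : X.grp => relPosition A B u) fun u u' huu => ?_
    obtain ⟨y, hy, hyB⟩ := exists_mem_fixG_of_relPosition_eq huu
    refine (Quotient.sound (s := MulAction.orbitRel W X.carrier) ?_).symm
    refine ⟨⟨y, hAW hy⟩, ?_⟩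
    have h1 : (((u' : X.grp)⁻¹ * ⟨y, h (hAW hy)⟩ * u : X.grp) : Sp F) ∈ X.stab x := by
      refine hBx (mem_fixG.2 fun b hb => ?_)
      change ((u' : Sp F)⁻¹ * y * u) • b = b
      rw [mul_smul, mul_smul, hyB b hb, inv_smul_smul]
    have h2 := mem_stab'.1 h1
    rw [mul_smul, mul_smul, inv_smul_eq_iff] at h2
    exact h2

theorem stab_res (X : HatSet E) {W : Subgroup (Sp F)} (hW : W ∈ E) (h : W ≤ X.grp)
    (x : X.carrier) : (res X W hW h).stab x = W ⊓ X.stab x := by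
  ext g
  rw [Subgroup.mem_inf]
  refine mem_stab.trans ⟨fun ⟨h1, h2⟩ => ⟨h1, mem_stab.2 ⟨h h1, h2⟩⟩, fun ⟨h1, h2⟩ => ⟨h1, ?_⟩⟩
  obtain ⟨h3, h4⟩ := mem_stab.1 h2
  exact h4

/-- The coset space `U / S`. -/
noncomputable def quot (U S : Subgroup (Sp F)) (hU : U ∈ E) (hS : S ∈ E) (hSU : S ≤ U) : HatSet E where
  grp := U
  grp_mem := hU
  carrier := U ⧸ S.subgroupOf U
  smooth x := by
    induction x using QuotientGroup.induction_on with
    | H u =>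
      refine hE.conj_mem S hS u _ fun x => ?_
      rw [Subgroup.mem_map]
      constructor
      · rintro ⟨g, hg, rfl⟩
        have := QuotientGroup.eq.1 (MulAction.mem_stabilizer_iff.1 hg).symm
        simpa [Subgroup.mem_subgroupOf, mul_assoc] using this
      · intro hx
        have hxU : x ∈ U := by
          have := mul_mem (mul_mem u.2 (hSU hx)) (inv_mem u.2)
          simpa [mul_assoc] using this
        refine ⟨⟨x, hxU⟩, ?_, rfl⟩
        rw [MulAction.mem_stabilizer_iff]
        refine (QuotientGroup.eq.2 ?_).symm
        simpa [Subgroup.mem_subgroupOf, mul_assoc] using hx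
  finitary := by
    have := (MulAction.pretransitive_iff_subsingleton_quotient U (U ⧸ S.subgroupOf U)).1 inferInstance
    infer_instance

omit [Finite F] in
/-- There is a transitive `U`-set with a given stabilizer. -/
theorem exists_transitive {U S : Subgroup (Sp F)} (hU : U ∈ E) (hS : S ∈ E) (hSU : S ≤ U) :
    ∃ (X : HatSet E) (x : X.carrier), X.grp = U ∧ MulAction.IsPretransitive X.grp X.carrier ∧
      X.stab x = S := by
  refine ⟨quot U S hU hS hSU, ((1 : U) : U ⧸ S.subgroupOf U), rfl,
    inferInstanceAs (MulAction.IsPretransitive U (U ⧸ S.subgroupOf U)), ?_⟩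
  ext g
  refine mem_stab.trans ⟨?_, fun hg => ⟨hSU hg, ?_⟩⟩
  · rintro ⟨h1, h2⟩
    have h3 : ((⟨g, h1⟩ * 1 : U) : U ⧸ S.subgroupOf U) = ((1 : U) : U ⧸ S.subgroupOf U) := h2
    rw [mul_one] at h3
    simpa [Subgroup.mem_subgroupOf] using QuotientGroup.eq.1 h3.symm
  · change ((⟨g, hSU hg⟩ * 1 : U) : U ⧸ S.subgroupOf U) = ((1 : U) : U ⧸ S.subgroupOf U)
    rw [mul_one]
    refine (QuotientGroup.eq.2 ?_).symm
    simpa [Subgroup.mem_subgroupOf] using hg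

section Measure
variable {k : Type w} [CommRing k] {μ : HatSet E → k}

theorem iso_res (X : HatSet E) {W : Subgroup (Sp F)} (hW : W ∈ E) (h : W ≤ X.grp) :
    Iso (res X W hW h) X :=
  ⟨W, hW, id, Function.bijective_id, le_rfl, h, fun _ _ _ => rfl⟩

theorem measure_mem_of_orbits (hμ : IsMeasure μ) (K : Subring k) (X : HatSet E)
    {W : Subgroup (Sp F)} (hW : W ∈ E) (hWX : W ≤ X.grp)
    (H : ∀ (Y : HatSet E) (_ : Y.carrier), Y.grp = W →
      MulAction.IsPretransitive Y.grp Y.carrier → μ Y ∈ K) : μ X ∈ K := by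
  rw [← hμ.iso _ _ (iso_res X hW hWX)]
  exact measure_mem_of_transitive hμ K (res X W hW hWX) H

end Measure
end StabClass
end InfSp

namespace InfSp
open Olig.HatSet

/-! ### A measure is generated by its value on 𝐕 -/

section Generation
variable {F : Type u} [Field F] [Finite F] {E : Set (Subgroup (Sp F))} [hE : IsStabClass E]

omit [Finite F] in
theorem mem_fixG_span_singleton {v : Vinf F} {g : Sp F} :
    g ∈ fixG (Submodule.span F {v}) ↔ g • v = v := by
  rw [← fixingSubgroup_eq_fixG, mem_fixingSubgroup_iff]
  simp

variable (E) in
/-- `𝐕` as a `Ĝ`-set. -/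
noncomputable def hatVE : HatSet E := (hatV F).ofSubset hE.EV_subset

theorem stab_hatVE (v : Vinf F) : (hatVE E).stab v = fixG (Submodule.span F {v}) := by
  ext g
  rw [mem_fixG_span_singleton]
  exact mem_stab.trans ⟨fun ⟨_, h⟩ => h, fun h => ⟨trivial, h⟩⟩

variable (E) in
/-- `𝐕` as a `G(A)`-set. -/
noncomputable def hatVres (A : Submodule F (Vinf F)) [Finite A] : HatSet E :=
  res (hatVE E) (fixG A) (fixG_mem A) (fun _ _ => trivial)

omit [Finite F] in
theorem domRestrict_smul (A : Submodule F (Vinf F)) (g : fixG A) (v : Vinf F) :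
    (formV F ((g : Sp F) • v)).domRestrict A = (formV F v).domRestrict A := by
  refine LinearMap.ext fun a => ?_
  rw [LinearMap.domRestrict_apply, LinearMap.domRestrict_apply,
    ← formV_smul_smul (g : Sp F) v, mem_fixG.1 g.2 a a.2]

variable (E) in
/-- The `G(A)`-set of vectors with given pairings with `A`. -/
noncomputable def hatL (A : Submodule F (Vinf F)) [Finite A] (l : Module.Dual F A) : HatSet E :=
  (hatVres E A).sub ((hatVres E A).preim
    (fun v : Vinf F => (formV F v).domRestrict A) (domRestrict_smul A) {l})

/-- The underlying vector of a point of `hatL E A l`. -/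
def hatLval {A : Submodule F (Vinf F)} [Finite A] {l : Module.Dual F A}
    (z : (hatL E A l).carrier) : Vinf F := z.1

theorem hatLval_spec {A : Submodule F (Vinf F)} [Finite A] {l : Module.Dual F A}
    (z : (hatL E A l).carrier) : (formV F (hatLval z)).domRestrict A = l := z.2

theorem hatLval_injective {A : Submodule F (Vinf F)} [Finite A] {l : Module.Dual F A} :
    Function.Injective (hatLval : (hatL E A l).carrier → Vinf F) := Subtype.val_injective

omit [Finite F] in
theorem exists_domRestrict_eq (A : Submodule F (Vinf F)) [Finite A] (l : Module.Dual F A) :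
    ∃ v, (formV F v).domRestrict A = l := by
  obtain ⟨l', hl'⟩ := LinearMap.exists_extend l
  obtain ⟨v, hv⟩ := exists_formV_eq l' A (finite_coe A)
  exact ⟨v, LinearMap.ext fun a => (hv a a.2).trans (LinearMap.congr_fun hl' a)⟩

/-- Translation by a vector d with pairings l' - l is a bijection. It is equivariant only for the
elements that also fix d, and this is enough for an isomorphism of `Ĝ`-sets. -/
theorem iso_hatL (A : Submodule F (Vinf F)) [Finite A] (l l' : Module.Dual F A) :
    HatSet.Iso (hatL E A l) (hatL E A l') := by
  obtain ⟨d, hd⟩ := exists_domRestrict_eq A (l' - l)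
  have hadd : ∀ v : Vinf F, (formV F v).domRestrict A = l →
      (formV F (v + d)).domRestrict A = l' := fun v hv => by
    have : (formV F (v + d)).domRestrict A =
        (formV F v).domRestrict A + (formV F d).domRestrict A := by
      rw [map_add]
      rfl
    rw [this, hv, hd, add_sub_cancel]
  have hsub : ∀ v : Vinf F, (formV F v).domRestrict A = l' →
      (formV F (v - d)).domRestrict A = l := fun v hv => by
    have : (formV F (v - d)).domRestrict A =
        (formV F v).domRestrict A - (formV F d).domRestrict A := by
      rw [map_sub]
      rfl
    rw [this, hv, hd, sub_sub_cancel]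
  have hle : fixG (A ⊔ Submodule.span F {d}) ≤ fixG A := fixG_antitone le_sup_left
  refine ⟨fixG (A ⊔ Submodule.span F {d}), fixG_mem _,
    fun z => ⟨hatLval z + d, hadd _ (hatLval_spec z)⟩, ⟨fun z z' h => ?_, fun z => ?_⟩, hle, hle,
    fun g hg z => ?_⟩
  · exact hatLval_injective (add_right_cancel (b := d) (congrArg hatLval h))
  · exact ⟨⟨hatLval z - d, hsub _ (hatLval_spec z)⟩,
      hatLval_injective (sub_add_cancel (hatLval z) d)⟩
  · refine hatLval_injective ?_
    change g • hatLval z + d = g • (hatLval z + d)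
    rw [smul_add, mem_fixG.1 hg d (Submodule.mem_sup_right (Submodule.mem_span_singleton_self d))]

variable {k : Type w} [CommRing k] {μ : HatSet E → k}

/-- 𝐕 is cut into one piece for each functional on A. The pieces are isomorphic and their number is
|A*| = |A|. -/
theorem measure_hatVE (hμ : IsMeasure μ) (A : Submodule F (Vinf F)) [Finite A]
    (l : Module.Dual F A) : μ (hatVE E) = Nat.card A * μ (hatL E A l) := by
  have : Finite (Module.Dual F A) := Finite.of_injective (fun l : Module.Dual F A => (l : A → F))
    DFunLike.coe_injective
  have := Fintype.ofFinite (Module.Dual F A)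
  rw [← hμ.iso _ _ (iso_res (hatVE E) (fixG_mem A) (fun _ _ => trivial)), ← card_dual (F := F),
    measure_eq_sum hμ (res (hatVE E) (fixG A) (fixG_mem A) (fun _ _ => trivial))
      (fun v : Vinf F => (formV F v).domRestrict A) (domRestrict_smul A)]
  refine (Finset.sum_congr rfl fun l' _ =>
    hμ.iso (hatL E A l') (hatL E A l) (iso_hatL A l' l)).trans ?_
  simp

theorem transitive_hatL {A : Submodule F (Vinf F)} [Finite A] {u z : Vinf F} (hu : u ∉ A)
    (hz : z ∉ A) (h : (formV F z).domRestrict A = (formV F u).domRestrict A) :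
    ∃ g : fixG A, (g : Sp F) • u = z := by
  obtain ⟨g, hg, hgu⟩ := exists_move (finite_coe A) hu hz
    fun a ha => (LinearMap.congr_fun h ⟨a, ha⟩).symm
  exact ⟨⟨g, mem_fixG.2 hg⟩, hgu⟩

-- This is the one-step case G(A)/G(A + ⟨u⟩). By Witt's theorem the orbit of u consists of all
-- vectors outside A that pair with A as u does. Its measure is therefore μ(𝐕)/|A| minus the
-- contribution of the vectors in A, each of which gives a fixed point or nothing.
open Classical in
theorem measure_mem_of_span_singleton (hμ : IsMeasure μ) (K : Subring k)
    (hV : μ (hatVE E) ∈ K) (hq : ∃ r ∈ K, r * Nat.card F = 1) {A : Submodule F (Vinf F)} [Finite A]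
    {u : Vinf F} (hu : u ∉ A) (X : HatSet E) (hX : X.grp = fixG A)
    [MulAction.IsPretransitive X.grp X.carrier] (x : X.carrier)
    (hx : X.stab x = fixG (A ⊔ Submodule.span F {u})) : μ X ∈ K := by
  set l : Module.Dual F A := (formV F u).domRestrict A with hl
  have hL : μ (hatL E A l) ∈ K := by
    obtain ⟨r, hr, hrq⟩ := hq
    have : Module.Finite F A := Module.Finite.of_finite
    have h1 : r ^ Module.finrank F A * μ (hatVE E) = μ (hatL E A l) := by
      rw [measure_hatVE hμ A l, Module.natCard_eq_pow_finrank (K := F) (V := A), Nat.cast_pow,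
        ← mul_assoc, ← mul_pow, hrq, one_pow, one_mul]
    exact h1 ▸ mul_mem (pow_mem hr _) hV
  let f : (hatL E A l).carrier → Option A := fun z =>
    if h : hatLval z ∈ A then some ⟨_, h⟩ else none
  have hf : ∀ (g : (hatL E A l).grp) z, f (g • z) = f z := by
    intro g z
    have hg : (g : Sp F) ∈ fixG A := g.2
    by_cases h : hatLval z ∈ A
    · have h1 : (g : Sp F) • hatLval z = hatLval z := mem_fixG.1 hg _ h
      have : g • z = z := hatLval_injective h1
      rw [this]
    · have h1 : (g : Sp F) • hatLval z ∉ A := fun h' => h (by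
        have := mem_fixG.1 (inv_mem hg) _ h'
        rw [inv_smul_smul] at this
        rwa [this])
      have e1 : f (g • z) = none := dif_neg h1
      have e2 : f z = none := dif_neg h
      exact e1.trans e2.symm
  have := Fintype.ofFinite A
  rw [measure_eq_sum hμ _ f hf, Fintype.sum_option] at hL
  have hsum : ∑ a : A, μ ((hatL E A l).sub ((hatL E A l).preim f hf {some a})) ∈ K := by
    refine sum_mem fun a _ => ?_
    have hval : ∀ z : ((hatL E A l).sub ((hatL E A l).preim f hf {some a})).carrier,
        hatLval z.1 = (a : Vinf F) := fun z => by
      have hz : f z.1 = some a := z.2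
      by_cases h : hatLval z.1 ∈ A
      · exact congrArg Subtype.val (Option.some_injective _ ((dif_pos h).symm.trans hz))
      · cases (dif_neg h).symm.trans hz
    have : Subsingleton ((hatL E A l).sub ((hatL E A l).preim f hf {some a})).carrier :=
      ⟨fun z z' => Subtype.ext (hatLval_injective ((hval z).trans (hval z').symm))⟩
    exact measure_mem_of_subsingleton hμ K _
  have hO := (add_mem_cancel_right hsum).1 hL
  set O := (hatL E A l).sub ((hatL E A l).preim f hf {none}) with hOdef
  have hnone : ∀ z : O.carrier, hatLval z.1 ∉ A := fun z h => by
    have hz : f z.1 = none := z.2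
    cases (dif_pos h).symm.trans hz
  let o : O.carrier := ⟨⟨u, rfl⟩, dif_neg hu⟩
  have hOt : MulAction.IsPretransitive O.grp O.carrier := by
    refine ⟨fun z z' => ?_⟩
    obtain ⟨g, hg⟩ := transitive_hatL (hnone z) (hnone z')
      ((show _ = l from z'.1.2).trans (show _ = l from z.1.2).symm)
    exact ⟨g, Subtype.ext (Subtype.ext hg)⟩
  have ho : O.stab o = fixG (A ⊔ Submodule.span F {u}) := by
    refine (stab_sub _ _).trans ((stab_sub _ _).trans ((stab_res _ _ _ _).trans ?_))
    rw [fixG_sup]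
    exact congrArg (fixG A ⊓ ·) (stab_hatVE u)
  rwa [hμ.iso X O (iso_of_stab_eq hX x o (hx.trans ho.symm))]

/-- Adjoining the vectors of B to A one at a time gives a tower of one-step extensions, and the
measures multiply. -/
theorem measure_mem_of_stab_eq_fixG (hμ : IsMeasure μ) (K : Subring k)
    (hV : μ (hatVE E) ∈ K) (hq : ∃ r ∈ K, r * Nat.card F = 1) {A B : Submodule F (Vinf F)} [Finite A]
    [Finite B] (hAB : A ≤ B) (X : HatSet E) (hX : X.grp = fixG A)
    [ht : MulAction.IsPretransitive X.grp X.carrier] (x : X.carrier) (hx : X.stab x = fixG B) :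
    μ X ∈ K := by
  suffices H : ∀ s : Set (Vinf F), s.Finite → ∀ (X : HatSet E) (x : X.carrier), X.grp = fixG A →
      MulAction.IsPretransitive X.grp X.carrier → X.stab x = fixG (A ⊔ Submodule.span F s) →
      μ X ∈ K by
    refine H B (finite_coe B) X x hX ht ?_
    rw [hx, Submodule.span_eq, sup_eq_right.2 hAB]
  intro s hs
  induction s, hs using Set.Finite.induction_on with
  | empty =>
    intro X x hX ht hx
    have : Subsingleton X.carrier := by
      have hfix : ∀ y, y = x := fun y => by
        obtain ⟨g, rfl⟩ := MulAction.exists_smul_eq X.grp x y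
        refine mem_stab'.1 ?_
        rw [hx, Submodule.span_empty, sup_bot_eq, ← hX]
        exact g.2
      exact ⟨fun y z => (hfix y).trans (hfix z).symm⟩
    exact measure_mem_of_subsingleton hμ K X
  | @insert w s _ hs ih =>
    intro X x hX ht hx
    have := finite_span (F := F) hs
    have hAw : A ⊔ Submodule.span F (insert w s) =
        (A ⊔ Submodule.span F s) ⊔ Submodule.span F {w} := by
      rw [Submodule.span_insert, sup_assoc, sup_comm (Submodule.span F {w})]
    rw [hAw] at hx
    by_cases hw : w ∈ A ⊔ Submodule.span F s
    · rw [sup_eq_left.2 ((Submodule.span_singleton_le_iff_mem _ _).2 hw)] at hx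
      exact ih X x hX ht hx
    · obtain ⟨Y, y, hY, hYt, hy⟩ := exists_transitive (E := E) (fixG_mem A)
        (fixG_mem (A ⊔ Submodule.span F s)) (fixG_antitone le_sup_left)
      obtain ⟨T, t, hT, hTt, ht'⟩ := exists_transitive (E := E)
        (fixG_mem (A ⊔ Submodule.span F s))
        (fixG_mem ((A ⊔ Submodule.span F s) ⊔ Submodule.span F {w})) (fixG_antitone le_sup_left)
      rw [hμ.fiber X Y T (isFiber_of_stab_eq (hX.trans hY.symm) x y t
        (by rw [hx, hy]; exact fixG_antitone le_sup_left) (hT.trans hy.symm) (ht'.trans hx.symm))]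
      exact mul_mem (ih Y y hY hYt hy) (measure_mem_of_span_singleton hμ K hV hq hw T hT t ht')

/-- A measure relative to `ℰ(𝐕)` takes its values in every subring that contains its value on `𝐕`
and an inverse of `q`. -/
theorem measure_mem_EV {μ : HatSet (EV F) → k} (hμ : IsMeasure μ) (K : Subring k)
    (hV : μ (hatV F) ∈ K) (hq : ∃ r ∈ K, r * Nat.card F = 1) (X : HatSet (EV F)) : μ X ∈ K := by
  obtain ⟨A, hA, hXA⟩ := mem_EV_iff.1 X.grp_mem
  refine measure_mem_of_transitive hμ K X fun Y y hYX hY => ?_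
  obtain ⟨B, hB, hYB⟩ := mem_EV_iff.1 (Y.stab_mem y)
  refine measure_mem_of_stab_eq_fixG hμ K hV hq (fixG_le_fixG.1 ?_) Y (hYX.trans hXA) y hYB
  rw [← hYB, ← hXA, ← hYX]
  exact Y.stab_le y

/-- A measure takes its values in every subring that contains its value on `𝐕` and inverses of all
positive integers. -/
theorem measure_mem_Op {μ : HatSet (Op F) → k} (hμ : IsMeasure μ) (K : Subring k)
    (hV : μ (hatVE (Op F)) ∈ K) (hq : ∀ n : ℕ, n ≠ 0 → ∃ r ∈ K, r * n = 1) (X : HatSet (Op F)) :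
    μ X ∈ K := by
  obtain ⟨A, hA, hXA⟩ := exists_fixG_le X.grp_mem
  refine measure_mem_of_orbits hμ K X (fixG_mem A) hXA fun Y y hYA hY => ?_
  -- With S the stabilizer of y and B its smallest support, μ(G(A)/G(B)) = μ(G(A)/S) μ(S/G(B)). The
  -- left side is already known to lie in K, and the last factor turns out to be a positive integer.
  obtain ⟨B, hB, hsupp⟩ := exists_support (Y.stab_mem y)
  have hBS : fixG B ≤ Y.stab y := (hsupp B hB).2 le_rfl
  have hSA : Y.stab y ≤ fixG A := hYA ▸ Y.stab_le y
  obtain ⟨Q, x, hQ, hQt, hx⟩ := exists_transitive (E := Op F) (fixG_mem A) (fixG_mem B)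
    (hBS.trans hSA)
  obtain ⟨T, t, hT, hTt, ht⟩ := exists_transitive (E := Op F) (Y.stab_mem y) (fixG_mem B) hBS
  -- Conjugating by s in S carries supports of S to supports of S, so the smallest one is stable
  -- under S.
  have hBstable : ∀ s ∈ Y.stab y, ∀ b ∈ B, s • b ∈ B := by
    intro s hs b hb
    have h1 : B ≤ B.map (toLin s⁻¹) := (hsupp _ inferInstance).1 fun g hg => by
      rw [mem_fixG_map, inv_inv] at hg
      simpa [mul_assoc] using mul_mem (mul_mem (inv_mem hs) (hBS hg)) hs
    simpa [mem_map_toLin] using mem_map_toLin.1 (h1 hb)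
  have hstabT : ∀ (g : T.grp), (∀ b ∈ B, (g : Sp F) • b = b) → g • t = t := fun g hg =>
    mem_stab'.1 (ht ▸ mem_fixG.2 hg)
  -- A coset in S/G(B) is determined by the action on the finite set B.
  have hTfin : Finite T.carrier := by
    refine Set.finite_univ_iff.1 ((finite_range_of_factors (fun g : T.grp => g • t)
      (fun g (b : B) => (⟨(g : Sp F) • (b : Vinf F), hBstable g (hT ▸ g.2) b b.2⟩ : B)) ?_).subset ?_)
    · intro g g' hgg
      have : (g'⁻¹ * g) • t = t := hstabT _ fun b hb => by
        have := congrArg Subtype.val (congrFun hgg ⟨b, hb⟩)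
        change ((g' : Sp F)⁻¹ * (g : Sp F)) • b = b
        rw [mul_smul, inv_smul_eq_iff]
        exact this
      rwa [mul_smul, inv_smul_eq_iff] at this
    · rintro t' -
      exact MulAction.exists_smul_eq T.grp t t'
  -- G(B) acts trivially on S/G(B) because S preserves B. After restriction to G(B) this is a finite
  -- disjoint union of points.
  have hTcard : μ T = Nat.card T.carrier := by
    rw [← hμ.iso _ _ (iso_res T (fixG_mem B) (hBS.trans hT.ge))]
    have : Finite (res T (fixG B) (fixG_mem B) (hBS.trans hT.ge)).carrier := hTfin
    refine measure_of_trivial hμ (res T (fixG B) (fixG_mem B) (hBS.trans hT.ge)) ?_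
    rintro ⟨g, hg⟩ (t' : T.carrier)
    obtain ⟨s, rfl⟩ := MulAction.exists_smul_eq T.grp t t'
    have hgT : g ∈ T.grp := hT ▸ hBS hg
    change (⟨g, hgT⟩ : T.grp) • s • t = s • t
    rw [← inv_smul_eq_iff, ← mul_smul, ← mul_smul]
    refine hstabT _ fun b hb => ?_
    change ((s : Sp F)⁻¹ * (g * (s : Sp F))) • b = b
    rw [mul_smul, mul_smul, mem_fixG.1 hg _ (hBstable s (hT ▸ s.2) b hb), inv_smul_smul]
  obtain ⟨r, hr, hrn⟩ := hq (Nat.card T.carrier) (by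
    have : Nonempty T.carrier := ⟨t⟩
    exact Nat.card_pos.ne')
  have hmul := hμ.fiber Q Y T (isFiber_of_stab_eq (hQ.trans hYA.symm) x y t (hx ▸ hBS) hT
    (ht.trans hx.symm))
  have : μ Y = μ Q * r := by
    rw [hmul, hTcard, mul_assoc, mul_comm _ r, hrn, mul_one]
  rw [this]
  exact mul_mem (measure_mem_of_stab_eq_fixG hμ K hV (hq _ Nat.card_pos.ne')
    (fixG_le_fixG.1 (hBS.trans hSA)) Q hQ x hx) hr

end Generation
end InfSp

namespace InfSp
open Olig.HatSet Filter

/-! ### The counting measure -/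

section Count
variable {F : Type u} [Field F] {E : Set (Subgroup (Sp F))}

/-- The points of a `Ĝ`-set that are fixed by `G(V_{m,0})`. -/
def fixPts (X : HatSet E) (m : ℕ) : Set X.carrier := {x | fixG (stdSub F m) ≤ X.stab x}

/-- The number of points of a `Ĝ`-set that are fixed by `G(V_{m,0})`. -/
noncomputable def cnt (X : HatSet E) (m : ℕ) : ℕ := Nat.card (fixPts X m)

variable [Finite F]

theorem eventually_fixG_stdSub_le {W : Subgroup (Sp F)} (hW : W ∈ Op F) :
    ∀ᶠ m in atTop, fixG (stdSub F m) ≤ W := by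
  obtain ⟨A, hA, hAW⟩ := mem_Op_iff.1 hW
  filter_upwards [eventually_le_stdSub A] with m hm using (fixG_antitone hm).trans hAW

/-- If B is the smallest support of the stabilizer of x, then u x can be fixed by G(V_{m,0}) only if
uB ⊆ V_{m,0}. Moreover u x depends only on the restriction B → V_{m,0} of u, and there are finitely
many such maps. -/
theorem finite_fixPts (hE : E ⊆ Op F) (X : HatSet E) (m : ℕ) : (fixPts X m).Finite := by
  have := X.finitary
  suffices H : ∀ x : X.carrier,
      (Set.range fun u : {u : X.grp // u • x ∈ fixPts X m} => u.1 • x).Finite by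
    have h1 := Set.finite_iUnion
      fun q : MulAction.orbitRel.Quotient X.grp X.carrier => H q.out
    refine h1.subset fun x hx => ?_
    obtain ⟨u, hu⟩ := Quotient.mk_out (s := MulAction.orbitRel X.grp X.carrier) x
    have hu' : u⁻¹ • Quotient.out (Quotient.mk (MulAction.orbitRel X.grp X.carrier) x) = x :=
      inv_smul_eq_iff.2 hu.symm
    exact Set.mem_iUnion.2 ⟨_, ⟨u⁻¹, by rwa [hu']⟩, hu'⟩
  intro x
  obtain ⟨B, hB, hsupp⟩ := exists_support (hE (X.stab_mem x))
  have key : ∀ u : {u : X.grp // u • x ∈ fixPts X m}, ∀ b ∈ B, (u.1 : Sp F) • b ∈ stdSub F m := by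
    rintro ⟨u, hu⟩ b hb
    have h1 : B ≤ (stdSub F m).map (toLin (u : Sp F)⁻¹) := (hsupp _ inferInstance).1 fun g hg => by
      rw [mem_fixG_map, inv_inv] at hg
      simpa [mul_assoc] using mem_stab_smul.1 (hu hg)
    simpa [mem_map_toLin] using mem_map_toLin.1 (h1 hb)
  refine finite_range_of_factors _ (fun u (b : B) =>
    (⟨(u.1 : Sp F) • (b : Vinf F), key u b b.2⟩ : stdSub F m)) fun u u' huu => ?_
  have : ((u'.1⁻¹ * u.1 : X.grp) : Sp F) ∈ X.stab x := by
    refine (hsupp B hB).2 le_rfl (mem_fixG.2 fun b hb => ?_)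
    change ((u'.1 : Sp F)⁻¹ * (u.1 : Sp F)) • b = b
    rw [mul_smul, inv_smul_eq_iff]
    exact congrArg Subtype.val (congrFun huu ⟨b, hb⟩)
  rwa [mem_stab', mul_smul, inv_smul_eq_iff] at this

omit [Finite F] in
theorem le_stab_of_isMap {W H : Subgroup (Sp F)} {X Y : HatSet E} {f : X.carrier → Y.carrier}
    (hf : IsMap W X Y f) (hH : H ≤ W) {x : X.carrier} (hx : H ≤ X.stab x) : H ≤ Y.stab (f x) := by
  obtain ⟨hX, hY, hf⟩ := hf
  intro g hg
  obtain ⟨h1, h2⟩ := mem_stab.1 (hx hg)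
  refine mem_stab.2 ⟨hY (hH hg), ?_⟩
  rw [← hf g (hH hg)]
  exact congrArg f h2

omit [Finite F] in
theorem le_stab_iff_of_isMap {W H : Subgroup (Sp F)} {X Y : HatSet E} {f : X.carrier → Y.carrier}
    (hf : IsMap W X Y f) (hinj : Function.Injective f) (hH : H ≤ W) {x : X.carrier} :
    H ≤ Y.stab (f x) ↔ H ≤ X.stab x := by
  refine ⟨fun hx => ?_, le_stab_of_isMap hf hH⟩
  obtain ⟨hX, hY, hf⟩ := hf
  intro g hg
  obtain ⟨h1, h2⟩ := mem_stab.1 (hx hg)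
  refine mem_stab.2 ⟨hX (hH hg), hinj ?_⟩
  rw [hf g (hH hg)]
  exact h2

theorem smul_mem_fixPts {X : HatSet E} {m : ℕ} {u : X.grp}
    (hu : ∀ v ∈ stdSub F m, (u : Sp F) • v ∈ stdSub F m) {x : X.carrier} :
    u • x ∈ fixPts X m ↔ x ∈ fixPts X m := by
  constructor
  · intro h g hg
    have h1 : (u : Sp F) * g * (u : Sp F)⁻¹ ∈ fixG (stdSub F m) := by
      rw [← conj_mem_fixG_stdSub hu]
      simpa [mul_assoc] using hg
    simpa [mul_assoc] using mem_stab_smul.1 (h h1)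
  · intro h g hg
    exact mem_stab_smul.2 (h ((conj_mem_fixG_stdSub hu).2 hg))

/-- The bijection is equivariant only for some W, so it matches fixed points once G(V_{m,0}) ≤ W.
This is why the counts are treated as germs at infinity. -/
theorem cnt_eq_of_iso {X Y : HatSet E} (hE : E ⊆ Op F) (h : HatSet.Iso X Y) :
    ∀ᶠ m in atTop, cnt X m = cnt Y m := by
  obtain ⟨W, hW, f, hf, hfm⟩ := h
  filter_upwards [eventually_fixG_stdSub_le (hE hW)] with m hm
  exact Nat.card_congr ((Equiv.ofBijective f hf).subtypeEquiv
    fun x => (le_stab_iff_of_isMap hfm hf.1 hm).symm)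

theorem cnt_eq_one {X : HatSet E} (hE : E ⊆ Op F) (h : Nonempty (Unique X.carrier)) :
    ∀ᶠ m in atTop, cnt X m = 1 := by
  obtain ⟨⟨x⟩, hx⟩ := h
  filter_upwards [eventually_fixG_stdSub_le (hE (X.stab_mem x))] with m hm
  exact Nat.card_eq_one_iff_unique.2
    ⟨⟨fun y z => Subtype.ext ((hx y.1).trans (hx z.1).symm)⟩, ⟨⟨x, hm⟩⟩⟩

theorem cnt_eq_add {X Y Z : HatSet E} (hE : E ⊆ Op F) (h : HatSet.IsCoprod X Y Z) :
    ∀ᶠ m in atTop, cnt Z m = cnt X m + cnt Y m := by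
  obtain ⟨W, hW, i, j, hi, hj, hi', hj', hc⟩ := h
  filter_upwards [eventually_fixG_stdSub_le (hE hW)] with m hm
  have := (finite_fixPts hE X m).to_subtype
  have := (finite_fixPts hE Y m).to_subtype
  have e : Function.Bijective (Sum.elim
      (fun x : fixPts X m => (⟨i x, (le_stab_iff_of_isMap hi hi' hm).2 x.2⟩ : fixPts Z m))
      (fun y : fixPts Y m => (⟨j y, (le_stab_iff_of_isMap hj hj' hm).2 y.2⟩ : fixPts Z m))) := by
    constructor
    · rintro (x | x) (y | y) hxy
      · exact congrArg Sum.inl (Subtype.ext (hi' (congrArg Subtype.val hxy)))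
      · exact (Set.disjoint_left.1 hc.disjoint ⟨x.1, rfl⟩
          ⟨y.1, (congrArg Subtype.val hxy).symm⟩).elim
      · exact (Set.disjoint_left.1 hc.disjoint ⟨y.1, rfl⟩
          ⟨x.1, congrArg Subtype.val hxy⟩).elim
      · exact congrArg Sum.inr (Subtype.ext (hj' (congrArg Subtype.val hxy)))
    · rintro ⟨z, hz⟩
      rcases (hc.sup_eq_top.ge : Set.univ ⊆ _) (Set.mem_univ z) with ⟨x, rfl⟩ | ⟨y, rfl⟩
      · exact ⟨Sum.inl ⟨x, (le_stab_iff_of_isMap hi hi' hm).1 hz⟩, rfl⟩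
      · exact ⟨Sum.inr ⟨y, (le_stab_iff_of_isMap hj hj' hm).1 hz⟩, rfl⟩
  rw [cnt, ← Nat.card_congr (Equiv.ofBijective _ e), Nat.card_sum, cnt, cnt]

theorem cnt_eq_of_isTwist {g : Sp F} {X Y : HatSet E} (hE : E ⊆ Op F) (h : HatSet.IsTwist g X Y) :
    ∀ᶠ m in atTop, cnt Y m = cnt X m := by
  obtain ⟨W, hW, hX, hY, f, hf, hfg⟩ := h
  obtain ⟨A, hA, hAW⟩ := mem_Op_iff.1 (hE hW)
  filter_upwards [eventually_le_stdSub A, eventually_le_stdSub (A.map (toLin g))] with m hm hm'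
  -- The twisting element g need not preserve V_{m,0}, so it is replaced by `g₁`, which does and
  -- which agrees with g on A. The discrepancy `g⁻¹ * g₁` lies in G(A) ≤ W and acts on X. Composing
  -- f with it turns conjugation by g into conjugation by `g₁`, which normalizes G(V_{m,0}).
  obtain ⟨g₁, hg₁, hg₁m⟩ := exists_extension m A hm g fun a ha => hm' ⟨a, ha, rfl⟩
  have hhW : g⁻¹ * g₁ ∈ W := hAW (mem_fixG.2 fun a ha => by
    rw [mul_smul, hg₁ a ha, inv_smul_smul])
  have hconj : ∀ x ∈ fixG (stdSub F m), g⁻¹ * x * g ∈ W := fun x hx =>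
    hAW (mem_fixG_map.1 (fixG_antitone hm' hx))
  let h : X.grp := ⟨g⁻¹ * g₁, hX hhW⟩
  refine (Nat.card_congr (((MulAction.toPerm h).trans (Equiv.ofBijective f hf)).subtypeEquiv
    fun x => ?_)).symm
  change fixG (stdSub F m) ≤ X.stab x ↔ fixG (stdSub F m) ≤ Y.stab (f (h • x))
  have key : ∀ y ∈ fixG (stdSub F m), y ∈ Y.stab (f (h • x)) ↔ g₁⁻¹ * y * g₁ ∈ X.stab x := by
    intro y hy
    have h1 : y ∈ Y.stab (f (h • x)) ↔ g⁻¹ * y * g ∈ X.stab (h • x) := by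
      have h2 : (⟨g * (g⁻¹ * y * g) * g⁻¹, hY _ (hconj y hy)⟩ : Y.grp) • f (h • x) =
        f ((⟨g⁻¹ * y * g, hX (hconj y hy)⟩ : X.grp) • h • x) := (hfg _ (hconj y hy) _).symm
      have h3 : g * (g⁻¹ * y * g) * g⁻¹ = y := by group
      rw [← h3, mem_stab, h3]
      constructor
      · rintro ⟨h4, h5⟩
        exact mem_stab.2 ⟨hX (hconj y hy), hf.1 (h2.symm.trans (by convert h5 using 3))⟩
      · intro h4
        obtain ⟨h5, h6⟩ := mem_stab.1 h4
        refine ⟨h3 ▸ hY _ (hconj y hy), ?_⟩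
        refine Eq.trans ?_ (h2.trans (congrArg f h6))
        congr 2
        exact h3.symm
    rw [h1, mem_stab_smul]
    change (g⁻¹ * g₁)⁻¹ * (g⁻¹ * y * g) * (g⁻¹ * g₁) ∈ X.stab x ↔ _
    rw [show (g⁻¹ * g₁)⁻¹ * (g⁻¹ * y * g) * (g⁻¹ * g₁) = g₁⁻¹ * y * g₁ by group]
  constructor
  · intro hx y hy
    exact (key y hy).2 (hx ((conj_mem_fixG_stdSub hg₁m).2 hy))
  · intro hx y hy
    have h1 : g₁ * y * g₁⁻¹ ∈ fixG (stdSub F m) := by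
      rw [← conj_mem_fixG_stdSub hg₁m]
      simpa [mul_assoc] using hy
    simpa [mul_assoc] using (key _ h1).1 (hx h1)

theorem card_eq_mul_of_fibers {α β : Type*} [Finite α] [Finite β] (f : α → β) (n : ℕ)
    (h : ∀ b, Nat.card {a // f a = b} = n) : Nat.card α = Nat.card β * n := by
  have := Fintype.ofFinite β
  rw [← Nat.card_congr (Equiv.sigmaFiberEquiv f), Nat.card_sigma]
  simp [h]

/-- By `exists_mul_preserves_stdSub` an element that carries x to x' can be corrected by the
stabilizer of x so that it preserves V_{m,0}. It then permutes the fixed points of Y and carries one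
fiber to the other. -/
theorem card_fiber_fixPts (hE : E ⊆ Op F) {Y X : HatSet E} (hYX : Y.grp = X.grp)
    [MulAction.IsPretransitive X.grp X.carrier] {f : Y.carrier → X.carrier}
    (hf : HatSet.IsMap Y.grp Y X f) {m : ℕ} {x x' : X.carrier} (hx : x ∈ fixPts X m)
    (hx' : x' ∈ fixPts X m) :
    Nat.card {y : Y.carrier // y ∈ fixPts Y m ∧ f y = x'} =
      Nat.card {y : Y.carrier // y ∈ fixPts Y m ∧ f y = x} := by
  obtain ⟨_, _, hff⟩ := hf
  obtain ⟨u, rfl⟩ := MulAction.exists_smul_eq X.grp x x'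
  obtain ⟨s, hs, hus⟩ := exists_mul_preserves_stdSub (hE (X.stab_mem x)) m u hx
    fun g hg => mem_stab_smul.1 (hx' hg)
  obtain ⟨hsX, hsx⟩ := mem_stab.1 hs
  have hgY : (u : Sp F) * s ∈ Y.grp := hYX.ge (mul_mem u.2 hsX)
  have hgx : (⟨(u : Sp F) * s, mul_mem u.2 hsX⟩ : X.grp) • x = u • x := by
    rw [show (⟨(u : Sp F) * s, mul_mem u.2 hsX⟩ : X.grp) = u * ⟨s, hsX⟩ from rfl, mul_smul, hsx]
  refine (Nat.card_congr ((MulAction.toPerm (⟨_, hgY⟩ : Y.grp)).subtypeEquiv fun y => ?_)).symm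
  rw [MulAction.toPerm_apply]
  refine and_congr (smul_mem_fixPts hus).symm ?_
  rw [hff _ hgY, ← hgx]
  exact (MulAction.injective _).eq_iff.symm

theorem cnt_eq_mul {Y X T : HatSet E} (hE : E ⊆ Op F) (h : HatSet.IsFiber Y X T) :
    ∀ᶠ m in atTop, cnt Y m = cnt X m * cnt T m := by
  obtain ⟨hYX, -, -, hXt, f, hf, x, W, hW, j, hj, hj', hjr⟩ := h
  filter_upwards [eventually_fixG_stdSub_le (hE hW),
    eventually_fixG_stdSub_le (hE (X.stab_mem x))] with m hm hmx
  have := (finite_fixPts hE X m).to_subtype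
  have := (finite_fixPts hE Y m).to_subtype
  have hfY : ∀ y ∈ fixPts Y m, f y ∈ fixPts X m := fun y hy =>
    le_stab_of_isMap hf (show fixG (stdSub F m) ≤ Y.grp from hy.trans (Y.stab_le y)) hy
  have hT : Nat.card {y : Y.carrier // y ∈ fixPts Y m ∧ f y = x} = cnt T m := by
    refine (Nat.card_congr (Equiv.ofBijective (fun t : fixPts T m =>
      (⟨j t, (le_stab_iff_of_isMap hj hj' hm).2 t.2, hjr.le ⟨t.1, rfl⟩⟩ :
        {y : Y.carrier // y ∈ fixPts Y m ∧ f y = x})) ⟨fun t t' h =>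
          Subtype.ext (hj' (congrArg Subtype.val h)), ?_⟩)).symm
    rintro ⟨y, hy, hyx⟩
    obtain ⟨t, rfl⟩ := hjr.ge hyx
    exact ⟨⟨t, (le_stab_iff_of_isMap hj hj' hm).1 hy⟩, rfl⟩
  refine card_eq_mul_of_fibers (fun y : fixPts Y m => (⟨f y, hfY y y.2⟩ : fixPts X m)) _ ?_
  rintro ⟨x', hx'⟩
  rw [← hT, ← card_fiber_fixPts hE hYX hf hmx hx']
  exact Nat.card_congr ⟨fun y => ⟨y.1.1, y.1.2, congrArg Subtype.val y.2⟩,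
    fun y => ⟨⟨y.1, y.2.1⟩, Subtype.ext y.2.2⟩, fun _ => rfl, fun _ => rfl⟩

/-- The germ at infinity of the counting function of a `Ĝ`-set. -/
noncomputable def cntGerm (X : HatSet E) : Germ (atTop : Filter ℕ) ℚ := ((fun m => (cnt X m : ℚ)) :)

theorem isMeasure_cntGerm (hE : E ⊆ Op F) : IsMeasure (cntGerm : HatSet E → _) where
  iso X Y h := Germ.coe_eq.2 (by
    filter_upwards [cnt_eq_of_iso hE h] with m hm
    rw [hm])
  point X h := Germ.coe_eq.2 (by
    filter_upwards [cnt_eq_one hE h] with m hm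
    simp [hm])
  coprod X Y Z h := Germ.coe_eq.2 (by
    filter_upwards [cnt_eq_add hE h] with m hm
    simp [hm])
  twist g X Y h := Germ.coe_eq.2 (by
    filter_upwards [cnt_eq_of_isTwist hE h] with m hm
    rw [hm])
  fiber Y X T h := Germ.coe_eq.2 (by
    filter_upwards [cnt_eq_mul hE h] with m hm
    simp [hm])

theorem cnt_hatVE [IsStabClass E] (m : ℕ) : cnt (hatVE E) m = Nat.card F ^ (2 * m) := by
  have h1 : Nat.card (Std F m 0) = Nat.card (stdSub F m) :=
    Nat.card_congr (LinearEquiv.ofInjective (stdEmb F m).1 (stdEmb F m).2.1).toEquiv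
  rw [card_std, add_zero] at h1
  rw [h1]
  refine Nat.card_congr (Equiv.subtypeEquivRight fun v => ?_)
  -- By `fixG_le_fixG` the vectors fixed by G(V_{m,0}) are exactly those of V_{m,0}.
  exact (iff_of_eq (congrArg (fixG (stdSub F m) ≤ ·) (stab_hatVE v))).trans
    (fixG_le_fixG.trans (Submodule.span_singleton_le_iff_mem _ _))

omit [Finite F] in
theorem stab_ofGSet (hE : ⊤ ∈ E) (X : Type u) [MulAction (Sp F) X]
    (hs : ∀ x : X, MulAction.stabilizer (Sp F) x ∈ E)
    (hf : Finite (MulAction.orbitRel.Quotient (Sp F) X)) (x : X) :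
    (HatSet.ofGSet hE X hs hf).stab x = MulAction.stabilizer (Sp F) x := by
  ext g
  exact mem_stab.trans ⟨fun ⟨_, h⟩ => h, fun h => ⟨trivial, h⟩⟩

omit [Finite F] in
theorem stabilizer_embX {a b : ℕ} (i : EmbX F a b) :
    MulAction.stabilizer (Sp F) i = fixG (LinearMap.range i.1) := by
  ext g
  rw [MulAction.mem_stabilizer_iff, mem_fixG]
  constructor
  · rintro h _ ⟨x, rfl⟩
    exact LinearMap.congr_fun (congrArg Subtype.val h) x
  · intro h
    exact Subtype.ext (LinearMap.ext fun x => h _ ⟨x, rfl⟩)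

theorem cnt_hatX (a b m : ℕ) : cnt (hatX F a b) m = numEmb F a b m 0 := by
  have hmem : ∀ i : EmbX F a b, i ∈ fixPts (hatX F a b) m ↔ LinearMap.range i.1 ≤ stdSub F m := by
    intro i
    have hst : (hatX F a b).stab i = fixG (LinearMap.range i.1) :=
      (stab_ofGSet _ _ _ _ i).trans (stabilizer_embX i)
    exact (iff_of_eq (congrArg (fixG (stdSub F m) ≤ ·) hst)).trans fixG_le_fixG
  let φ := LinearEquiv.ofInjective (stdEmb F m).1 (stdEmb F m).2.1
  refine (Nat.card_congr (Equiv.ofBijective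
    (fun k : Embedding (formStd F a b) (formStd F m 0) =>
      (⟨⟨(stdEmb F m).1 ∘ₗ k.1, (stdEmb F m).2.1.comp k.2.1,
        fun v w => ((stdEmb F m).2.2 _ _).trans (k.2.2 v w)⟩, (hmem _).2 (by
          rintro _ ⟨x, rfl⟩
          exact ⟨k.1 x, rfl⟩)⟩ : fixPts (hatX F a b) m)) ⟨fun k k' h => ?_, ?_⟩)).symm
  · refine Subtype.ext (LinearMap.ext fun x => (stdEmb F m).2.1 ?_)
    exact LinearMap.congr_fun (congrArg (fun i : fixPts (hatX F a b) m => (i.1 : EmbX F a b).1) h) x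
  · rintro ⟨i, hi⟩
    let k : Std F a b →ₗ[F] Std F m 0 := φ.symm.toLinearMap ∘ₗ
      (LinearMap.codRestrict (stdSub F m) i.1 fun x => (hmem i).1 hi ⟨x, rfl⟩)
    have hk : ∀ x, (stdEmb F m).1 (k x) = i.1 x := fun x =>
      congrArg Subtype.val (φ.apply_symm_apply ⟨i.1 x, (hmem i).1 hi ⟨x, rfl⟩⟩)
    refine ⟨⟨k, fun x y h => i.2.1 (by rw [← hk, ← hk, h]), fun v w => ?_⟩,
      Subtype.ext (Subtype.ext (LinearMap.ext hk))⟩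
    rw [← (stdEmb F m).2.2, hk, hk, i.2.2]

/-- For a map of transitive `G`-sets and large `m`, the maps from `X_{m,0}` are counted by the fixed
points of `G(V_{m,0})` in the fiber. -/
theorem eventually_card_hom_fiber {X Y : Type u} [MulAction (Sp F) X] [MulAction (Sp F) Y]
    [MulAction.IsPretransitive (Sp F) X] [MulAction.IsPretransitive (Sp F) Y]
    (hX : ∀ x : X, MulAction.stabilizer (Sp F) x ∈ EV F)
    (hY : ∀ y : Y, MulAction.stabilizer (Sp F) y ∈ EV F) (f : Y →[Sp F] X) (x : X) :
    ∀ᶠ m : ℕ in atTop, Nonempty (EmbX F m 0 →[Sp F] X) ∧ ∀ p : EmbX F m 0 →[Sp F] X,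
      Nat.card {r : EmbX F m 0 →[Sp F] Y // f.comp r = p} = cnt (HatSet.fiber f hX hY x) m := by
  have hstd : ∀ m, MulAction.stabilizer (Sp F) (stdEmb F m) = fixG (stdSub F m) := fun m =>
    stabilizer_embX _
  -- The set X_{m,0} is G/G(V_{m,0}). Evaluation at the standard embedding therefore identifies the
  -- `G`-maps from it to Z with the points of Z fixed by G(V_{m,0}).
  have homOf : ∀ (m : ℕ) (Z : Type u) [MulAction (Sp F) Z] (z : Z),
      fixG (stdSub F m) ≤ MulAction.stabilizer (Sp F) z →
      ∃ r : EmbX F m 0 →[Sp F] Z, r (stdEmb F m) = z := by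
    intro m Z _ z hz
    choose c hc using fun i : EmbX F m 0 => MulAction.exists_smul_eq (Sp F) (stdEmb F m) i
    have key : ∀ g : Sp F, c (g • stdEmb F m) • z = g • z := by
      intro g
      have : g⁻¹ * c (g • stdEmb F m) ∈ MulAction.stabilizer (Sp F) z := by
        refine hz (hstd m ▸ ?_)
        rw [MulAction.mem_stabilizer_iff, mul_smul, hc, inv_smul_smul]
      rwa [MulAction.mem_stabilizer_iff, mul_smul, inv_smul_eq_iff] at this
    refine ⟨⟨fun i => c i • z, fun g i => ?_⟩, ?_⟩
    · obtain ⟨g', rfl⟩ := MulAction.exists_smul_eq (Sp F) (stdEmb F m) i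
      rw [← mul_smul, key, key, mul_smul]
      rfl
    · have := key 1
      rw [one_smul, one_smul] at this
      exact this
  have homFix : ∀ (m : ℕ) (Z : Type u) [MulAction (Sp F) Z] (r : EmbX F m 0 →[Sp F] Z),
      fixG (stdSub F m) ≤ MulAction.stabilizer (Sp F) (r (stdEmb F m)) := by
    intro m Z _ r g hg
    rw [← hstd, MulAction.mem_stabilizer_iff] at hg
    rw [MulAction.mem_stabilizer_iff, ← map_smul, hg]
  have homExt : ∀ (m : ℕ) (Z : Type u) [MulAction (Sp F) Z] (r r' : EmbX F m 0 →[Sp F] Z),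
      r (stdEmb F m) = r' (stdEmb F m) → r = r' := by
    intro m Z _ r r' h
    refine MulActionHom.ext fun i => ?_
    obtain ⟨g, rfl⟩ := MulAction.exists_smul_eq (Sp F) (stdEmb F m) i
    rw [map_smul, map_smul, h]
  have orb : ∀ (Z : Type u) [MulAction (Sp F) Z] [MulAction.IsPretransitive (Sp F) Z],
      Finite (MulAction.orbitRel.Quotient (Sp F) Z) := fun Z _ _ => by
    have := (MulAction.pretransitive_iff_subsingleton_quotient (Sp F) Z).1 inferInstance
    infer_instance
  let HX : HatSet (EV F) := HatSet.ofGSet (top_mem_stabClass _ _) X hX (orb X)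
  let HY : HatSet (EV F) := HatSet.ofGSet (top_mem_stabClass _ _) Y hY (orb Y)
  have hHXt : MulAction.IsPretransitive HX.grp HX.carrier := ⟨fun a b => by
    obtain ⟨g, hg⟩ := MulAction.exists_smul_eq (Sp F) (show X from a) (show X from b)
    exact ⟨⟨g, trivial⟩, hg⟩⟩
  have hmap : HatSet.IsMap HY.grp HY HX f := ⟨le_rfl, le_rfl, fun g _ y => map_smul f g (show Y from y)⟩
  have memX : ∀ m (z : X), z ∈ fixPts HX m ↔ fixG (stdSub F m) ≤ MulAction.stabilizer (Sp F) z :=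
    fun m z => by rw [← stab_ofGSet (top_mem_stabClass _ _) X hX (orb X) z]; rfl
  have memY : ∀ m (z : Y), z ∈ fixPts HY m ↔ fixG (stdSub F m) ≤ MulAction.stabilizer (Sp F) z :=
    fun m z => by rw [← stab_ofGSet (top_mem_stabClass _ _) Y hY (orb Y) z]; rfl
  filter_upwards [eventually_fixG_stdSub_le (stabClass_subset _ _ (hX x))] with m hm
  refine ⟨⟨(homOf m X x hm).choose⟩, fun p => ?_⟩
  have h1 : Nat.card {r : EmbX F m 0 →[Sp F] Y // f.comp r = p} =
      Nat.card {y : Y // y ∈ fixPts HY m ∧ f y = p (stdEmb F m)} := by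
    refine Nat.card_congr (Equiv.ofBijective (fun r => ⟨r.1 (stdEmb F m),
      (memY m _).2 (homFix m Y r.1), DFunLike.congr_fun r.2 (stdEmb F m)⟩) ⟨fun r r' h => ?_, ?_⟩)
    · exact Subtype.ext (homExt m Y _ _ (congrArg Subtype.val h))
    · rintro ⟨y, hy, hyp⟩
      obtain ⟨r, hr⟩ := homOf m Y y ((memY m y).1 hy)
      refine ⟨⟨r, homExt m X _ _ ?_⟩, Subtype.ext hr⟩
      rw [← hyp, ← hr]
      rfl
  rw [h1]
  refine (card_fiber_fixPts (stabClass_subset _ _) (Y := HY) (X := HX) rfl hmap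
    ((memX m x).2 hm) ((memX m _).2 (homFix m X p))).trans ?_
  have memT : ∀ y : f ⁻¹' {x}, y ∈ fixPts (HatSet.fiber f hX hY x) m ↔ y.1 ∈ fixPts HY m := by
    intro y
    rw [memY]
    constructor
    · intro h g hg
      obtain ⟨h1, h2⟩ := mem_stab.1 (h hg)
      exact congrArg Subtype.val h2
    · intro h g hg
      exact mem_stab.2 ⟨hm hg, Subtype.ext (h hg)⟩
  exact Nat.card_congr ⟨fun y => ⟨⟨y.1, y.2.2⟩, (memT _).2 y.2.1⟩,
    fun y => ⟨y.1.1, (memT _).1 y.2, y.1.2⟩, fun _ => rfl, fun _ => rfl⟩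

end Count
end InfSp

/-! ### Measures as homomorphisms from Θ -/

namespace Olig
variable {G : Type u} [Group G] {E : Set (Subgroup G)} {k : Type v} [CommRing k]
  {k' : Type w} [CommRing k']

theorem IsMeasure.comp {μ : HatSet E → k} (hμ : IsMeasure μ) (f : k →+* k') :
    IsMeasure fun X => f (μ X) where
  iso X Y h := by rw [hμ.iso X Y h]
  point X h := by rw [hμ.point X h, map_one]
  coprod X Y Z h := by rw [hμ.coprod X Y Z h, map_add]
  twist g X Y h := by rw [hμ.twist g X Y h]
  fiber Y X T h := by rw [hμ.fiber Y X T h, map_mul]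

theorem IsMeasure.of_injective {μ : HatSet E → k} {f : k →+* k'} (hf : Function.Injective f)
    (hμ : IsMeasure fun X => f (μ X)) : IsMeasure μ where
  iso X Y h := hf (hμ.iso X Y h)
  point X h := hf ((hμ.point X h).trans (map_one f).symm)
  coprod X Y Z h := hf ((hμ.coprod X Y Z h).trans (map_add f _ _).symm)
  twist g X Y h := hf (hμ.twist g X Y h)
  fiber Y X T h := hf ((hμ.fiber Y X T h).trans (map_mul f _ _).symm)

/-- Applied with the diagonal of `k × k` as subring, this turns generation by the value on 𝐕 into
uniqueness. -/
theorem IsMeasure.prod {μ : HatSet E → k} {μ' : HatSet E → k'} (hμ : IsMeasure μ)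
    (hμ' : IsMeasure μ') : IsMeasure fun X => (μ X, μ' X) where
  iso X Y h := Prod.ext (hμ.iso X Y h) (hμ'.iso X Y h)
  point X h := Prod.ext (hμ.point X h) (hμ'.point X h)
  coprod X Y Z h := Prod.ext (hμ.coprod X Y Z h) (hμ'.coprod X Y Z h)
  twist g X Y h := Prod.ext (hμ.twist g X Y h) (hμ'.twist g X Y h)
  fiber Y X T h := Prod.ext (hμ.fiber Y X T h) (hμ'.fiber Y X T h)

namespace Theta

theorem isMeasure_cls : IsMeasure (cls : HatSet E → Theta E) where
  iso X Y h := mk_eq_of_rel (.iso X Y h)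
  point X h := mk_eq_of_rel (.point X h)
  coprod X Y Z h := mk_eq_of_rel (.coprod X Y Z h)
  twist g X Y h := mk_eq_of_rel (.twist g X Y h)
  fiber Y X T h := mk_eq_of_rel (.fiber Y X T h)

/-- The ring homomorphism from `Θ` given by a measure. -/
noncomputable def lift {μ : HatSet E → k} (hμ : IsMeasure μ) : Theta E →+* k :=
  Ideal.Quotient.lift _ (MvPolynomial.aeval μ).toRingHom <| by
    intro a ha
    refine Submodule.span_induction (p := fun a _ => (MvPolynomial.aeval μ).toRingHom a = 0)
      ?_ (map_zero _) (fun x y _ _ hx hy => by rw [map_add, hx, hy, add_zero])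
      (fun c x _ hx => by rw [smul_eq_mul, map_mul, hx, mul_zero]) ha
    rintro x ⟨p, q, hpq, hx⟩
    obtain rfl : x = p - q := eq_sub_of_add_eq hx
    rw [map_sub, sub_eq_zero]
    cases hpq with
    | iso X Y h => simpa using hμ.iso X Y h
    | point X h => simpa using hμ.point X h
    | coprod X Y Z h => simpa using hμ.coprod X Y Z h
    | twist g X Y h => simpa using hμ.twist g X Y h
    | fiber Y X T h => simpa using hμ.fiber Y X T h

theorem lift_cls {μ : HatSet E → k} (hμ : IsMeasure μ) (X : HatSet E) : lift hμ (cls X) = μ X := by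
  simp [lift, cls]

theorem mem_of_cls_mem (K : Subring (Theta E)) (h : ∀ X, cls X ∈ K) (z : Theta E) : z ∈ K := by
  obtain ⟨p, rfl⟩ := Ideal.Quotient.mk_surjective z
  induction p using MvPolynomial.induction_on with
  | C n =>
    have : (MvPolynomial.C n : MvPolynomial (HatSet E) ℤ) = n := map_intCast MvPolynomial.C n
    rw [this, map_intCast]
    exact intCast_mem K n
  | add p q hp hq =>
    rw [map_add]
    exact add_mem hp hq
  | mul_X p X hp =>
    rw [map_mul]
    exact mul_mem hp (h X)

theorem mem_range_of_cls {R : Type*} [CommRing R] (f : R →+* k) (g : Theta E →+* k)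
    (h : ∀ X, ∃ p, f p = g (cls X)) (z : Theta E) : ∃ p, f p = g z :=
  mem_of_cls_mem (f.range.comap g) h z

theorem map_cls {E' : Set (Subgroup G)} (h : E ⊆ E') (X : HatSet E) :
    map h (cls X) = cls (X.ofSubset h) := by
  simp [map, cls]

end Theta
end Olig

namespace InfSp
open Filter

theorem natCast_mul_map_eq_one {R S : Type*} [CommRing R] [CommRing S] (f : R →+* S) {r : R}
    {n : ℕ} (h : r * n = 1) : (n : S) * f r = 1 := by
  rw [← map_natCast f, ← map_mul, mul_comm, h, map_one]

/-! ### Values of measures in the image of a polynomial ring -/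

section Range
variable {F : Type u} [Field F] [Finite F] {k : Type w} [CommRing k] {R : Type*} [CommRing R]

theorem measure_mem_range_EV {μ : HatSet (EV F) → k} (hμ : IsMeasure μ) (f : R →+* k)
    (hV : ∃ p, f p = μ (hatV F)) (hq : ∃ r : R, r * Nat.card F = 1) (X : HatSet (EV F)) :
    ∃ p, f p = μ X := by
  obtain ⟨r, hr⟩ := hq
  exact measure_mem_EV hμ f.range hV ⟨f r, ⟨r, rfl⟩, by
    rw [← map_natCast f, ← map_mul, hr, map_one]⟩ X

theorem measure_mem_range_Op {μ : HatSet (Op F) → k} (hμ : IsMeasure μ) (f : Polynomial ℚ →+* k)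
    (hV : ∃ p, f p = μ (hatVE (Op F))) (X : HatSet (Op F)) : ∃ p, f p = μ X :=
  measure_mem_Op hμ f.range hV (fun n hn => ⟨f (Polynomial.C (n : ℚ)⁻¹), ⟨_, rfl⟩, by
    rw [← map_natCast f, ← map_mul, ← map_natCast Polynomial.C, ← map_mul,
      inv_mul_cancel₀ (Nat.cast_ne_zero.2 hn), map_one, map_one]⟩) X

end Range

/-! ### Counting functions are polynomials in q^{2m} -/

section Polynomials
variable (F : Type u) [Field F] [Finite F]

/-- The germ at infinity of the values of a polynomial at the powers `q^{2m}`. -/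
noncomputable def evalGerm : Polynomial ℚ →+* Germ (atTop : Filter ℕ) ℚ :=
  (Germ.coeRingHom atTop).comp
    (RingHom.pi fun m => Polynomial.evalRingHom ((Nat.card F : ℚ) ^ (2 * m)))

omit [Field F] [Finite F] in
theorem evalGerm_eq_iff (p : Polynomial ℚ) (g : ℕ → ℚ) : evalGerm F p = (g : Germ atTop ℚ) ↔
    ∀ᶠ m in atTop, p.eval ((Nat.card F : ℚ) ^ (2 * m)) = g m :=
  Germ.coe_eq

/-- A polynomial with zero germ vanishes at infinitely many of the distinct numbers q^{2m}. -/
theorem evalGerm_injective : Function.Injective (evalGerm F) := by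
  refine (injective_iff_map_eq_zero _).2 fun p hp => ?_
  obtain ⟨N, hN⟩ := eventually_atTop.1 ((evalGerm_eq_iff F p 0).1 hp)
  refine Polynomial.eq_zero_of_infinite_isRoot p (Set.Infinite.mono ?_ (Set.infinite_range_of_injective
    (f := fun m : ℕ => (Nat.card F : ℚ) ^ (2 * (N + m))) fun a b hab => ?_))
  · rintro _ ⟨m, rfl⟩
    exact hN _ (Nat.le_add_right _ _)
  · have h1 : (1 : ℚ) < Nat.card F := by exact_mod_cast Finite.one_lt_card
    have := pow_right_injective₀ (zero_lt_one.trans h1) h1.ne' hab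
    omega

theorem zqToRat_injective : Function.Injective (zqToRat F) := by
  refine (injective_iff_map_eq_zero _).2 fun z hz => ?_
  obtain ⟨n, a, ha⟩ := IsLocalization.Away.surj (Nat.card F : ℤ) z
  have h1 := congrArg (zqToRat F) ha
  rw [map_mul, hz, zero_mul, eq_intCast, map_intCast] at h1
  have h2 : a = 0 := by exact_mod_cast h1.symm
  rw [h2, map_zero] at ha
  have hu : IsUnit ((algebraMap ℤ (Zq F)) (Nat.card F : ℤ) ^ n) :=
    (IsLocalization.Away.algebraMap_isUnit _).pow n
  exact (hu.mul_left_eq_zero).1 ha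

/-- The germ at infinity of the values at the powers `q^{2m}` of a polynomial over `ℤ[1/q]`. -/
noncomputable def evalGermZq : Polynomial (Zq F) →+* Germ (atTop : Filter ℕ) ℚ :=
  (evalGerm F).comp (Polynomial.mapRingHom (zqToRat F))

theorem evalGermZq_injective : Function.Injective (evalGermZq F) :=
  (evalGerm_injective F).comp (Polynomial.map_injective _ (zqToRat_injective F))

theorem evalGermZq_eq_iff (p : Polynomial (Zq F)) (g : ℕ → ℕ) :
    evalGermZq F p = ((fun m => (g m : ℚ)) : Germ atTop ℚ) ↔
      ∀ᶠ m in atTop, p.eval ((Nat.card F : Zq F) ^ (2 * m)) = g m := by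
  refine (evalGerm_eq_iff F _ _).trans (eventually_congr (Eventually.of_forall fun m => ?_))
  rw [← (zqToRat_injective F).eq_iff, map_natCast, Polynomial.coe_mapRingHom,
    ← map_natCast (zqToRat F) (Nat.card F), ← map_pow, Polynomial.eval_map, Polynomial.eval₂_at_apply]

omit [Field F] [Finite F] in
theorem exists_mul_card_eq_one :
    ∃ r : Polynomial (Zq F), r * (Nat.card F : Polynomial (Zq F)) = 1 := by
  obtain ⟨u, hu⟩ := (isUnit_card_Zq F).map (Polynomial.C : Zq F →+* _)
  refine ⟨↑u⁻¹, ?_⟩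
  rw [← map_natCast Polynomial.C, ← hu, Units.inv_mul]

theorem cntGerm_hatVE {E : Set (Subgroup (Sp F))} [IsStabClass E] :
    cntGerm (hatVE E) = evalGerm F Polynomial.X := by
  refine ((evalGerm_eq_iff F _ _).2 (Eventually.of_forall fun m => ?_)).symm
  rw [cnt_hatVE]
  simp

variable {F}

/-- The range of `evalGerm` is a subring that contains the germ of 𝐕, the image of t, and all
inverses of positive integers. So it contains every value of the counting measure. -/
theorem exists_poly_Op (X : HatSet (Op F)) : ∃ p, evalGerm F p = cntGerm X :=
  measure_mem_range_Op (isMeasure_cntGerm subset_rfl) (evalGerm F)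
    ⟨_, (cntGerm_hatVE F).symm⟩ X

theorem exists_poly_EV (X : HatSet (EV F)) : ∃ p, evalGermZq F p = cntGerm X := by
  refine measure_mem_range_EV (R := Polynomial (Zq F)) (isMeasure_cntGerm (stabClass_subset _ _))
    (evalGermZq F) ?_
    (exists_mul_card_eq_one F) X
  refine ⟨Polynomial.X, ?_⟩
  rw [evalGermZq, RingHom.comp_apply, Polynomial.coe_mapRingHom, Polynomial.map_X]
  exact (cntGerm_hatVE F (E := EV F)).symm

/-- The polynomial that counts the points of a `𝐕`-smooth `Ĝ`-set. -/
noncomputable def polyEV (X : HatSet (EV F)) : Polynomial (Zq F) := (exists_poly_EV X).choose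

theorem evalGermZq_polyEV (X : HatSet (EV F)) : evalGermZq F (polyEV X) = cntGerm X :=
  (exists_poly_EV X).choose_spec

/-- The polynomial that counts the points of a `Ĝ`-set. -/
noncomputable def polyOp (X : HatSet (Op F)) : Polynomial ℚ := (exists_poly_Op X).choose

theorem evalGerm_polyOp (X : HatSet (Op F)) : evalGerm F (polyOp X) = cntGerm X :=
  (exists_poly_Op X).choose_spec

theorem isMeasure_polyEV : IsMeasure (polyEV : HatSet (EV F) → _) := by
  refine IsMeasure.of_injective (evalGermZq_injective F) ?_
  simp only [evalGermZq_polyEV]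
  exact isMeasure_cntGerm (stabClass_subset _ _)

theorem isMeasure_polyOp : IsMeasure (polyOp : HatSet (Op F) → _) := by
  refine IsMeasure.of_injective (evalGerm_injective F) ?_
  simp only [evalGerm_polyOp]
  exact isMeasure_cntGerm subset_rfl

theorem polyEV_hatV : polyEV (hatV F) = Polynomial.X := by
  refine evalGermZq_injective F ((evalGermZq_polyEV _).trans ?_)
  rw [evalGermZq, RingHom.comp_apply, Polynomial.coe_mapRingHom, Polynomial.map_X]
  exact cntGerm_hatVE F (E := EV F)

theorem polyOp_hatVE : polyOp (hatVE (Op F)) = Polynomial.X :=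
  evalGerm_injective F ((evalGerm_polyOp _).trans (cntGerm_hatVE F))

theorem polyEV_hatX (a b : ℕ) : polyEV (hatX F a b) = Ppoly F a b := by
  refine evalGermZq_injective F ((evalGermZq_polyEV _).trans ?_)
  refine ((evalGermZq_eq_iff F _ _).2 (Eventually.of_forall fun m => ?_)).symm
  rw [Ppoly_eval, cnt_hatX]

theorem polyOp_ofSubset (X : HatSet (EV F)) :
    polyOp (X.ofSubset (stabClass_subset _ _)) = (polyEV X).map (zqToRat F) :=
  evalGerm_injective F ((evalGerm_polyOp _).trans (evalGermZq_polyEV X).symm)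

theorem eventually_eval_polyEV (X : HatSet (EV F)) :
    ∀ᶠ m in atTop, (polyEV X).eval ((Nat.card F : Zq F) ^ (2 * m)) = cnt X m :=
  (evalGermZq_eq_iff F _ _).1 (evalGermZq_polyEV X)

end Polynomials

/-! ### The isomorphisms with polynomial rings and the uniqueness of measures -/

section Isomorphisms
variable (F : Type u) [Field F] [Finite F]

/-- The homomorphism `Θ(G; 𝐕) → ℤ[1/q][t]` given by counting points. -/
noncomputable def thetaEV : Theta (EV F) →+* Polynomial (Zq F) := Theta.lift isMeasure_polyEV

theorem thetaEV_cls (X : HatSet (EV F)) : thetaEV F (Theta.cls X) = polyEV X := Theta.lift_cls _ X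

theorem invertCard_algebraMap (z : Theta (EV F)) :
    invertCard F (thetaEV F) (algebraMap _ _ z) = thetaEV F z :=
  IsLocalization.Away.lift_eq _ (isUnit_map_card F (thetaEV F)) z

/-- The inverse is the map β from ℤ[1/q][t] that sends t to [𝐕]. Counting after β is the identity
because 𝐕 is counted by t, and β is onto by generation for the universal measure. -/
theorem bijective_invertCard : Function.Bijective (invertCard F (thetaEV F)) := by
  let L := Localization.Away (Nat.card F : Theta (EV F))
  have hu : IsUnit (Nat.card F : L) := by
    simpa using IsLocalization.Away.algebraMap_isUnit (S := L) (Nat.card F : Theta (EV F))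
  let i : Zq F →+* L := Localization.awayLift (Int.castRingHom L) (Nat.card F : ℤ) (by simpa using hu)
  let β : Polynomial (Zq F) →+* L :=
    Polynomial.eval₂RingHom i (algebraMap _ L (Theta.cls (hatV F)))
  have hβX : β Polynomial.X = algebraMap _ L (Theta.cls (hatV F)) := Polynomial.eval₂_X _ _
  have hid : (invertCard F (thetaEV F)).comp β = RingHom.id _ := by
    refine Polynomial.ringHom_ext' ?_ ?_
    · exact IsLocalization.ringHom_ext (Submonoid.powers (Nat.card F : ℤ)) (RingHom.ext_int _ _)
    · rw [RingHom.comp_apply, hβX, invertCard_algebraMap, thetaEV_cls, polyEV_hatV,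
        RingHom.id_apply]
  have hcls : ∀ z : Theta (EV F), ∃ p, β p = algebraMap _ L z :=
    Theta.mem_range_of_cls (E := EV F) (R := Polynomial (Zq F)) β (algebraMap _ L)
      (measure_mem_range_EV (R := Polynomial (Zq F)) (Theta.isMeasure_cls.comp (algebraMap _ L)) β ⟨_, hβX⟩
        (exists_mul_card_eq_one F))
  have hsurj : Function.Surjective β := by
    intro x
    obtain ⟨n, a, ha⟩ := IsLocalization.Away.surj (Nat.card F : Theta (EV F)) x
    obtain ⟨p, hp⟩ := hcls a
    obtain ⟨r, hr⟩ := exists_mul_card_eq_one F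
    have hr' : (Nat.card F : L) * β r = 1 := by
      exact natCast_mul_map_eq_one (R := Polynomial (Zq F)) β hr
    -- By `ha`, x times q^n is the image of a class a in Θ(G;𝐕), and r is the inverse of q in
    -- ℤ[1/q][t].
    refine ⟨p * r ^ n, ?_⟩
    rw [map_mul, hp, ← ha, map_natCast, map_pow, mul_assoc, ← mul_pow, hr', one_pow, mul_one]
  have hid' : ∀ p, invertCard F (thetaEV F) (β p) = p := fun p => RingHom.congr_fun hid p
  refine ⟨fun x y hxy => ?_, fun p => ⟨β p, hid' p⟩⟩
  obtain ⟨p, rfl⟩ := hsurj x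
  obtain ⟨p', rfl⟩ := hsurj y
  rw [hid', hid'] at hxy
  rw [hxy]

/-- The homomorphism `Θ(G) → ℚ[t]` given by counting points. -/
noncomputable def thetaOp : Theta (Op F) →+* Polynomial ℚ := Theta.lift isMeasure_polyOp

theorem thetaOp_cls (X : HatSet (Op F)) : thetaOp F (Theta.cls X) = polyOp X := Theta.lift_cls _ X

/-- The homomorphism `Θ(G) ⊗ ℚ → ℚ[t]` given by counting points. -/
noncomputable def thetaRat : Theta (Op F) ⊗[ℤ] ℚ →+* Polynomial ℚ :=
  (Algebra.TensorProduct.productMap (thetaOp F).toIntAlgHom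
    (Polynomial.C : ℚ →+* Polynomial ℚ).toIntAlgHom).toRingHom

theorem thetaRat_tmul (z : Theta (Op F)) (r : ℚ) :
    thetaRat F (z ⊗ₜ r) = thetaOp F z * Polynomial.C r :=
  Algebra.TensorProduct.productMap_apply_tmul _ _ z r

theorem thetaRat_tmul_one (z : Theta (Op F)) : thetaRat F (z ⊗ₜ 1) = thetaOp F z := by
  rw [thetaRat_tmul, map_one, mul_one]

/-- The argument is the one for `bijective_invertCard`, over ℚ, where all the finite indices [S :
G(B)] are invertible. -/
theorem bijective_thetaRat : Function.Bijective (thetaRat F) := by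
  let i : ℚ →+* Theta (Op F) ⊗[ℤ] ℚ :=
    (Algebra.TensorProduct.includeRight : ℚ →ₐ[ℤ] Theta (Op F) ⊗[ℤ] ℚ).toRingHom
  let j : Theta (Op F) →+* Theta (Op F) ⊗[ℤ] ℚ := Algebra.TensorProduct.includeLeftRingHom
  let β : Polynomial ℚ →+* Theta (Op F) ⊗[ℤ] ℚ :=
    Polynomial.eval₂RingHom i (j (Theta.cls (hatVE (Op F))))
  have hβX : β Polynomial.X = j (Theta.cls (hatVE (Op F))) := Polynomial.eval₂_X _ _
  have hβC : ∀ r, β (Polynomial.C r) = 1 ⊗ₜ r := fun r => Polynomial.eval₂_C _ _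
  have hid : (thetaRat F).comp β = RingHom.id _ := by
    refine Polynomial.ringHom_ext' (RingHom.ext_rat _ _) ?_
    rw [RingHom.comp_apply, hβX, RingHom.id_apply]
    exact (thetaRat_tmul_one F _).trans ((thetaOp_cls F _).trans polyOp_hatVE)
  have hcls : ∀ z : Theta (Op F), ∃ p, β p = j z :=
    Theta.mem_range_of_cls (E := Op F) (k := Theta (Op F) ⊗[ℤ] ℚ) (R := Polynomial ℚ) β j
      (measure_mem_range_Op (F := F) (k := Theta (Op F) ⊗[ℤ] ℚ)
        (Theta.isMeasure_cls.comp (k' := Theta (Op F) ⊗[ℤ] ℚ) j) β ⟨_, hβX⟩)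
  have hsurj : Function.Surjective β := by
    intro x
    induction x using TensorProduct.induction_on with
    | zero => exact ⟨0, map_zero β⟩
    | add x y hx hy =>
      obtain ⟨p, rfl⟩ := hx
      obtain ⟨p', rfl⟩ := hy
      exact ⟨p + p', map_add β p p'⟩
    | tmul z r =>
      obtain ⟨p, hp⟩ := hcls z
      refine ⟨p * Polynomial.C r, ?_⟩
      rw [map_mul, hp, hβC]
      change (z ⊗ₜ[ℤ] (1 : ℚ)) * _ = _
      rw [Algebra.TensorProduct.tmul_mul_tmul, mul_one, one_mul]
  have hid' : ∀ p, thetaRat F (β p) = p := fun p => RingHom.congr_fun hid p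
  refine ⟨fun x y hxy => ?_, fun p => ⟨β p, hid' p⟩⟩
  obtain ⟨p, rfl⟩ := hsurj x
  obtain ⟨p', rfl⟩ := hsurj y
  rw [hid', hid'] at hxy
  rw [hxy]

theorem thetaOp_map (z : Theta (EV F)) :
    thetaOp F (Theta.map (stabClass_subset _ _) z) = (thetaEV F z).map (zqToRat F) :=
  Theta.mem_of_cls_mem (((thetaOp F).comp (Theta.map (stabClass_subset _ _))).eqLocus
    ((Polynomial.mapRingHom (zqToRat F)).comp (thetaEV F))) (fun X => by
      change thetaOp F (Theta.map _ (Theta.cls X)) = (thetaEV F (Theta.cls X)).map (zqToRat F)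
      rw [Theta.map_cls, thetaOp_cls, thetaEV_cls, polyOp_ofSubset]) z

variable {F} in
omit [Finite F] in
theorem isMeasure_muOf (Φ : Theta (Op F) ⊗[ℤ] ℚ ≃+* Polynomial ℚ) {k : Type w} [Field k]
    [CharZero k] (t : k) : IsMeasure (muOf Φ t) :=
  Theta.isMeasure_cls.comp (((Polynomial.aeval t : Polynomial ℚ →ₐ[ℚ] k) : Polynomial ℚ →+* k).comp
    ((Φ : Theta (Op F) ⊗[ℤ] ℚ →+* Polynomial ℚ).comp Algebra.TensorProduct.includeLeftRingHom))

/-- The isomorphism `Θ(G) ⊗ ℚ ≅ ℚ[t]` given by counting points. -/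
noncomputable def thetaRatEquiv : Theta (Op F) ⊗[ℤ] ℚ ≃+* Polynomial ℚ :=
  RingEquiv.ofBijective (thetaRat F) (bijective_thetaRat F)

theorem thetaRatEquiv_tmul_one (z : Theta (Op F)) : thetaRatEquiv F (z ⊗ₜ 1) = thetaOp F z :=
  thetaRat_tmul_one F z

theorem muOf_hatVE {k : Type w} [Field k] [CharZero k] (t : k) :
    muOf (thetaRatEquiv F) t (hatVE (Op F)) = t := by
  rw [muOf, thetaRatEquiv_tmul_one, thetaOp_cls, polyOp_hatVE, Polynomial.aeval_X]

variable {F} in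
-- The product measure (μ, ν) has a diagonal value on 𝐕. The diagonal contains the inverses of all
-- positive integers in characteristic 0, so every value is diagonal.
theorem measure_eq_of_hatVE_eq {k : Type w} [Field k] [CharZero k] {μ ν : HatSet (Op F) → k}
    (hμ : IsMeasure μ) (hν : IsMeasure ν) (h : μ (hatVE (Op F)) = ν (hatVE (Op F))) : μ = ν :=
  funext fun X => measure_mem_Op (hμ.prod hν) ((RingHom.fst k k).eqLocus (RingHom.snd k k)) h
    (fun n hn => ⟨((n : k)⁻¹, (n : k)⁻¹), rfl, by
      have : (n : k) ≠ 0 := Nat.cast_ne_zero.2 hn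
      ext <;> simp [this]⟩) X

end Isomorphisms
end InfSp

theorem mainTheorem8 (F : Type u) [Field F] [Finite F] :
    ∃ φ : Theta (EV F) →+* Polynomial (Zq F),
      -- `φ` maps `x_{a,b}` to `P_{a,b}(t)`
      (∀ a b : ℕ, φ (Theta.cls (hatX F a b)) = Ppoly F a b) ∧
      -- `P_{a,b}(q^{2m})` is the number of embeddings `V_{a,b} → V_{m,0}`
      (∀ a b m : ℕ, (Ppoly F a b).eval ((Nat.card F : Zq F) ^ (2 * m)) = (numEmb F a b m 0 : Zq F)) ∧
      -- `φ` is the counting measure of the smooth approximation `X_{m,0}`: for a map `f : Y → X` of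
      -- transitive `𝐕`-smooth `G`-sets with fiber `T` and all large `m`, the set `Hom_G(X_{m,0}, X)`
      -- is non-empty and the fibers of `Hom_G(X_{m,0}, Y) → Hom_G(X_{m,0}, X)` have `φ([T])(q^{2m})`
      -- elements
      (∀ (X Y : Type u) [MulAction (Sp F) X] [MulAction (Sp F) Y]
        [MulAction.IsPretransitive (Sp F) X] [MulAction.IsPretransitive (Sp F) Y] [Nonempty Y]
        (hX : ∀ x : X, MulAction.stabilizer (Sp F) x ∈ EV F)
        (hY : ∀ y : Y, MulAction.stabilizer (Sp F) y ∈ EV F) (f : Y →[Sp F] X) (x : X),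
        ∀ᶠ m : ℕ in Filter.atTop, Nonempty (EmbX F m 0 →[Sp F] X) ∧
          ∀ p : EmbX F m 0 →[Sp F] X,
            (Nat.card {r : EmbX F m 0 →[Sp F] Y // f.comp r = p} : Zq F) =
              (φ (Theta.cls (HatSet.fiber f hX hY x))).eval ((Nat.card F : Zq F) ^ (2 * m))) ∧
      -- `φ` is an isomorphism after inverting `q`
      Function.Bijective (invertCard F φ) ∧
      -- `φ` induces an isomorphism `Θ(G) ⊗ ℚ → ℚ[t]`
      ∃ Φ : TensorProduct ℤ (Theta (Op F)) ℚ ≃+* Polynomial ℚ,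
        (∀ z : Theta (EV F), Φ (Theta.map (stabClass_subset (Sp F) (Vinf F)) z ⊗ₜ[ℤ] (1 : ℚ)) =
          (φ z).map (zqToRat F)) ∧
        -- every measure valued in a field `k` of characteristic `0` is `μ_t` for a unique `t` in
        -- `k`, namely for its value on `𝐕`
        ∀ (k : Type w) [Field k] [CharZero k],
          (∀ t : k, IsMeasure (muOf Φ t) ∧
            muOf Φ t ((hatV F).ofSubset (stabClass_subset (Sp F) (Vinf F))) = t) ∧
          ∀ μ : HatSet (Op F) → k, IsMeasure μ →
            μ = muOf Φ (μ ((hatV F).ofSubset (stabClass_subset (Sp F) (Vinf F)))) := by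
  refine ⟨thetaEV F, fun a b => (thetaEV_cls F _).trans (polyEV_hatX a b), Ppoly_eval F,
    fun X Y _ _ _ _ _ hX hY f x => ?_, bijective_invertCard F,
    thetaRatEquiv F, fun z => (thetaRatEquiv_tmul_one F _).trans (thetaOp_map F z), fun k _ _ => ?_⟩
  · filter_upwards [eventually_card_hom_fiber hX hY f x,
      eventually_eval_polyEV (HatSet.fiber f hX hY x)] with m h1 h2
    refine ⟨h1.1, fun p => ?_⟩
    rw [h1.2 p, thetaEV_cls, h2]
  · exact ⟨fun t => ⟨isMeasure_muOf _ t, muOf_hatVE F t⟩, fun μ hμ =>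
      measure_eq_of_hatVE_eq hμ (isMeasure_muOf _ _) (muOf_hatVE F _).symm⟩
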